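/- **Setting.** Let $\tau\in(0,1)$ and a kernel $K:\mathbb R\to\mathbb R$ be fixed. Along a sequence of problems, $N=mn\to\infty$, where $m$ is the number of machines and $n$ the local sample size; $p$, $s$, the law of $(X,Y)$ and all other quantities may change along the sequence, while the constants $f_1,f_2,l_0,c_1,\alpha,\lambda_-,\lambda_+,\nu,c,r$ below do not. $X=(x_0,\dots,x_p)^{\mathrm T}$ with $x_0\equiv1$ and finite second moments, $Y\in\mathbb R$, and the conditional $\tau$-quantile of $Y$ given $X$ is $X^{\mathrm T}\beta^*$, $\beta^*\in\mathbb R^{p+1}$. Put $\varepsilon=Y-X^{\mathrm T}\beta^*$, with conditional density $f_{\varepsilon|X}$ given $X$. For $\beta\in\mathbb R^{p+1}$ let $\operatorname{supp}(\beta)=\{1\le j\le p:\beta_j\ne0\}$ (the intercept is not counted), $S=\operatorname{supp}(\beta^*)$, $s=|S|\ge1$, $S^c=\{1,\dots,p\}\setminus S$. The data $(X_i,Y_i)$, $i=1,\dots,N$, are i.i.d. copies of $(X,Y)$, and the first (central) machine $\mathcal M_1$ holds the first $n$ of them. **Estimator.** Given an initial estimator $\hat\beta_0$, write $K_h(u)=K(u/h)/h$,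 $\hat e_i=Y_i-X_i^{\mathrm T}\hat\beta_0$, $$\hat D_h=\frac1N\sum_{i=1}^N K_h(\hat e_i)X_iX_i^{\mathrm T},\qquad \hat D_{1,b}=\frac1n\sum_{i\in\mathcal M_1}K_b(\hat e_i)X_iX_i^{\mathrm T},\qquad z_N=\hat D_h\hat\beta_0-\frac1N\sum_{i=1}^N X_i\{I(\hat e_i\le0)-\tau\}.$$ The one-step DHSQR estimator $\hat\beta_{1,h}$ is any minimizer over $\beta\in\mathbb R^{p+1}$ of $$\tfrac12\beta^{\mathrm T}\hat D_{1,b}\beta-\beta^{\mathrm T}\{z_N+(\hat D_{1,b}-\hat D_h)\hat\beta_0\}+\lambda_N|\beta|_1 .$$ **Assumptions.** 1. $K$ is symmetric, nonnegative, bounded, integrates to one, $\int u^2K(u)\,du<\infty$, $\min_{|u|\le1}K(u)>0$, and $K$ is differentiable with bounded derivative. 2. $0<f_1\le f_{\varepsilon|X}(0)\le f_2$ and $|f_{\varepsilon|X}(u)-f_{\varepsilon|X}(v)|\le l_0|u-v|$ for all $u,v\in\mathbb R$, almost surely. 3. With $\Sigma=E(XX^{\mathrm T})$ and some $c_1>0$,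 $P(|X^{\mathrm T}\Sigma^{-1/2}\delta|\ge c_1t)\le2e^{-t^2/2}$ for every unit vector $\delta$ and every $t>0$. 4. $I=E\{f_{\varepsilon|X}(0)XX^{\mathrm T}\}$ satisfies $\|I_{S^c\times S}I_{S\times S}^{-1}\|_\infty\le1-\alpha$ (maximal absolute row sum) for some $0<\alpha<1$, and all eigenvalues of $I$ lie in $[\lambda_-,\lambda_+]$, where $\lambda_\pm>0$. 5. $p=O(N^\nu)$ for some $\nu>0$, $n\ge N^c$ for some $0<c<1$, and $s=O(n^r)$ for some $0\le r<1/3$. 6. $|\hat\beta_0-\beta^*|_2=O_{\mathbb P}(a_N)$ with $a_N\asymp\sqrt{s\log N/n}$, and $P(\operatorname{supp}(\hat\beta_0)\subseteq S)\to1$. **Theorem.** Under Assumptions 1–6, let $h\asymp(s\log N/N)^{1/3}$, $b\asymp(s\log n/n)^{1/3}$, $\eta=\max\{(s\log n/n)^{1/3},\sqrt{s\log N/n}\}$ and $\lambda_N=C(\sqrt{\log N/N}+a_N\eta)$. Then for a sufficiently large constant $C$ the estimator $\hat\beta_{1,h}$ exists and $$|\hat\beta_{1,h}-\beta^*|_2=O_{\mathbb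 P}\Bigl(\sqrt{\tfrac{s\log N}{N}}+\sqrt s\,a_N\eta\Bigr)$$ in the following sense. (i) For every $\epsilon>0$ there is $C_0>0$ such that for every $C\ge C_0$ there is $M$ such that, for all sufficiently large $N$, with probability at least $1-\epsilon$ a minimizer $\hat\beta_{1,h}$ exists and every minimizer satisfies $|\hat\beta_{1,h}-\beta^*|_2\le M(\sqrt{s\log N/N}+\sqrt s\,a_N\eta)$. (ii) If, moreover, $P(|\hat\beta_0-\beta^*|_2\le M_0a_N)\to1$ for some constant $M_0$, then $C_0$ can be chosen independently of $\epsilon$: there is $C_0>0$ such that for every $C\ge C_0$ and every $\epsilon>0$ there is $M$ with the same property. -/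

import Mathlib

open MeasureTheory ProbabilityTheory Filter Topology Matrix
open scoped ENNReal

/-! ### Vectors, supports, rates -/

/-- The Euclidean norm `|u|₂` of a coordinate vector. -/
noncomputable def l2norm {d : ℕ} (u : Fin d → ℝ) : ℝ := √(∑ j, u j ^ 2)

/-- The norm `|u|₁` of a coordinate vector. -/
noncomputable def l1norm {d : ℕ} (u : Fin d → ℝ) : ℝ := ∑ j, |u j|

open Classical in
/-- The support of a coefficient vector `(β₀, β₁, …, β_p)`: the indices `j ∈ {1, …, p}` with
`β_j ≠ 0`. The index `0` belongs to the intercept and is never counted. -/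
noncomputable def slopeSupport {p : ℕ} (β : Fin (p + 1) → ℝ) : Finset (Fin (p + 1)) :=
  Finset.univ.filter fun j => j ≠ 0 ∧ β j ≠ 0

/-- `u ≍ v` for sequences of (eventually) nonnegative reals. -/
def SameOrder (u v : ℕ → ℝ) : Prop :=
  ∃ c > 0, ∃ C > 0, ∀ᶠ k in atTop, c * v k ≤ u k ∧ u k ≤ C * v k

/-- `(s log n / n)^{1/3}`, the order of the bandwidth for a sample of size `n`. -/
noncomputable def bandwidthRate (s n : ℕ) : ℝ := (s * Real.log n / n) ^ ((1 : ℝ) / 3)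

/-- `√(s log N / n)`, the order of the error of the initial estimator. -/
noncomputable def initialRate (s N n : ℕ) : ℝ := √(s * Real.log N / n)

/-- `η = max {(s log n / n)^{1/3}, √(s log N / n)}`. -/
noncomputable def etaRate (s N n : ℕ) : ℝ := max (bandwidthRate s n) (initialRate s N n)

/-- The penalty level `C (√(log N / N) + a η)`. -/
noncomputable def penaltyLevel (C a : ℝ) (s N n : ℕ) : ℝ :=
  C * (√(Real.log N / N) + a * etaRate s N n)

/-- The rate `√(s log N / N) + √s a η`. -/
noncomputable def oneStepRate (a : ℝ) (s N n : ℕ) : ℝ :=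
  √(s * Real.log N / N) + √(s : ℝ) * a * etaRate s N n

/-! ### The smoothing kernel -/

/-- Conditions on the smoothing kernel. -/
structure IsSmoothingKernel (K : ℝ → ℝ) : Prop where
  symm : ∀ u, K (-u) = K u
  nonneg : ∀ u, 0 ≤ K u
  bounded : ∃ B, ∀ u, K u ≤ B
  integral_eq_one : ∫ u, K u = 1
  second_moment : Integrable fun u => u ^ 2 * K u
  pos : ∀ u, |u| ≤ 1 → 0 < K u
  differentiable : Differentiable ℝ K
  deriv_bounded : ∃ B, ∀ u, |deriv K u| ≤ B

/-- `K_h(u) = K(u / h) / h`. -/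
noncomputable def scaledKernel (K : ℝ → ℝ) (h u : ℝ) : ℝ := K (u / h) / h

/-! ### The population: a law `ν` of the pair `(X, Y)` on `ℝ^{p+1} × ℝ` -/

section Population

variable {p : ℕ}

/-- `f x` is the conditional density of `ε = Y - Xᵀβ` given `X = x`, that is, `f` is the density
of the law of `(X, ε)` with respect to (law of `X`) ⊗ (Lebesgue measure). -/
structure IsErrorCondDensity (ν : Measure ((Fin (p + 1) → ℝ) × ℝ)) (β : Fin (p + 1) → ℝ)
    (f : (Fin (p + 1) → ℝ) → ℝ → ℝ) : Prop where
  measurable : Measurable (Function.uncurry f)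
  nonneg : ∀ x u, 0 ≤ f x u
  law_eq : ν.map (fun z => (z.1, z.2 - z.1 ⬝ᵥ β)) =
    (ν.fst.prod volume).withDensity fun z => ENNReal.ofReal (f z.1 z.2)

/-- The linear `τ`-quantile model: `x₀ ≡ 1`, `X` has second moments, and
`Q_τ(Y | X) = min {y : P(Y ≤ y | X) ≥ τ} = Xᵀβ`, where the conditional distribution function of
`Y` given `X = x` is written through the conditional density `f x` of the error. -/
structure IsLinearQuantileModel (τ : ℝ) (ν : Measure ((Fin (p + 1) → ℝ) × ℝ))
    (β : Fin (p + 1) → ℝ) (f : (Fin (p + 1) → ℝ) → ℝ → ℝ) : Prop where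
  isProbabilityMeasure : IsProbabilityMeasure ν
  intercept : ∀ᵐ x ∂ν.fst, x 0 = 1
  memLp : ∀ j, MemLp (fun x : Fin (p + 1) → ℝ => x j) 2 ν.fst
  density : IsErrorCondDensity ν β f
  quantile : ∀ᵐ x ∂ν.fst,
    IsLeast {y : ℝ | τ ≤ ∫ u in Set.Iic (y - x ⬝ᵥ β), f x u} (x ⬝ᵥ β)

/-- The conditional density is Lipschitz with constant `l₀`, and at zero it lies in `[f₁, f₂]`. -/
def CondDensityRegular (ν : Measure ((Fin (p + 1) → ℝ) × ℝ))
    (f : (Fin (p + 1) → ℝ) → ℝ → ℝ) (f₁ f₂ l₀ : ℝ) : Prop :=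
  ∀ᵐ x ∂ν.fst, f₁ ≤ f x 0 ∧ f x 0 ≤ f₂ ∧ ∀ u v, |f x u - f x v| ≤ l₀ * |u - v|

/-- `Σ = E (X Xᵀ)`. -/
noncomputable def secondMoment (ν : Measure ((Fin (p + 1) → ℝ) × ℝ)) :
    Matrix (Fin (p + 1)) (Fin (p + 1)) ℝ :=
  Matrix.of fun i j => ∫ x, x i * x j ∂ν.fst

open scoped MatrixOrder in
/-- Sub-Gaussian covariates: `P(|Xᵀ Σ^{-1/2} δ| ≥ c₁ t) ≤ 2 exp (-t² / 2)` for unit `δ`, `t > 0`. -/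
def SubGaussianCovariates (ν : Measure ((Fin (p + 1) → ℝ) × ℝ)) (c₁ : ℝ) : Prop :=
  ∀ δ : Fin (p + 1) → ℝ, l2norm δ = 1 → ∀ t : ℝ, 0 < t →
    ν.fst.real {x | c₁ * t ≤ |x ⬝ᵥ ((CFC.sqrt (secondMoment ν))⁻¹ *ᵥ δ)|}
      ≤ 2 * Real.exp (-t ^ 2 / 2)

/-- `I = E (f_{ε|X}(0) X Xᵀ)`. -/
noncomputable def populationHessian (ν : Measure ((Fin (p + 1) → ℝ) × ℝ))
    (f : (Fin (p + 1) → ℝ) → ℝ → ℝ) : Matrix (Fin (p + 1)) (Fin (p + 1)) ℝ :=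
  Matrix.of fun i j => ∫ x, f x 0 * (x i * x j) ∂ν.fst

/-- The irrepresentable condition `‖A_{Sᶜ×S} A_{S×S}⁻¹‖_∞ ≤ 1 - α` (maximal absolute row sum),
where `S` is the support of `β` and `Sᶜ = {1, …, p} \ S`. -/
def Irrepresentable (A : Matrix (Fin (p + 1)) (Fin (p + 1)) ℝ) (β : Fin (p + 1) → ℝ)
    (α : ℝ) : Prop :=
  ∀ i : {i : Fin (p + 1) // i ≠ 0 ∧ i ∉ slopeSupport β},
    ∑ j : {j // j ∈ slopeSupport β},
      |(A.submatrix (fun i : {i : Fin (p + 1) // i ≠ 0 ∧ i ∉ slopeSupport β} => (i : Fin (p + 1)))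
            (fun j : {j // j ∈ slopeSupport β} => (j : Fin (p + 1))) *
          (A.submatrix (fun j : {j // j ∈ slopeSupport β} => (j : Fin (p + 1)))
            (fun j : {j // j ∈ slopeSupport β} => (j : Fin (p + 1))))⁻¹) i j| ≤ 1 - α

/-- All eigenvalues of `A` lie in `[lo, hi]`. -/
def EigenvaluesIn (A : Matrix (Fin (p + 1)) (Fin (p + 1)) ℝ) (lo hi : ℝ) : Prop :=
  ∀ t ∈ spectrum ℝ A, lo ≤ t ∧ t ≤ hi

/-- `(X_i, Y_i)`, `i = 1, …, N`, are independent with common law `ν`. -/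
structure IsIIDSample {Ω : Type*} [MeasurableSpace Ω] (P : Measure Ω)
    (ν : Measure ((Fin (p + 1) → ℝ) × ℝ)) {N : ℕ}
    (X : Fin N → Ω → Fin (p + 1) → ℝ) (Y : Fin N → Ω → ℝ) : Prop where
  indep : iIndepFun (fun i ω => (X i ω, Y i ω)) P
  hasLaw : ∀ i, HasLaw (fun ω => (X i ω, Y i ω)) ν P

end Population

/-! ### The one-step distributed estimator

The data are `x i, y i` for `i < m * n`. The central machine holds the first `n` of them. -/

section Estimator

variable {p : ℕ}

/-- The residual `e = y - xᵀβ₀`. -/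
def residualAt (β₀ x : Fin (p + 1) → ℝ) (y : ℝ) : ℝ := y - x ⬝ᵥ β₀

open Classical in
/-- `I(e ≤ 0) - τ`. -/
noncomputable def signScore (τ e : ℝ) : ℝ := (if e ≤ 0 then 1 else 0) - τ

/-- The pseudo covariate `√K_h(e) x`. -/
noncomputable def pseudoCovariate (K : ℝ → ℝ) (h : ℝ) (β₀ x : Fin (p + 1) → ℝ) (y : ℝ) :
    Fin (p + 1) → ℝ :=
  √(scaledKernel K h (residualAt β₀ x y)) • x

/-- The pseudo response `x̃ᵀβ₀ - (I(e ≤ 0) - τ) / √K_h(e)`, meaningful where `K_h(e) > 0`. -/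
noncomputable def pseudoResponse (K : ℝ → ℝ) (h τ : ℝ) (β₀ x : Fin (p + 1) → ℝ) (y : ℝ) : ℝ :=
  pseudoCovariate K h β₀ x y ⬝ᵥ β₀ -
    1 / √(scaledKernel K h (residualAt β₀ x y)) * signScore τ (residualAt β₀ x y)

/-- The product `x̃ ỹ` of pseudo covariate and pseudo response, with the factors
`√K_h(e)` and `1 / √K_h(e)` cancelled, so that it is also meaningful where `K_h(e) = 0`. -/
noncomputable def pseudoProduct (K : ℝ → ℝ) (h τ : ℝ) (β₀ x : Fin (p + 1) → ℝ) (y : ℝ) :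
    Fin (p + 1) → ℝ :=
  (pseudoCovariate K h β₀ x y ⬝ᵥ β₀) • pseudoCovariate K h β₀ x y -
    signScore τ (residualAt β₀ x y) • x

/-- Where `K_h(e) > 0`, `pseudoProduct` is the product of pseudo covariate and response. -/
theorem pseudoProduct_eq (K : ℝ → ℝ) (h τ : ℝ) (β₀ x : Fin (p + 1) → ℝ) (y : ℝ)
    (hpos : 0 < scaledKernel K h (residualAt β₀ x y)) :
    pseudoProduct K h τ β₀ x y =
      pseudoResponse K h τ β₀ x y • pseudoCovariate K h β₀ x y := by
  have hs : √(scaledKernel K h (residualAt β₀ x y)) ≠ 0 := (Real.sqrt_pos.2 hpos).ne'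
  funext j
  simp only [pseudoProduct, pseudoResponse, pseudoCovariate, Pi.sub_apply, Pi.smul_apply,
    smul_eq_mul]
  field_simp

variable {m n : ℕ}

/-- The indices of the observations stored on the central machine. -/
def centralMachine (m n : ℕ) : Finset (Fin (m * n)) :=
  Finset.univ.filter fun i => (i : ℕ) < n

/-- `D̂_{1,b} = n⁻¹ ∑_{i on the central machine} x̃_{i,b} x̃_{i,b}ᵀ`. -/
noncomputable def localHessian (K : ℝ → ℝ) (b : ℝ) (β₀ : Fin (p + 1) → ℝ)
    (x : Fin (m * n) → Fin (p + 1) → ℝ) (y : Fin (m * n) → ℝ) :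
    Matrix (Fin (p + 1)) (Fin (p + 1)) ℝ :=
  (1 / (n : ℝ)) • ∑ i ∈ centralMachine m n,
    vecMulVec (pseudoCovariate K b β₀ (x i) (y i)) (pseudoCovariate K b β₀ (x i) (y i))

/-- `D̂_h = N⁻¹ ∑_i x̃_{i,h} x̃_{i,h}ᵀ`. -/
noncomputable def globalHessian (K : ℝ → ℝ) (h : ℝ) (β₀ : Fin (p + 1) → ℝ)
    (x : Fin (m * n) → Fin (p + 1) → ℝ) (y : Fin (m * n) → ℝ) :
    Matrix (Fin (p + 1)) (Fin (p + 1)) ℝ :=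
  (1 / ((m * n : ℕ) : ℝ)) • ∑ i,
    vecMulVec (pseudoCovariate K h β₀ (x i) (y i)) (pseudoCovariate K h β₀ (x i) (y i))

/-- `z_N = N⁻¹ ∑_i x̃_{i,h} ỹ_{i,h}`. -/
noncomputable def globalMoment (K : ℝ → ℝ) (h τ : ℝ) (β₀ : Fin (p + 1) → ℝ)
    (x : Fin (m * n) → Fin (p + 1) → ℝ) (y : Fin (m * n) → ℝ) : Fin (p + 1) → ℝ :=
  (1 / ((m * n : ℕ) : ℝ)) • ∑ i, pseudoProduct K h τ β₀ (x i) (y i)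

/-- The shifted loss
`(2n)⁻¹ ∑_{i on the central machine} (x̃_{i,b}ᵀβ)² - βᵀ {z_N + (D̂_{1,b} - D̂_h) β₀}`. -/
noncomputable def shiftedLoss (K : ℝ → ℝ) (τ h b : ℝ) (β₀ : Fin (p + 1) → ℝ)
    (x : Fin (m * n) → Fin (p + 1) → ℝ) (y : Fin (m * n) → ℝ) (β : Fin (p + 1) → ℝ) : ℝ :=
  1 / (2 * (n : ℝ)) * ∑ i ∈ centralMachine m n, (pseudoCovariate K b β₀ (x i) (y i) ⬝ᵥ β) ^ 2 -
    β ⬝ᵥ (globalMoment K h τ β₀ x y +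
      (localHessian K b β₀ x y - globalHessian K h β₀ x y) *ᵥ β₀)

/-- `β` is a one-step estimator with initial value `β₀`: it minimizes the `ℓ₁`-penalized shifted
loss over `ℝ^{p+1}`. -/
def IsOneStepEstimator (K : ℝ → ℝ) (τ h b lam : ℝ) (β₀ : Fin (p + 1) → ℝ)
    (x : Fin (m * n) → Fin (p + 1) → ℝ) (y : Fin (m * n) → ℝ) (β : Fin (p + 1) → ℝ) : Prop :=
  IsMinOn (fun β' => shiftedLoss K τ h b β₀ x y β' + lam * l1norm β') Set.univ β

/-- The one-step estimator exists, and every version of it is within `l2norm`-distance `r` of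
`βstar`. -/
def OneStepWithin (K : ℝ → ℝ) (τ h b lam : ℝ) (β₀ : Fin (p + 1) → ℝ)
    (x : Fin (m * n) → Fin (p + 1) → ℝ) (y : Fin (m * n) → ℝ) (βstar : Fin (p + 1) → ℝ)
    (r : ℝ) : Prop :=
  (∃ β, IsOneStepEstimator K τ h b lam β₀ x y β) ∧
    ∀ β, IsOneStepEstimator K τ h b lam β₀ x y β → l2norm (β - βstar) ≤ r

end Estimator

/-!
# The one-step distributed smoothed quantile regression estimator

Write `δ = βinit - βstar`, `ε = Y - Xᵀβstar` and `N = m n`. The global Hessian drops out of the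
gradient of the shifted loss at `βstar`, which equals
`N⁻¹ ∑ X_i {I(ε_i ≤ X_iᵀδ) - τ} - D̂_{1,b} δ` (`gradient_shiftedLoss_apply`). The average splits into
the score at the truth, of size `√(log N / N)`, and increments of the indicator process, which are
`I δ` up to `O(√(log N / N) + |δ|²)`; since `D̂_{1,b}` is within `O(η)` of the population Hessian `I`
on sparse vectors, the gradient is `O(√(log N / N) + a η)` in sup norm. The penalty level
dominates twice this bound when `C` is large, so the basic inequality of the Lasso
(`l2norm_sub_le_of_isMinOn`) confines the error to the cone `|v|₁ ≤ 4 √(s + 1) |v|₂`, where `s + 1`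
accounts for the penalized intercept, and bounds it by a multiple of `√s λ_N`. Existence of a
minimizer follows from the same gradient bound.

The curvature of `D̂_{1,b}` on the cone comes from sparse vectors only: a quadratic form close to `I`
on `L s`-sparse vectors, `L` a large constant, is bounded below on the cone by a derandomized version
of Maurey's argument (`quadratic_lower_of_sparse`, `quadratic_lower_on_cone`).

The random fluctuations have to be controlled uniformly over the unknown direction of `δ`. With
probability close to one, `δ` is `a` times a sparse vector of bounded length, so a union bound over
a grid of sparse vectors suffices (`sparseGrid`, of cardinality `exp (O(s log N))`), together with
Bernstein-type bounds (`measure_lt_abs_average_sub_le`). Three variance proxies enter: a constant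
for the score, order `a` for the indicator increments and order `1 / b` for the
summands of `D̂_{1,b}` (`exists_score_bounds`, `exists_indicatorIncrement_bounds`,
`exists_kernelQuadratic_bounds`); their exponential moments are finite because the covariates are
sub-Gaussian. Between grid points the kernel is Lipschitz and the indicator is monotone
(`abs_sampleMean_kernelQuadratic_sub_le`, `abs_sampleMean_indicatorIncrement_sub_le`).

Collecting the exceptional events gives a finite-sample bound (`measure_not_oneStepWithin_le`). The
union bound over the grid costs `s log N` in the exponent. For the indicator increments it is beaten
by `log N / a` because `s a → 0`, which is where `r < 1/3` is used, and for the local Hessian by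
`n b η²`, which is at least a constant times `s log N`.
-/

/-! ### Coordinate norms and sparsity -/

/-- At most `k` coordinates of `v` are nonzero. -/
def IsSparse {d : ℕ} (k : ℕ) (v : Fin d → ℝ) : Prop :=
  ∃ A : Finset (Fin d), A.card ≤ k ∧ ∀ j ∉ A, v j = 0

lemma l2norm_nonneg {d : ℕ} (u : Fin d → ℝ) : 0 ≤ l2norm u := Real.sqrt_nonneg _

lemma l2norm_sq {d : ℕ} (u : Fin d → ℝ) : l2norm u ^ 2 = ∑ j, u j ^ 2 :=
  Real.sq_sqrt (Finset.sum_nonneg fun _ _ => sq_nonneg _)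

lemma l1norm_nonneg {d : ℕ} (u : Fin d → ℝ) : 0 ≤ l1norm u :=
  Finset.sum_nonneg fun _ _ => abs_nonneg _

lemma l2norm_smul {d : ℕ} (c : ℝ) (u : Fin d → ℝ) : l2norm (c • u) = |c| * l2norm u := by
  unfold l2norm
  rw [← Real.sqrt_sq_eq_abs, ← Real.sqrt_mul (sq_nonneg c), Finset.mul_sum]
  simp [mul_pow]

lemma dotProduct_self_eq_l2norm_sq {d : ℕ} (u : Fin d → ℝ) : u ⬝ᵥ u = l2norm u ^ 2 := by
  rw [l2norm_sq]; simp [dotProduct, sq]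

lemma abs_apply_le_l2norm {d : ℕ} (u : Fin d → ℝ) (j : Fin d) : |u j| ≤ l2norm u := by
  rw [← Real.sqrt_sq_eq_abs]
  exact Real.sqrt_le_sqrt
    (Finset.single_le_sum (f := fun j => u j ^ 2) (fun _ _ => sq_nonneg _) (Finset.mem_univ j))

lemma sum_abs_le_sqrt_mul_l2norm {d t : ℕ} (u : Fin d → ℝ) (T : Finset (Fin d))
    (hT : T.card ≤ t) : ∑ j ∈ T, |u j| ≤ √t * l2norm u := by
  unfold l2norm
  rw [← Real.sqrt_mul (Nat.cast_nonneg _)]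
  apply Real.le_sqrt_of_sq_le
  calc (∑ j ∈ T, |u j|) ^ 2 ≤ T.card * ∑ j ∈ T, |u j| ^ 2 := sq_sum_le_card_mul_sum_sq
    _ ≤ t * ∑ j, u j ^ 2 := by
      simp only [sq_abs]
      gcongr
      exact Finset.subset_univ _

lemma IsSparse.mono {d k k' : ℕ} {v : Fin d → ℝ} (hv : IsSparse k v) (h : k ≤ k') :
    IsSparse k' v := by
  obtain ⟨A, hA, hv⟩ := hv
  exact ⟨A, hA.trans h, hv⟩

lemma IsSparse.add {d k l : ℕ} {u v : Fin d → ℝ} (hu : IsSparse k u) (hv : IsSparse l v) :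
    IsSparse (k + l) (u + v) := by
  classical
  obtain ⟨A, hA, hu⟩ := hu
  obtain ⟨B, hB, hv⟩ := hv
  refine ⟨A ∪ B, (Finset.card_union_le _ _).trans (by omega), fun j hj => ?_⟩
  simp only [Finset.mem_union, not_or] at hj
  simp [hu j hj.1, hv j hj.2]

lemma IsSparse.smul {d k : ℕ} {u : Fin d → ℝ} (hu : IsSparse k u) (c : ℝ) :
    IsSparse k (c • u) := by
  obtain ⟨A, hA, hu⟩ := hu
  exact ⟨A, hA, fun j hj => by simp [hu j hj]⟩

lemma isSparse_single {d : ℕ} (j : Fin d) (c : ℝ) : IsSparse 1 (Pi.single j c : Fin d → ℝ) :=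
  ⟨{j}, by simp, fun i hi => by
    simp only [Finset.mem_singleton] at hi
    simp [hi]⟩

lemma isSparse_zero {d : ℕ} (k : ℕ) : IsSparse k (0 : Fin d → ℝ) := ⟨∅, by simp, by simp⟩

/-! ### The deterministic Lasso inequality -/

lemma quadratic_sub {d : ℕ} {D : Matrix (Fin d) (Fin d) ℝ} (hD : D.IsSymm)
    (w β β' : Fin d → ℝ) :
    (1 / 2 * (β ⬝ᵥ D *ᵥ β) - β ⬝ᵥ w) - (1 / 2 * (β' ⬝ᵥ D *ᵥ β') - β' ⬝ᵥ w) =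
      1 / 2 * ((β - β') ⬝ᵥ D *ᵥ (β - β')) + (β - β') ⬝ᵥ (D *ᵥ β' - w) := by
  have hs : β' ⬝ᵥ D *ᵥ β = β ⬝ᵥ D *ᵥ β' := by
    rw [dotProduct_mulVec, ← mulVec_transpose, hD.eq, dotProduct_comm]
  simp only [mulVec_sub, dotProduct_sub, sub_dotProduct, hs]
  ring

lemma abs_dotProduct_le_mul_l1norm {d : ℕ} (u g : Fin d → ℝ) (c : ℝ) (hg : ∀ j, |g j| ≤ c) :
    |u ⬝ᵥ g| ≤ c * l1norm u := by
  unfold dotProduct l1norm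
  rw [Finset.mul_sum]
  refine (Finset.abs_sum_le_sum_abs _ _).trans (Finset.sum_le_sum fun j _ => ?_)
  rw [abs_mul, mul_comm]
  exact mul_le_mul_of_nonneg_right (hg j) (abs_nonneg _)

lemma continuous_l1norm {d : ℕ} : Continuous (l1norm : (Fin d → ℝ) → ℝ) := by
  unfold l1norm; fun_prop

lemma norm_le_l1norm {d : ℕ} (u : Fin d → ℝ) : ‖u‖ ≤ l1norm u :=
  (pi_norm_le_iff_of_nonneg (l1norm_nonneg u)).2 fun j =>
    Finset.single_le_sum (f := fun j => |u j|) (fun _ _ => abs_nonneg _) (Finset.mem_univ j)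

/-- The penalty dominates the gradient at one point, which makes the objective coercive. -/
lemma exists_isMinOn_penalized {d : ℕ} {D : Matrix (Fin d) (Fin d) ℝ} (hD : D.IsSymm)
    (hpsd : ∀ v, 0 ≤ v ⬝ᵥ D *ᵥ v) (w βs : Fin d → ℝ) {lam : ℝ} (hlam : 0 < lam)
    (hg : ∀ j, |(D *ᵥ βs - w) j| ≤ lam / 2) :
    ∃ β, IsMinOn (fun β => (1 / 2 * (β ⬝ᵥ D *ᵥ β) - β ⬝ᵥ w) + lam * l1norm β) Set.univ β := by
  set F : (Fin d → ℝ) → ℝ := fun β => (1 / 2 * (β ⬝ᵥ D *ᵥ β) - β ⬝ᵥ w) + lam * l1norm β with hF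
  have hcont : Continuous F := by
    simp only [hF, dotProduct, mulVec]
    have := continuous_l1norm (d := d)
    fun_prop
  have hlow : ∀ β, lam / 2 * ‖β‖ + ((1 / 2 * (βs ⬝ᵥ D *ᵥ βs) - βs ⬝ᵥ w)
      - lam / 2 * l1norm βs) ≤ F β := by
    intro β
    have h1 := quadratic_sub hD w β βs
    have h2 := abs_dotProduct_le_mul_l1norm (β - βs) (D *ᵥ βs - w) (lam / 2) hg
    have h3 : l1norm (β - βs) ≤ l1norm β + l1norm βs := by
      unfold l1norm
      rw [← Finset.sum_add_distrib]
      exact Finset.sum_le_sum fun j _ => abs_sub _ _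
    have h4 := hpsd (β - βs)
    have h5 := norm_le_l1norm β
    have h6 := (abs_le.1 h2).1
    simp only [hF]
    nlinarith [mul_le_mul_of_nonneg_left h5 hlam.le, mul_le_mul_of_nonneg_left h3 hlam.le]
  have htend : Tendsto F (cocompact _) atTop := by
    refine tendsto_atTop_mono hlow ?_
    exact tendsto_atTop_add_const_right _ _
      ((tendsto_norm_cocompact_atTop).const_mul_atTop (by positivity))
  obtain ⟨β, hβ⟩ := hcont.exists_forall_le htend
  exact ⟨β, fun β' _ => hβ β'⟩

/-- The basic inequality of the Lasso: when the penalty level is at least twice the sup norm of the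
gradient at a `t`-sparse point `βs`, every minimizer has its error in a cone on which the `ℓ₁` norm
is at most `4 √t` times the Euclidean norm. -/
lemma l2norm_sub_le_of_isMinOn {d t : ℕ} {D : Matrix (Fin d) (Fin d) ℝ} (hD : D.IsSymm)
    (hpsd : ∀ v, 0 ≤ v ⬝ᵥ D *ᵥ v) (w βs : Fin d → ℝ) {lam κ : ℝ} (hlam : 0 < lam) (hκ : 0 < κ)
    (hg : ∀ j, |(D *ᵥ βs - w) j| ≤ lam / 2) (hsp : IsSparse t βs)
    (hre : ∀ v, l1norm v ≤ 4 * √t * l2norm v → κ * l2norm v ^ 2 ≤ v ⬝ᵥ D *ᵥ v)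
    {β : Fin d → ℝ}
    (hβ : IsMinOn (fun β => (1 / 2 * (β ⬝ᵥ D *ᵥ β) - β ⬝ᵥ w) + lam * l1norm β) Set.univ β) :
    l2norm (β - βs) ≤ 3 * √t * lam / κ := by
  classical
  obtain ⟨T, hT, hsupp⟩ := hsp
  have h0 : (1 / 2 * (β ⬝ᵥ D *ᵥ β) - β ⬝ᵥ w) + lam * l1norm β ≤
      (1 / 2 * (βs ⬝ᵥ D *ᵥ βs) - βs ⬝ᵥ w) + lam * l1norm βs := hβ (Set.mem_univ βs)
  have h1 := quadratic_sub hD w β βs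
  set Δ := β - βs with hΔ
  have h2 := (abs_le.1 (abs_dotProduct_le_mul_l1norm Δ (D *ᵥ βs - w) (lam / 2) hg)).1
  have hsplit : l1norm Δ = ∑ j ∈ T, |Δ j| + ∑ j ∈ Tᶜ, |Δ j| := (Finset.sum_add_sum_compl T _).symm
  have hb : l1norm βs - ∑ j ∈ T, |Δ j| + ∑ j ∈ Tᶜ, |Δ j| ≤ l1norm β := by
    have e1 : l1norm βs = ∑ j ∈ T, |βs j| := by
      unfold l1norm
      refine (Finset.sum_subset (Finset.subset_univ T) fun j _ hj => ?_).symm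
      simp [hsupp j hj]
    have e2 : l1norm β = ∑ j ∈ T, |β j| + ∑ j ∈ Tᶜ, |β j| := (Finset.sum_add_sum_compl T _).symm
    have e3 : ∑ j ∈ Tᶜ, |Δ j| = ∑ j ∈ Tᶜ, |β j| := Finset.sum_congr rfl fun j hj => by
      simp [hΔ, hsupp j (Finset.mem_compl.1 hj)]
    rw [e1, e2, e3, ← Finset.sum_sub_distrib]
    gcongr with j
    have := abs_sub_abs_le_abs_sub (βs j) (β j)
    rw [abs_sub_comm] at this
    simp only [hΔ, Pi.sub_apply]
    linarith
  have hS := sum_abs_le_sqrt_mul_l2norm Δ T hT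
  have hq := hpsd Δ
  have hc0 : 0 ≤ ∑ j ∈ Tᶜ, |Δ j| := Finset.sum_nonneg fun _ _ => abs_nonneg _
  set A := ∑ j ∈ T, |Δ j|
  set B := ∑ j ∈ Tᶜ, |Δ j|
  have hmain : 1 / 2 * (Δ ⬝ᵥ D *ᵥ Δ) ≤ 3 / 2 * lam * A - 1 / 2 * lam * B := by
    rw [hsplit] at h2
    nlinarith [mul_le_mul_of_nonneg_left hb hlam.le]
  have hcone : B ≤ 3 * A := by
    by_contra hcon
    nlinarith [mul_pos hlam (sub_pos.2 (not_le.1 hcon))]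
  have hre' := hre Δ (by rw [hsplit]; linarith)
  have hn := l2norm_nonneg Δ
  rcases hn.eq_or_lt with hz | hz
  · rw [← hz]; positivity
  · rw [le_div_iff₀ hκ]
    have : κ * l2norm Δ ^ 2 ≤ 3 * lam * (√t * l2norm Δ) := by
      nlinarith [mul_le_mul_of_nonneg_left hS hlam.le, mul_nonneg hlam.le hc0]
    by_contra hcon
    nlinarith [mul_lt_mul_of_pos_right (not_le.1 hcon) hz]

/-! ### From sparse vectors to the cone -/

/-- The vector `‖Δ‖₁ sgn(Δ_j) e_j`; it averages to `Δ` under the weights `|Δ_j| / ‖Δ‖₁`. -/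
noncomputable def signedAtom {d : ℕ} (Δ : Fin d → ℝ) (j : Fin d) : Fin d → ℝ :=
  Pi.single j (l1norm Δ * SignType.sign (Δ j))

lemma sum_abs_smul_signedAtom {d : ℕ} (Δ : Fin d → ℝ) :
    ∑ j, |Δ j| • signedAtom Δ j = l1norm Δ • Δ := by
  funext i
  simp only [signedAtom, Finset.sum_apply, Pi.smul_apply, smul_eq_mul, Pi.single_apply]
  simp only [mul_ite, mul_zero, Finset.sum_ite_eq, Finset.mem_univ, if_true]
  rw [mul_left_comm, abs_mul_sign]

lemma exists_signedAtom_le {d : ℕ} {Γ : Matrix (Fin d) (Fin d) ℝ} (hΓ : Γ.IsSymm)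
    (Δ u : Fin d → ℝ) (hΔ : 0 < l1norm Δ) :
    ∃ j, (u - Δ + signedAtom Δ j) ⬝ᵥ Γ *ᵥ (u - Δ + signedAtom Δ j) ≤
      u ⬝ᵥ Γ *ᵥ u + (l1norm Δ * ∑ i, |Δ i| * Γ i i - Δ ⬝ᵥ Γ *ᵥ Δ) := by
  by_contra! hcon
  have hs : ∀ a b : Fin d → ℝ, a ⬝ᵥ Γ *ᵥ b = b ⬝ᵥ Γ *ᵥ a := fun a b => by
    rw [dotProduct_mulVec, ← mulVec_transpose, hΓ.eq, dotProduct_comm]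
  set R := u ⬝ᵥ Γ *ᵥ u + (l1norm Δ * ∑ i, |Δ i| * Γ i i - Δ ⬝ᵥ Γ *ᵥ Δ) with hR
  have hV : ∀ j, |Δ j| * (signedAtom Δ j ⬝ᵥ Γ *ᵥ signedAtom Δ j) =
      l1norm Δ ^ 2 * (|Δ j| * Γ j j) := by
    intro j
    simp only [signedAtom, mulVec_single, single_dotProduct]
    simp only [Pi.smul_apply, col_apply, MulOpposite.smul_eq_mul_unop, MulOpposite.unop_op]
    rcases lt_trichotomy (Δ j) 0 with h | h | h
    · rw [sign_neg h, SignType.coe_neg_one]; ring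
    · simp [h]
    · rw [sign_pos h, SignType.coe_one]; ring
  have hlin : ∑ j, |Δ j| * ((u - Δ) ⬝ᵥ Γ *ᵥ signedAtom Δ j) =
      l1norm Δ * ((u - Δ) ⬝ᵥ Γ *ᵥ Δ) := by
    have : ∀ j, |Δ j| * ((u - Δ) ⬝ᵥ Γ *ᵥ signedAtom Δ j) =
        ((u - Δ) ᵥ* Γ) ⬝ᵥ (|Δ j| • signedAtom Δ j) := fun j => by
      rw [dotProduct_smul, dotProduct_mulVec, smul_eq_mul]
    simp only [this]
    rw [← dotProduct_sum, sum_abs_smul_signedAtom, dotProduct_smul, dotProduct_mulVec, smul_eq_mul]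
  have hsum : ∑ j, |Δ j| * ((u - Δ + signedAtom Δ j) ⬝ᵥ Γ *ᵥ (u - Δ + signedAtom Δ j)) =
      l1norm Δ * R := by
    have e : ∀ j, |Δ j| * ((u - Δ + signedAtom Δ j) ⬝ᵥ Γ *ᵥ (u - Δ + signedAtom Δ j)) =
        |Δ j| * ((u - Δ) ⬝ᵥ Γ *ᵥ (u - Δ)) + 2 * (|Δ j| * ((u - Δ) ⬝ᵥ Γ *ᵥ signedAtom Δ j)) +
          l1norm Δ ^ 2 * (|Δ j| * Γ j j) := fun j => by
      rw [← hV j, mulVec_add, dotProduct_add, add_dotProduct, add_dotProduct,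
        hs (signedAtom Δ j) (u - Δ)]
      ring
    simp only [e, Finset.sum_add_distrib, ← Finset.mul_sum, hlin, ← Finset.sum_mul]
    have : ∑ j, |Δ j| = l1norm Δ := rfl
    rw [this, hR]
    simp only [mulVec_sub, dotProduct_sub, sub_dotProduct, hs Δ u]
    ring
  have hlt : ∑ j, |Δ j| * R <
      ∑ j, |Δ j| * ((u - Δ + signedAtom Δ j) ⬝ᵥ Γ *ᵥ (u - Δ + signedAtom Δ j)) := by
    obtain ⟨i, -, hi⟩ := Finset.exists_lt_of_sum_lt (f := fun _ : Fin d => (0 : ℝ))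
      (g := fun j => |Δ j|) (s := Finset.univ) (by rw [Finset.sum_const_zero]; exact hΔ)
    exact Finset.sum_lt_sum
      (fun j _ => mul_le_mul_of_nonneg_left (hcon j).le (abs_nonneg _))
      ⟨i, Finset.mem_univ i, mul_lt_mul_of_pos_left (hcon i) hi⟩
  rw [hsum, ← Finset.sum_mul] at hlt
  exact lt_irrefl _ hlt

/-- A derandomized form of Maurey's empirical method: a quadratic form that is nonnegative on
`k`-sparse vectors is almost nonnegative on vectors of small `ℓ₁` norm. The vector `k Δ` is replaced,
one summand at a time, by a sum of `k` signed atoms, in such a way that the form increases by no more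
than it would on average. -/
lemma quadratic_lower_of_sparse {d k : ℕ} {Γ : Matrix (Fin d) (Fin d) ℝ} (hΓ : Γ.IsSymm)
    (hsp : ∀ v, IsSparse k v → 0 ≤ v ⬝ᵥ Γ *ᵥ v) (Δ : Fin d → ℝ) :
    0 ≤ k * ((k - 1) * (Δ ⬝ᵥ Γ *ᵥ Δ) + l1norm Δ * ∑ i, |Δ i| * Γ i i) := by
  rcases (l1norm_nonneg Δ).eq_or_lt with h0 | hpos
  · have hz : Δ = 0 := by
      funext j
      have := (Finset.sum_eq_zero_iff_of_nonneg (fun j _ => abs_nonneg (Δ j))).1 h0.symm j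
        (Finset.mem_univ j)
      simpa using this
    simp [hz]
  set q := l1norm Δ * ∑ i, |Δ i| * Γ i i - Δ ⬝ᵥ Γ *ᵥ Δ with hq
  have key : ∀ l : ℕ, l ≤ k → ∃ u, IsSparse l u ∧
      (u + ((k : ℝ) - l) • Δ) ⬝ᵥ Γ *ᵥ (u + ((k : ℝ) - l) • Δ) ≤
        (k : ℝ) ^ 2 * (Δ ⬝ᵥ Γ *ᵥ Δ) + l * q := by
    intro l
    induction l with
    | zero =>
      intro _
      refine ⟨0, isSparse_zero 0, ?_⟩
      simp only [CharP.cast_eq_zero, sub_zero, zero_add, mulVec_smul, dotProduct_smul,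
        smul_dotProduct, smul_eq_mul, zero_mul, add_zero]
      exact le_of_eq (by ring)
    | succ l ih =>
      intro hl
      obtain ⟨u, hu, hle⟩ := ih (by omega)
      obtain ⟨j, hj⟩ := exists_signedAtom_le hΓ Δ (u + ((k : ℝ) - l) • Δ) hpos
      refine ⟨u + signedAtom Δ j, hu.add (isSparse_single j _), ?_⟩
      have e : u + signedAtom Δ j + ((k : ℝ) - (l + 1 : ℕ)) • Δ =
          u + ((k : ℝ) - l) • Δ - Δ + signedAtom Δ j := by
        push_cast
        module
      rw [e]
      push_cast
      linarith
  obtain ⟨u, hu, hle⟩ := key k le_rfl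
  have h1 := hsp u hu
  rw [sub_self, zero_smul, add_zero] at hle
  have : (k : ℝ) * ((k - 1) * (Δ ⬝ᵥ Γ *ᵥ Δ) + l1norm Δ * ∑ i, |Δ i| * Γ i i) =
      (k : ℝ) ^ 2 * (Δ ⬝ᵥ Γ *ᵥ Δ) + k * q := by rw [hq]; ring
  rw [this]
  linarith

/-- If `D` is close to `A` on `k`-sparse vectors, with `k` a large multiple of `t`, then `D` inherits
half of the lower spectral bound of `A` on the cone `‖v‖₁ ≤ 4 √t ‖v‖₂`. -/
lemma quadratic_lower_on_cone {d k t : ℕ} {D A : Matrix (Fin d) (Fin d) ℝ} (hD : D.IsSymm)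
    {lo hi : ℝ} (hlo : 0 < lo) (hA : ∀ v, lo * l2norm v ^ 2 ≤ v ⬝ᵥ A *ᵥ v)
    (hA' : ∀ v, v ⬝ᵥ A *ᵥ v ≤ hi * l2norm v ^ 2)
    (hDA : ∀ v, IsSparse k v → |v ⬝ᵥ D *ᵥ v - v ⬝ᵥ A *ᵥ v| ≤ lo / 4 * l2norm v ^ 2)
    (hk : 64 * t * hi < lo * (k - 1)) (hk1 : 1 < k) (v : Fin d → ℝ)
    (hv : l1norm v ≤ 4 * √t * l2norm v) :
    lo / 2 * l2norm v ^ 2 ≤ v ⬝ᵥ D *ᵥ v := by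
  have hquad : ∀ u : Fin d → ℝ, u ⬝ᵥ (D - (3 / 4 * lo) • (1 : Matrix (Fin d) (Fin d) ℝ)) *ᵥ u =
      u ⬝ᵥ D *ᵥ u - 3 / 4 * lo * l2norm u ^ 2 := fun u => by
    rw [sub_mulVec, dotProduct_sub, smul_mulVec, one_mulVec, dotProduct_smul,
      dotProduct_self_eq_l2norm_sq, smul_eq_mul]
  have hsym : (D - (3 / 4 * lo) • (1 : Matrix (Fin d) (Fin d) ℝ)).IsSymm := by
    unfold Matrix.IsSymm
    rw [transpose_sub, hD.eq, transpose_smul, transpose_one]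
  have hM := quadratic_lower_of_sparse (k := k) hsym (fun u hu => by
    rw [hquad]
    have := (abs_le.1 (hDA u hu)).1
    linarith [hA u]) v
  have hdiag : ∀ i, (D - (3 / 4 * lo) • (1 : Matrix (Fin d) (Fin d) ℝ)) i i ≤ hi := by
    intro i
    have hs := (isSparse_single i (1 : ℝ)).mono hk1.le
    have h1 := (abs_le.1 (hDA _ hs)).2
    have h2 := hA' (Pi.single i 1)
    have h3 : l2norm (Pi.single i (1 : ℝ) : Fin d → ℝ) ^ 2 = 1 := by
      rw [← dotProduct_self_eq_l2norm_sq]; simp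
    have h4 : (Pi.single i (1 : ℝ) : Fin d → ℝ) ⬝ᵥ D *ᵥ Pi.single i 1 = D i i := by simp
    rw [h3, h4] at h1
    rw [h3] at h2
    simp only [Matrix.sub_apply, Matrix.smul_apply, one_apply_eq, smul_eq_mul]
    linarith
  have hsum : l1norm v * ∑ i, |v i| * (D - (3 / 4 * lo) • (1 : Matrix (Fin d) (Fin d) ℝ)) i i ≤
      hi * l1norm v ^ 2 := by
    have : ∑ i, |v i| * (D - (3 / 4 * lo) • (1 : Matrix (Fin d) (Fin d) ℝ)) i i ≤
        l1norm v * hi := by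
      unfold l1norm
      rw [Finset.sum_mul]
      exact Finset.sum_le_sum fun i _ => mul_le_mul_of_nonneg_left (hdiag i) (abs_nonneg _)
    nlinarith [mul_le_mul_of_nonneg_left this (l1norm_nonneg v)]
  rw [hquad] at hM
  have hn := l2norm_nonneg v
  rcases hn.eq_or_lt with hz | hz
  · have hv0 : l1norm v = 0 := le_antisymm (by rw [← hz] at hv; simpa using hv) (l1norm_nonneg v)
    have hzero : v = 0 := by
      funext j
      have := abs_apply_le_l2norm v j
      rw [← hz] at this
      simpa using this
    simp [hzero, l2norm]
  have hhi : 0 ≤ hi := by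
    have := (hA v).trans (hA' v)
    by_contra hcon
    nlinarith [pow_pos hz 2]
  have hk0 : (0 : ℝ) < k - 1 := by
    have : (1 : ℝ) < k := by exact_mod_cast hk1
    linarith
  have hM' : 0 ≤ ((k : ℝ) - 1) * (v ⬝ᵥ D *ᵥ v - 3 / 4 * lo * l2norm v ^ 2) +
      hi * (16 * t * l2norm v ^ 2) := by
    have h1 : l1norm v ^ 2 ≤ 16 * t * l2norm v ^ 2 := by
      calc l1norm v ^ 2 ≤ (4 * √t * l2norm v) ^ 2 := by
            gcongr
            exact l1norm_nonneg v
        _ = 16 * t * l2norm v ^ 2 := by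
            rw [mul_pow, mul_pow, Real.sq_sqrt (Nat.cast_nonneg _)]; norm_num
    have h2 := nonneg_of_mul_nonneg_right hM (by linarith : (0 : ℝ) < k)
    nlinarith [mul_le_mul_of_nonneg_left h1 hhi]
  by_contra hcon
  nlinarith [mul_lt_mul_of_pos_left (not_le.1 hcon) hk0, mul_lt_mul_of_pos_right hk (pow_pos hz 2)]

/-- Polarization: closeness of two symmetric forms on sparse vectors controls the coordinates of the
difference applied to a sparse vector. -/
lemma abs_mulVec_sub_le_of_sparse {d k : ℕ} {D A : Matrix (Fin d) (Fin d) ℝ} (hD : D.IsSymm)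
    (hA : A.IsSymm) {θ : ℝ} (hDA : ∀ v, IsSparse (k + 1) v →
      |v ⬝ᵥ D *ᵥ v - v ⬝ᵥ A *ᵥ v| ≤ θ * l2norm v ^ 2) (u : Fin d → ℝ) (hu : IsSparse k u)
    (hu1 : l2norm u ≤ 1) (j : Fin d) : |(D *ᵥ u) j - (A *ᵥ u) j| ≤ θ := by
  set e : Fin d → ℝ := Pi.single j 1 with he
  have hE : ∀ M : Matrix (Fin d) (Fin d) ℝ, M.IsSymm →
      (u + e) ⬝ᵥ M *ᵥ (u + e) - (u - e) ⬝ᵥ M *ᵥ (u - e) = 4 * (M *ᵥ u) j := by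
    intro M hM
    have hs : u ⬝ᵥ M *ᵥ e = e ⬝ᵥ M *ᵥ u := by
      rw [dotProduct_mulVec, ← mulVec_transpose, hM.eq, dotProduct_comm]
    have h1 : e ⬝ᵥ M *ᵥ u = (M *ᵥ u) j := by simp [he]
    simp only [mulVec_add, dotProduct_add, add_dotProduct, mulVec_sub, dotProduct_sub,
      sub_dotProduct, hs, h1]
    ring
  have hp : IsSparse (k + 1) (u + e) := hu.add (isSparse_single j _)
  have hm : IsSparse (k + 1) (u - e) := by
    have := hu.add ((isSparse_single j (1 : ℝ)).smul (-1))
    simpa [sub_eq_add_neg] using this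
  have hn : l2norm (u + e) ^ 2 + l2norm (u - e) ^ 2 = 2 * l2norm u ^ 2 + 2 := by
    have : e ⬝ᵥ e = 1 := by simp [he]
    simp only [← dotProduct_self_eq_l2norm_sq, dotProduct_add, add_dotProduct, dotProduct_sub,
      sub_dotProduct, this]
    ring
  have hθ : 0 ≤ θ := by
    have h1 := (abs_nonneg _).trans (hDA e ((isSparse_single j _).mono (by omega)))
    rwa [← dotProduct_self_eq_l2norm_sq, show e ⬝ᵥ e = 1 by simp [he], mul_one] at h1
  have h1 := abs_le.1 (hDA _ hp)
  have h2 := abs_le.1 (hDA _ hm)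
  have h3 := hE D hD
  have h4 := hE A hA
  have h5 : l2norm u ^ 2 ≤ 1 := pow_le_one₀ (l2norm_nonneg u) hu1
  have h6 : θ * (l2norm (u + e) ^ 2 + l2norm (u - e) ^ 2) ≤ θ * 4 := by
    rw [hn]; gcongr; linarith
  rw [abs_le]
  constructor <;> linarith [h1.1, h1.2, h2.1, h2.2]

/-! ### Exponential deviation bounds for averages -/

lemma exp_le_one_add_add_sq_mul_exp_abs (y : ℝ) :
    Real.exp y ≤ 1 + y + y ^ 2 * Real.exp |y| := by
  have h := Complex.norm_exp_sub_sum_le_norm_mul_exp (y : ℂ) 2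
  have e : Complex.exp y - ∑ m ∈ Finset.range 2, (y : ℂ) ^ m / m.factorial =
      ((Real.exp y - (1 + y) : ℝ) : ℂ) := by
    simp [Finset.sum_range_succ]
  rw [e, Complex.norm_real, Complex.norm_real, Real.norm_eq_abs, Real.norm_eq_abs, sq_abs] at h
  linarith [(abs_le.1 h).2]

lemma integrable_and_integral_le_of_lintegral_le {α : Type*} [MeasurableSpace α] {μ : Measure α}
    {g : α → ℝ} (hg : AEStronglyMeasurable g μ) (h0 : ∀ z, 0 ≤ g z) {v : ℝ}
    (hv0 : 0 ≤ v) (hv : ∫⁻ z, ENNReal.ofReal (g z) ∂μ ≤ ENNReal.ofReal v) :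
    Integrable g μ ∧ ∫ z, g z ∂μ ≤ v := by
  constructor
  · refine ⟨hg, ?_⟩
    rw [hasFiniteIntegral_iff_ofReal (ae_of_all _ h0)]
    exact hv.trans_lt ENNReal.ofReal_lt_top
  · rw [integral_eq_lintegral_of_nonneg_ae (ae_of_all _ h0) hg]
    exact ENNReal.toReal_le_of_le_ofReal hv0 hv

lemma integrable_of_lintegral_sq_mul_exp_le {S : Type*} [MeasurableSpace S] {Q : Measure S}
    [IsFiniteMeasure Q] {φ : S → ℝ} (hφ : Measurable φ) {t v : ℝ} (ht : 0 ≤ t) (hv0 : 0 ≤ v)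
    (hv : ∫⁻ z, ENNReal.ofReal (φ z ^ 2 * Real.exp (t * |φ z|)) ∂Q ≤ ENNReal.ofReal v) :
    Integrable φ Q := by
  obtain ⟨hint2, -⟩ := integrable_and_integral_le_of_lintegral_le
    (g := fun z => φ z ^ 2 * Real.exp (t * |φ z|)) (by fun_prop) (fun z => by positivity) hv0 hv
  refine (hint2.add (integrable_const 1)).mono' hφ.aestronglyMeasurable (ae_of_all _ fun z => ?_)
  have h1 : 1 ≤ Real.exp (t * |φ z|) := Real.one_le_exp (by positivity)
  have h2 := mul_le_mul_of_nonneg_left h1 (sq_nonneg (φ z))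
  simp only [Real.norm_eq_abs, Pi.add_apply]
  nlinarith [sq_nonneg (|φ z| - 1), sq_abs (φ z), abs_nonneg (φ z)]

/-- The weighted second moment `E φ² exp (t |φ|)` controls the moment generating function of `φ` at
`t`, hence the upper deviations of averages of independent copies. -/
lemma measureReal_average_ge_le {ι S : Type*} [Fintype ι] [MeasurableSpace S] (Q : Measure S)
    [IsProbabilityMeasure Q] (J : Finset ι) (hJ : J.Nonempty) {φ : S → ℝ} (hφ : Measurable φ)
    {t v : ℝ} (x : ℝ) (ht : 0 ≤ t) (hv0 : 0 ≤ v)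
    (hv : ∫⁻ z, ENNReal.ofReal (φ z ^ 2 * Real.exp (t * |φ z|)) ∂Q ≤ ENNReal.ofReal v) :
    (Measure.pi fun _ : ι => Q).real
        {W | x ≤ 1 / (J.card : ℝ) * ∑ i ∈ J, φ (W i) - ∫ z, φ z ∂Q} ≤
      Real.exp (-(J.card * (t * x - t ^ 2 * v))) := by
  obtain ⟨hint2, hint2'⟩ := integrable_and_integral_le_of_lintegral_le
    (g := fun z => φ z ^ 2 * Real.exp (t * |φ z|)) (by fun_prop) (fun z => by positivity) hv0 hv
  have hint : Integrable φ Q := integrable_of_lintegral_sq_mul_exp_le hφ ht hv0 hv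
  have hbound : ∀ z, Real.exp (t * φ z) ≤
      1 + t * φ z + t ^ 2 * (φ z ^ 2 * Real.exp (t * |φ z|)) := fun z => by
    have := exp_le_one_add_add_sq_mul_exp_abs (t * φ z)
    rw [abs_mul, abs_of_nonneg ht] at this
    linarith
  have hdom : Integrable (fun z => 1 + t * φ z + t ^ 2 * (φ z ^ 2 * Real.exp (t * |φ z|))) Q :=
    ((integrable_const 1).add (hint.const_mul t)).add (hint2.const_mul _)
  have hexp : Integrable (fun z => Real.exp (t * φ z)) Q :=
    hdom.mono' (by fun_prop) (ae_of_all _ fun z => by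
      rw [Real.norm_eq_abs, Real.abs_exp]; exact hbound z)
  have hmgf : ∫ z, Real.exp (t * φ z) ∂Q ≤ Real.exp (t * ∫ z, φ z ∂Q + t ^ 2 * v) := by
    calc ∫ z, Real.exp (t * φ z) ∂Q
        ≤ ∫ z, 1 + t * φ z + t ^ 2 * (φ z ^ 2 * Real.exp (t * |φ z|)) ∂Q :=
          integral_mono hexp hdom hbound
      _ = 1 + t * ∫ z, φ z ∂Q + t ^ 2 * ∫ z, φ z ^ 2 * Real.exp (t * |φ z|) ∂Q := by
          have e1 : ∫ z, 1 + t * φ z + t ^ 2 * (φ z ^ 2 * Real.exp (t * |φ z|)) ∂Q =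
              ∫ z, 1 + t * φ z ∂Q + ∫ z, t ^ 2 * (φ z ^ 2 * Real.exp (t * |φ z|)) ∂Q :=
            integral_add ((integrable_const 1).add (hint.const_mul t)) (hint2.const_mul _)
          have e2 : ∫ z, 1 + t * φ z ∂Q = ∫ _, (1 : ℝ) ∂Q + ∫ z, t * φ z ∂Q :=
            integral_add (integrable_const 1) (hint.const_mul t)
          rw [e1, e2, integral_const_mul, integral_const_mul]
          simp
      _ ≤ (t * ∫ z, φ z ∂Q + t ^ 2 * v) + 1 := by
          nlinarith [mul_le_mul_of_nonneg_left hint2' (sq_nonneg t)]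
      _ ≤ _ := Real.add_one_le_exp _
  set Pi := Measure.pi fun _ : ι => Q
  have hmp : ∀ i, MeasurePreserving (Function.eval i) Pi Q := fun i =>
    measurePreserving_eval (fun _ : ι => Q) i
  have hind : iIndepFun (fun i (W : ι → S) => φ (W i)) Pi :=
    iIndepFun_pi (μ := fun _ : ι => Q) (X := fun _ => φ) fun _ => hφ.aemeasurable
  have hm : ∀ i, Measurable fun W : ι → S => φ (W i) := fun i => hφ.comp (measurable_pi_apply i)
  have hexpi : ∀ i, Integrable (fun W : ι → S => Real.exp (t * φ (W i))) Pi := fun i =>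
    (hmp i).integrable_comp_of_integrable (g := fun z => Real.exp (t * φ z)) hexp
  have hmgfi : ∀ i, mgf (fun W : ι → S => φ (W i)) Pi t = ∫ z, Real.exp (t * φ z) ∂Q := fun i => by
    have h1 : ∫ z, Real.exp (t * φ z) ∂Q = ∫ z, Real.exp (t * φ z) ∂(Pi.map (Function.eval i)) := by
      rw [(hmp i).map_eq]
    rw [h1, integral_map (measurable_pi_apply i).aemeasurable (by fun_prop)]
    rfl
  have hJ0 : (0 : ℝ) < J.card := by exact_mod_cast hJ.card_pos
  have key := measure_ge_le_exp_mul_mgf (μ := Pi) (X := ∑ i ∈ J, fun W : ι → S => φ (W i))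
    (J.card * (x + ∫ z, φ z ∂Q)) ht (hind.integrable_exp_mul_sum hm fun i _ => hexpi i)
  rw [hind.mgf_sum hm J, Finset.prod_congr rfl fun i _ => hmgfi i, Finset.prod_const] at key
  have hset : {W : ι → S | x ≤ 1 / (J.card : ℝ) * ∑ i ∈ J, φ (W i) - ∫ z, φ z ∂Q} =
      {W | J.card * (x + ∫ z, φ z ∂Q) ≤ (∑ i ∈ J, fun W : ι → S => φ (W i)) W} := by
    ext W
    simp only [Set.mem_ofPred_eq, Finset.sum_apply]
    rw [le_sub_iff_add_le, one_div, inv_mul_eq_div, le_div_iff₀ hJ0, mul_comm]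
  rw [hset]
  refine key.trans ?_
  calc Real.exp (-t * (J.card * (x + ∫ z, φ z ∂Q))) * (∫ z, Real.exp (t * φ z) ∂Q) ^ J.card
      ≤ Real.exp (-t * (J.card * (x + ∫ z, φ z ∂Q))) *
          Real.exp (t * ∫ z, φ z ∂Q + t ^ 2 * v) ^ J.card := by
        gcongr
    _ = _ := by
        rw [← Real.exp_nat_mul, ← Real.exp_add]
        ring_nf

/-- The two-sided form of `measureReal_average_ge_le`. -/
lemma measure_lt_abs_average_sub_le {ι S : Type*} [Fintype ι] [MeasurableSpace S] (Q : Measure S)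
    [IsProbabilityMeasure Q] (J : Finset ι) (hJ : J.Nonempty) {φ : S → ℝ} (hφ : Measurable φ)
    {t v : ℝ} (x : ℝ) (ht : 0 ≤ t) (hv0 : 0 ≤ v)
    (hv : ∫⁻ z, ENNReal.ofReal (φ z ^ 2 * Real.exp (t * |φ z|)) ∂Q ≤ ENNReal.ofReal v) :
    (Measure.pi fun _ : ι => Q)
        {W | x < |1 / (J.card : ℝ) * ∑ i ∈ J, φ (W i) - ∫ z, φ z ∂Q|} ≤
      ENNReal.ofReal (2 * Real.exp (-(J.card * (t * x - t ^ 2 * v)))) := by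
  have h1 := measureReal_average_ge_le Q J hJ hφ x ht hv0 hv
  have h2 := measureReal_average_ge_le Q J hJ hφ.neg x ht hv0 (by simpa using hv)
  have hsub : {W : ι → S | x < |1 / (J.card : ℝ) * ∑ i ∈ J, φ (W i) - ∫ z, φ z ∂Q|} ⊆
      {W | x ≤ 1 / (J.card : ℝ) * ∑ i ∈ J, φ (W i) - ∫ z, φ z ∂Q} ∪
      {W | x ≤ 1 / (J.card : ℝ) * ∑ i ∈ J, (-φ) (W i) - ∫ z, (-φ) z ∂Q} := by
    intro W hW
    simp only [Set.mem_ofPred_eq, Set.mem_union, Pi.neg_apply, integral_neg,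
      Finset.sum_neg_distrib] at hW ⊢
    rcases lt_abs.1 hW with h | h
    · exact Or.inl h.le
    · right; linarith
  refine (measure_mono hsub).trans ((measure_union_le _ _).trans ?_)
  rw [two_mul, ENNReal.ofReal_add (Real.exp_pos _).le (Real.exp_pos _).le]
  refine add_le_add ?_ ?_
  · exact (ENNReal.le_ofReal_iff_toReal_le (measure_ne_top _ _) (Real.exp_pos _).le).2 h1
  · exact (ENNReal.le_ofReal_iff_toReal_le (measure_ne_top _ _) (Real.exp_pos _).le).2 h2

/-- A Gaussian tail bound gives a Gaussian-square exponential moment, with a universal bound. -/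
lemma exists_lintegral_exp_sq_le : ∃ G : ℝ, 1 ≤ G ∧
    ∀ {α : Type} [MeasurableSpace α] (μ : Measure α) [IsProbabilityMeasure μ] (Z : α → ℝ),
      Measurable Z → (∀ t : ℝ, 0 < t → μ.real {x | t ≤ |Z x|} ≤ 2 * Real.exp (-t ^ 2 / 2)) →
      ∫⁻ x, ENNReal.ofReal (Real.exp (Z x ^ 2 / 4)) ∂μ ≤ ENNReal.ofReal G := by
  have hsum : Summable fun m : ℕ => 2 * Real.exp (5 / 4) * Real.exp (-1 / 2) ^ m :=
    (summable_geometric_of_lt_one (Real.exp_pos _).le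
      (Real.exp_lt_one_iff.2 (by norm_num))).mul_left _
  have hterm : ∀ m : ℕ, 0 ≤ 2 * Real.exp (5 / 4) * Real.exp (-1 / 2) ^ m := fun m => by positivity
  refine ⟨max 1 (∑' m : ℕ, 2 * Real.exp (5 / 4) * Real.exp (-1 / 2) ^ m), le_max_left _ _, ?_⟩
  intro α _ μ _ Z hZ htail
  have htail' : ∀ m : ℕ, μ {x | (m : ℝ) ≤ |Z x|} ≤
      ENNReal.ofReal (2 * Real.exp (-(m : ℝ) ^ 2 / 2)) := by
    intro m
    rcases Nat.eq_zero_or_pos m with h | h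
    · subst h
      refine prob_le_one.trans ?_
      rw [ENNReal.one_le_ofReal]
      norm_num
    · exact (ENNReal.le_ofReal_iff_toReal_le (measure_ne_top _ _) (by positivity)).2
        (htail m (by exact_mod_cast h))
  have hpt : ∀ x, ENNReal.ofReal (Real.exp (Z x ^ 2 / 4)) ≤
      ∑' m : ℕ, Set.indicator {x | (m : ℝ) ≤ |Z x|}
        (fun _ => ENNReal.ofReal (Real.exp (((m : ℝ) + 1) ^ 2 / 4))) x := by
    intro x
    refine le_trans ?_ (ENNReal.le_tsum ⌊|Z x|⌋₊)
    have hmem : x ∈ {y | ((⌊|Z x|⌋₊ : ℕ) : ℝ) ≤ |Z y|} := by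
      rw [Set.mem_ofPred_eq]
      exact Nat.floor_le (abs_nonneg _)
    rw [Set.indicator_of_mem hmem, ← sq_abs (Z x)]
    gcongr
    exact (Nat.lt_floor_add_one _).le
  calc ∫⁻ x, ENNReal.ofReal (Real.exp (Z x ^ 2 / 4)) ∂μ
      ≤ ∫⁻ x, ∑' m : ℕ, Set.indicator {x | (m : ℝ) ≤ |Z x|}
        (fun _ => ENNReal.ofReal (Real.exp (((m : ℝ) + 1) ^ 2 / 4))) x ∂μ := lintegral_mono hpt
    _ = ∑' m : ℕ, ENNReal.ofReal (Real.exp (((m : ℝ) + 1) ^ 2 / 4)) * μ {x | (m : ℝ) ≤ |Z x|} := by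
        have hms : ∀ m : ℕ, MeasurableSet {x | (m : ℝ) ≤ |Z x|} := fun m =>
          measurableSet_le measurable_const (measurable_norm.comp hZ)
        rw [lintegral_tsum fun m => (measurable_const.indicator (hms m)).aemeasurable]
        exact tsum_congr fun m => by rw [lintegral_indicator_const (hms m)]
    _ ≤ ∑' m : ℕ, ENNReal.ofReal (2 * Real.exp (5 / 4) * Real.exp (-1 / 2) ^ m) := by
        refine ENNReal.tsum_le_tsum fun m => ?_
        refine (mul_le_mul_right (htail' m) _).trans ?_
        rw [← ENNReal.ofReal_mul (Real.exp_pos _).le]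
        apply ENNReal.ofReal_le_ofReal
        rw [← Real.exp_nat_mul, mul_left_comm, ← Real.exp_add, mul_assoc, ← Real.exp_add]
        refine mul_le_mul_of_nonneg_left (Real.exp_le_exp.2 ?_) (by norm_num)
        nlinarith [sq_nonneg ((m : ℝ) / 2 - 1)]
    _ = ENNReal.ofReal (∑' m : ℕ, 2 * Real.exp (5 / 4) * Real.exp (-1 / 2) ^ m) :=
        (ENNReal.ofReal_tsum_of_nonneg hterm hsum).symm
    _ ≤ _ := ENNReal.ofReal_le_ofReal (le_max_right _ _)

/-! ### Grids of sparse vectors -/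

open Classical in
/-- The vectors with at most `k` nonzero coordinates, all of the form `z / q` with `z` an integer in
`[-q, q]`; they are built by overwriting one coordinate at a time. -/
noncomputable def sparseGrid (d q : ℕ) : ℕ → Finset (Fin d → ℝ)
  | 0 => {0}
  | k + 1 => sparseGrid d q k ∪
      (sparseGrid d q k ×ˢ (Finset.univ ×ˢ Finset.Icc (-(q : ℤ)) q)).image
        fun w => Function.update w.1 w.2.1 ((w.2.2 : ℝ) / q)

lemma card_sparseGrid_le (d q k : ℕ) :
    (sparseGrid d q k).card ≤ (1 + d * (2 * q + 1)) ^ k := by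
  induction k with
  | zero => simp [sparseGrid]
  | succ k ih =>
    simp only [sparseGrid]
    refine (Finset.card_union_le _ _).trans ?_
    have h1 := Finset.card_image_le (s := sparseGrid d q k ×ˢ
        ((Finset.univ : Finset (Fin d)) ×ˢ Finset.Icc (-(q : ℤ)) q))
      (f := fun w : (Fin d → ℝ) × Fin d × ℤ => Function.update w.1 w.2.1 ((w.2.2 : ℝ) / q))
    have h2 : (Finset.Icc (-(q : ℤ)) q).card = 2 * q + 1 := by
      rw [Int.card_Icc]; omega
    rw [Finset.card_product, Finset.card_product, Finset.card_univ, Fintype.card_fin, h2] at h1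
    calc _ ≤ (sparseGrid d q k).card + (sparseGrid d q k).card * (d * (2 * q + 1)) := by
          convert Nat.add_le_add_left h1 _
      _ = (sparseGrid d q k).card * (1 + d * (2 * q + 1)) := by ring
      _ ≤ _ := by rw [pow_succ]; exact Nat.mul_le_mul_right _ ih

lemma mem_sparseGrid {d q : ℕ} (z : Fin d → ℤ) (hz : ∀ j, z j ∈ Finset.Icc (-(q : ℤ)) q)
    (k : ℕ) (A : Finset (Fin d)) (hA : A.card ≤ k) (hzA : ∀ j ∉ A, z j = 0) :
    (fun j => (z j : ℝ) / q) ∈ sparseGrid d q k := by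
  classical
  induction k generalizing z A with
  | zero =>
    have : A = ∅ := Finset.card_eq_zero.1 (Nat.le_zero.1 hA)
    subst this
    simp only [sparseGrid, Finset.mem_singleton]
    funext j
    simp [hzA j (by simp)]
  | succ k ih =>
    simp only [sparseGrid, Finset.mem_union]
    rcases A.eq_empty_or_nonempty with rfl | ⟨a, ha⟩
    · exact Or.inl (ih z hz ∅ (by simp) hzA)
    · right
      refine Finset.mem_image.2 ⟨(fun j => ((Function.update z a 0 j : ℤ) : ℝ) / q, a, z a),
        Finset.mem_product.2 ⟨?_, Finset.mem_product.2 ⟨Finset.mem_univ _, hz a⟩⟩, ?_⟩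
      · refine ih (Function.update z a 0) (fun j => ?_) (A.erase a) ?_ fun j hj => ?_
        · by_cases h : j = a
          · subst h; simp
          · simpa [h] using hz j
        · rw [Finset.card_erase_of_mem ha]; omega
        · by_cases h : j = a
          · subst h; simp
          · rw [Function.update_of_ne h]
            exact hzA j fun hjA => hj (Finset.mem_erase.2 ⟨h, hjA⟩)
      · funext j
        by_cases h : j = a
        · subst h; simp
        · simp [h]

/-- Rounding to the grid: a sparse vector of the unit ball has a grid neighbour on the same set of
coordinates. -/
lemma exists_mem_sparseGrid {d q k : ℕ} (hq : 0 < q) (hkq : k ≤ q) {u : Fin d → ℝ}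
    (hu : IsSparse k u) (hu1 : l2norm u ≤ 1) :
    ∃ u' ∈ sparseGrid d q k, l2norm u' ≤ 2 ∧ l1norm (u - u') ≤ k / q := by
  obtain ⟨A, hA, hu⟩ := hu
  have hq0 : (0 : ℝ) < q := by exact_mod_cast hq
  have habs : ∀ j, |u j| ≤ 1 := fun j => (abs_apply_le_l2norm u j).trans hu1
  have hz0 : ∀ j ∉ A, ⌊u j * q⌋ = 0 := fun j hj => by simp [hu j hj]
  have hdiff : ∀ j, |u j - (⌊u j * q⌋ : ℝ) / q| ≤ 1 / q := by
    intro j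
    have h1 := Int.floor_le (u j * q)
    have h2 := Int.lt_floor_add_one (u j * q)
    have e : u j - (⌊u j * q⌋ : ℝ) / q = (u j * q - ⌊u j * q⌋) / q := by field_simp
    rw [e, abs_div, abs_of_pos hq0]
    gcongr
    rw [abs_of_nonneg (by linarith)]
    linarith
  have hl1 : l1norm (u - fun j => (⌊u j * q⌋ : ℝ) / q) ≤ k / q := by
    have e : l1norm (u - fun j => (⌊u j * q⌋ : ℝ) / q) =
        ∑ j ∈ A, |u j - (⌊u j * q⌋ : ℝ) / q| := by
      unfold l1norm
      refine (Finset.sum_subset (Finset.subset_univ A) fun j _ hj => ?_).symm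
      simp [hu j hj]
    rw [e]
    calc _ ≤ ∑ j ∈ A, (1 : ℝ) / q := Finset.sum_le_sum fun j _ => hdiff j
      _ = A.card / q := by rw [Finset.sum_const, nsmul_eq_mul]; ring
      _ ≤ _ := by gcongr
  refine ⟨fun j => (⌊u j * q⌋ : ℝ) / q, mem_sparseGrid (fun j => ⌊u j * q⌋) (fun j => ?_) k A hA hz0,
    ?_, hl1⟩
  · have := abs_le.1 (habs j)
    rw [Finset.mem_Icc]
    constructor
    · rw [Int.le_floor]; push_cast; nlinarith
    · have : (⌊u j * q⌋ : ℝ) ≤ q := (Int.floor_le _).trans (by nlinarith)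
      exact_mod_cast this
  · set u' : Fin d → ℝ := fun j => (⌊u j * q⌋ : ℝ) / q with hu'
    have h1 : l1norm (u - u') ≤ 1 := hl1.trans (by
      rw [div_le_one hq0]; exact_mod_cast hkq)
    have h2 : l2norm (u - u') ^ 2 ≤ 1 := by
      have : l2norm (u - u') ^ 2 ≤ l1norm (u - u') ^ 2 := by
        rw [l2norm_sq]
        unfold l1norm
        calc ∑ j, (u - u') j ^ 2 = ∑ j, |(u - u') j| ^ 2 := by simp only [sq_abs]
          _ ≤ _ := Finset.sum_sq_le_sq_sum_of_nonneg fun _ _ => abs_nonneg _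
      exact this.trans (pow_le_one₀ (l1norm_nonneg _) h1)
    have h3 : l2norm u ^ 2 ≤ 1 := pow_le_one₀ (l2norm_nonneg u) hu1
    have h4 : l2norm u' ^ 2 ≤ 2 * l2norm u ^ 2 + 2 * l2norm (u - u') ^ 2 := by
      simp only [l2norm_sq, Finset.mul_sum, ← Finset.sum_add_distrib, Pi.sub_apply]
      exact Finset.sum_le_sum fun j _ => by nlinarith [sq_nonneg (2 * u j - u' j)]
    exact abs_le_of_sq_le_sq' (by nlinarith) (by norm_num) |>.2

/-! ### The law of covariate and error -/

/-- `Q` is the law of `(X, ε)` on `ℝ^d × ℝ`: the covariate has law `μ`, the error has conditional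
density `f x` given `X = x`, which is at most `f₂` at zero and Lipschitz with constant `l₀`, and
`exp (σ (Xᵀv)²)` has expectation at most `G` for every `v` of Euclidean norm at most two. -/
structure IsErrorLaw {d : ℕ} (Q : Measure ((Fin d → ℝ) × ℝ)) (μ : Measure (Fin d → ℝ))
    (f : (Fin d → ℝ) → ℝ → ℝ) (f₂ l₀ σ G : ℝ) : Prop where
  prob : IsProbabilityMeasure μ
  measurable : Measurable (Function.uncurry f)
  nonneg : ∀ x u, 0 ≤ f x u
  law : Q = (μ.prod volume).withDensity fun z => ENNReal.ofReal (f z.1 z.2)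
  map_fst : Q.map Prod.fst = μ
  regular : ∀ᵐ x ∂μ, f x 0 ≤ f₂ ∧ ∀ u v, |f x u - f x v| ≤ l₀ * |u - v|
  f₂_nonneg : 0 ≤ f₂
  l₀_nonneg : 0 ≤ l₀
  σ_pos : 0 < σ
  one_le_G : 1 ≤ G
  exp_moment : ∀ v : Fin d → ℝ, l2norm v ≤ 2 →
    ∫⁻ x, ENNReal.ofReal (Real.exp (σ * (x ⬝ᵥ v) ^ 2)) ∂μ ≤ ENNReal.ofReal G

section Law

variable {d : ℕ} {Q : Measure ((Fin d → ℝ) × ℝ)} {μ : Measure (Fin d → ℝ)}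
  {f : (Fin d → ℝ) → ℝ → ℝ} {f₂ l₀ σ G : ℝ}

@[fun_prop]
lemma measurable_dotProduct_right (v : Fin d → ℝ) : Measurable fun x : Fin d → ℝ => x ⬝ᵥ v := by
  unfold dotProduct; fun_prop

lemma IsErrorLaw.prob_law (hQ : IsErrorLaw Q μ f f₂ l₀ σ G) : IsProbabilityMeasure Q := by
  have := hQ.prob
  rw [← hQ.map_fst] at this
  exact ⟨by
    have h := this.measure_univ
    rwa [Measure.map_apply measurable_fst MeasurableSet.univ, Set.preimage_univ] at h⟩

lemma IsErrorLaw.lintegral_eq (hQ : IsErrorLaw Q μ f f₂ l₀ σ G)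
    {g : (Fin d → ℝ) × ℝ → ℝ≥0∞} (hg : Measurable g) :
    ∫⁻ z, g z ∂Q = ∫⁻ x, (∫⁻ u, ENNReal.ofReal (f x u) * g (x, u)) ∂μ := by
  have := hQ.prob
  have hf : Measurable fun z : (Fin d → ℝ) × ℝ => ENNReal.ofReal (f z.1 z.2) :=
    hQ.measurable.ennreal_ofReal
  rw [hQ.law, lintegral_withDensity_eq_lintegral_mul _ hf hg]
  exact lintegral_prod _ (hf.mul hg).aemeasurable

lemma IsErrorLaw.lintegral_ofReal_le (hQ : IsErrorLaw Q μ f f₂ l₀ σ G)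
    {g : (Fin d → ℝ) × ℝ → ℝ} (hg : Measurable g) {H : (Fin d → ℝ) → ℝ} {v : ℝ≥0∞}
    (hH : ∀ᵐ x ∂μ, ∫⁻ u, ENNReal.ofReal (f x u * g (x, u)) ≤ ENNReal.ofReal (H x))
    (hv : ∫⁻ x, ENNReal.ofReal (H x) ∂μ ≤ v) :
    ∫⁻ z, ENNReal.ofReal (g z) ∂Q ≤ v := by
  rw [hQ.lintegral_eq hg.ennreal_ofReal]
  refine (lintegral_mono_ae ?_).trans hv
  filter_upwards [hH] with x hx
  simpa only [ENNReal.ofReal_mul (hQ.nonneg x _)] using hx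

/-- The expectation of `A(X) ψ(X, ε)` is computed by first integrating `ψ(x, ·)` against the
conditional density of the error. -/
lemma IsErrorLaw.abs_integral_sub_le (hQ : IsErrorLaw Q μ f f₂ l₀ σ G)
    {A T R : (Fin d → ℝ) → ℝ} {ψ : (Fin d → ℝ) → ℝ → ℝ} {c : ℝ}
    (hφ : Integrable (fun z : (Fin d → ℝ) × ℝ => A z.1 * ψ z.1 z.2) Q)
    (hR : ∀ᵐ x ∂μ, |(∫ u, f x u * ψ x u) - T x| ≤ R x)
    (hAT : Integrable (fun x => A x * T x) μ) (hAR : Integrable (fun x => |A x| * R x) μ)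
    (hc : ∫ x, |A x| * R x ∂μ ≤ c) :
    |∫ z, A z.1 * ψ z.1 z.2 ∂Q - ∫ x, A x * T x ∂μ| ≤ c := by
  have := hQ.prob
  have hf : Measurable fun z : (Fin d → ℝ) × ℝ => ENNReal.ofReal (f z.1 z.2) :=
    hQ.measurable.ennreal_ofReal
  have hi : Integrable (fun z : (Fin d → ℝ) × ℝ => f z.1 z.2 * (A z.1 * ψ z.1 z.2))
      (μ.prod volume) := by
    rw [hQ.law, integrable_withDensity_iff hf (ae_of_all _ fun _ => ENNReal.ofReal_lt_top)] at hφ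
    refine hφ.congr (ae_of_all _ fun z => ?_)
    simp only [ENNReal.toReal_ofReal (hQ.nonneg _ _)]
    ring
  have e : ∫ z, A z.1 * ψ z.1 z.2 ∂Q = ∫ x, A x * (∫ u, f x u * ψ x u) ∂μ := by
    rw [hQ.law, integral_withDensity_eq_integral_toReal_smul hf
      (ae_of_all _ fun _ => ENNReal.ofReal_lt_top)]
    simp only [ENNReal.toReal_ofReal (hQ.nonneg _ _), smul_eq_mul]
    rw [integral_prod _ hi]
    refine integral_congr_ae (ae_of_all _ fun x => ?_)
    simp only
    rw [← integral_const_mul]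
    exact integral_congr_ae (ae_of_all _ fun u => by simp only; ring)
  have ho : Integrable (fun x => A x * ∫ u, f x u * ψ x u) μ := by
    refine hi.integral_prod_left.congr (ae_of_all _ fun x => ?_)
    simp only
    rw [← integral_const_mul]
    exact integral_congr_ae (ae_of_all _ fun u => by simp only; ring)
  rw [e, ← integral_sub ho hAT]
  refine (abs_integral_le_integral_abs).trans ((integral_mono_ae (ho.sub hAT).abs hAR ?_).trans hc)
  filter_upwards [hR] with x hx
  rw [Pi.sub_apply, ← mul_sub, abs_mul]
  exact mul_le_mul_of_nonneg_left hx (abs_nonneg _)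

/-! ### Pointwise bounds by Gaussian-square exponentials -/

lemma sq_le_mul_exp {κ : ℝ} (hκ : 0 < κ) (z : ℝ) : z ^ 2 ≤ 1 / κ * Real.exp (κ * z ^ 2) := by
  have := Real.add_one_le_exp (κ * z ^ 2)
  rw [div_mul_eq_mul_div, one_mul, le_div_iff₀ hκ]
  linarith

lemma abs_le_mul_exp {κ : ℝ} (hκ : 0 < κ) (z : ℝ) :
    |z| ≤ (1 + 1 / κ) * Real.exp (κ * z ^ 2) := by
  have h1 := sq_le_mul_exp hκ z
  have h2 : 1 ≤ Real.exp (κ * z ^ 2) := Real.one_le_exp (by positivity)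
  nlinarith [sq_nonneg (|z| - 1), sq_abs z, abs_nonneg z]

lemma one_add_sq_le_mul_exp {κ : ℝ} (hκ : 0 < κ) (z : ℝ) :
    1 + z ^ 2 ≤ (1 + 1 / κ) * Real.exp (κ * z ^ 2) := by
  have h1 := sq_le_mul_exp hκ z
  have h2 : 1 ≤ Real.exp (κ * z ^ 2) := Real.one_le_exp (by positivity)
  linarith

lemma fourth_power_mul_exp_le {κ : ℝ} (hκ : 0 < κ) (z : ℝ) :
    z ^ 4 * Real.exp (κ / 4 * z ^ 2) ≤ 32 / κ ^ 2 * Real.exp (κ / 2 * z ^ 2) := by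
  have h := Real.quadratic_le_exp_of_nonneg (x := κ / 4 * z ^ 2) (by positivity)
  have h1 : z ^ 4 ≤ 32 / κ ^ 2 * Real.exp (κ / 4 * z ^ 2) := by
    rw [div_mul_eq_mul_div, le_div_iff₀ (by positivity)]
    nlinarith [mul_nonneg hκ.le (sq_nonneg z)]
  calc z ^ 4 * Real.exp (κ / 4 * z ^ 2)
      ≤ 32 / κ ^ 2 * Real.exp (κ / 4 * z ^ 2) * Real.exp (κ / 4 * z ^ 2) := by gcongr
    _ = _ := by
      rw [mul_assoc, ← Real.exp_add]
      congr 2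
      ring

lemma sq_mul_exp_abs_le {κ : ℝ} (hκ : 0 < κ) (z : ℝ) :
    z ^ 2 * Real.exp |z| ≤ 4 / κ * Real.exp (1 / κ) * Real.exp (κ / 2 * z ^ 2) := by
  have h1 := sq_le_mul_exp (show 0 < κ / 4 by positivity) z
  have h2 : |z| ≤ κ / 4 * z ^ 2 + 1 / κ := by
    have h3 : 0 ≤ κ * (|z| / 2 - 1 / κ) ^ 2 := by positivity
    have h4 : κ * (|z| / 2 - 1 / κ) ^ 2 = κ / 4 * |z| ^ 2 - |z| + 1 / κ := by
      field_simp
      ring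
    rw [h4, sq_abs] at h3
    linarith
  calc z ^ 2 * Real.exp |z|
      ≤ (1 / (κ / 4) * Real.exp (κ / 4 * z ^ 2)) * Real.exp (κ / 4 * z ^ 2 + 1 / κ) := by gcongr
    _ = 4 / κ * Real.exp (1 / κ) * (Real.exp (κ / 4 * z ^ 2) * Real.exp (κ / 4 * z ^ 2)) := by
      rw [Real.exp_add]; field_simp
    _ = _ := by
      rw [← Real.exp_add]
      congr 2
      ring

lemma exp_half_mul_exp_half_le (p q : ℝ) :
    Real.exp (p / 2) * Real.exp (q / 2) ≤ Real.exp p + Real.exp q := by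
  have hp : Real.exp p = Real.exp (p / 2) ^ 2 := by
    rw [← Real.exp_nat_mul]; congr 1; push_cast; ring
  have hq : Real.exp q = Real.exp (q / 2) ^ 2 := by
    rw [← Real.exp_nat_mul]; congr 1; push_cast; ring
  rw [hp, hq]
  nlinarith [sq_nonneg (Real.exp (p / 2) - Real.exp (q / 2)), Real.exp_pos (p / 2),
    Real.exp_pos (q / 2)]

/-- A product of two factors, controlled by exponentials of half the exponent in two directions. -/
lemma mul_le_exp_add_exp {κ α β a b p z : ℝ} (hα : 0 ≤ α) (hβ : 0 ≤ β) (hb : 0 ≤ b)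
    (h1 : a ≤ α * Real.exp (κ / 2 * p ^ 2)) (h2 : b ≤ β * Real.exp (κ / 2 * z ^ 2)) :
    a * b ≤ α * β * (Real.exp (κ * p ^ 2) + Real.exp (κ * z ^ 2)) := by
  have h3 := exp_half_mul_exp_half_le (κ * p ^ 2) (κ * z ^ 2)
  calc a * b ≤ (α * Real.exp (κ / 2 * p ^ 2)) * (β * Real.exp (κ / 2 * z ^ 2)) :=
        mul_le_mul h1 h2 hb (by positivity)
    _ = α * β * (Real.exp (κ * p ^ 2 / 2) * Real.exp (κ * z ^ 2 / 2)) := by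
        rw [show κ / 2 * p ^ 2 = κ * p ^ 2 / 2 by ring, show κ / 2 * z ^ 2 = κ * z ^ 2 / 2 by ring]
        ring
    _ ≤ _ := by gcongr

lemma IsErrorLaw.lintegral_le_of_le_exp (hQ : IsErrorLaw Q μ f f₂ l₀ σ G) {H : (Fin d → ℝ) → ℝ}
    {c : ℝ} (hc : 0 ≤ c) {u v : Fin d → ℝ} (hu : l2norm u ≤ 2) (hv : l2norm v ≤ 2)
    (hH : ∀ᵐ x ∂μ,
      H x ≤ c * (Real.exp (σ * (x ⬝ᵥ v) ^ 2) + Real.exp (σ * (x ⬝ᵥ u) ^ 2))) :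
    ∫⁻ x, ENNReal.ofReal (H x) ∂μ ≤ ENNReal.ofReal (2 * G * c) := by
  have hG := hQ.one_le_G
  calc ∫⁻ x, ENNReal.ofReal (H x) ∂μ
      ≤ ∫⁻ x, ENNReal.ofReal c * (ENNReal.ofReal (Real.exp (σ * (x ⬝ᵥ v) ^ 2)) +
          ENNReal.ofReal (Real.exp (σ * (x ⬝ᵥ u) ^ 2))) ∂μ := by
        refine lintegral_mono_ae ?_
        filter_upwards [hH] with x hx
        rw [← ENNReal.ofReal_add (Real.exp_pos _).le (Real.exp_pos _).le, ← ENNReal.ofReal_mul hc]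
        exact ENNReal.ofReal_le_ofReal hx
    _ = ENNReal.ofReal c * (∫⁻ x, ENNReal.ofReal (Real.exp (σ * (x ⬝ᵥ v) ^ 2)) ∂μ +
          ∫⁻ x, ENNReal.ofReal (Real.exp (σ * (x ⬝ᵥ u) ^ 2)) ∂μ) := by
        rw [lintegral_const_mul _ (by fun_prop), lintegral_add_left (by fun_prop)]
    _ ≤ ENNReal.ofReal c * (ENNReal.ofReal G + ENNReal.ofReal G) := by
        gcongr
        · exact hQ.exp_moment v hv
        · exact hQ.exp_moment u hu
    _ = _ := by
        rw [← ENNReal.ofReal_add (by linarith) (by linarith), ← ENNReal.ofReal_mul hc]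
        congr 1
        ring

lemma IsErrorLaw.integrable_of_le_exp (hQ : IsErrorLaw Q μ f f₂ l₀ σ G) {H : (Fin d → ℝ) → ℝ}
    (hm : AEStronglyMeasurable H μ)
    {c : ℝ} (hc : 0 ≤ c) {u v : Fin d → ℝ} (hu : l2norm u ≤ 2) (hv : l2norm v ≤ 2)
    (hH : ∀ᵐ x ∂μ,
      |H x| ≤ c * (Real.exp (σ * (x ⬝ᵥ v) ^ 2) + Real.exp (σ * (x ⬝ᵥ u) ^ 2))) :
    Integrable H μ ∧ |∫ x, H x ∂μ| ≤ 2 * G * c ∧ ∫ x, |H x| ∂μ ≤ 2 * G * c := by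
  have hG := hQ.one_le_G
  obtain ⟨h1, h2⟩ := integrable_and_integral_le_of_lintegral_le (g := fun x => |H x|)
    (by fun_prop) (fun _ => abs_nonneg _) (by positivity)
    (hQ.lintegral_le_of_le_exp hc hu hv hH)
  exact ⟨(integrable_norm_iff hm).1 h1, (abs_integral_le_integral_abs).trans h2, h2⟩

/-! ### Integrals against a Lipschitz density -/

lemma continuous_of_abs_sub_le {g : ℝ → ℝ} {l : ℝ} (hg : ∀ u v, |g u - g v| ≤ l * |u - v|)
    (hl : 0 ≤ l) : Continuous g := by
  have : LipschitzWith ⟨l, hl⟩ g := LipschitzWith.of_dist_le_mul fun u v => by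
    rw [Real.dist_eq, Real.dist_eq]; exact hg u v
  exact this.continuous

lemma IsSmoothingKernel.integrable {K : ℝ → ℝ} (hK : IsSmoothingKernel K) : Integrable K := by
  by_contra h
  have := hK.integral_eq_one
  rw [integral_undef h] at this
  exact zero_ne_one this

lemma IsSmoothingKernel.continuous {K : ℝ → ℝ} (hK : IsSmoothingKernel K) : Continuous K :=
  hK.differentiable.continuous

lemma IsSmoothingKernel.integrable_abs_mul {K : ℝ → ℝ} (hK : IsSmoothingKernel K) :
    Integrable fun u => |u| * K u := by
  refine (hK.integrable.add hK.second_moment).mono'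
    (continuous_abs.mul hK.continuous).aestronglyMeasurable (ae_of_all _ fun u => ?_)
  have := hK.nonneg u
  rw [Real.norm_eq_abs, abs_of_nonneg (by positivity)]
  simp only [Pi.add_apply]
  nlinarith [mul_nonneg this (sq_nonneg (|u| - 1)), sq_abs u, mul_nonneg this (abs_nonneg u)]

lemma scaledKernel_nonneg {K : ℝ → ℝ} (hK : IsSmoothingKernel K) {b : ℝ} (hb : 0 < b) (u : ℝ) :
    0 ≤ scaledKernel K b u := div_nonneg (hK.nonneg _) hb.le

/-- Smoothing a Lipschitz density around `y` with bandwidth `b` recovers its value at zero up to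
`O(|y| + b)`. -/
lemma integral_mul_scaledKernel {K : ℝ → ℝ} (hK : IsSmoothingKernel K) {g : ℝ → ℝ} {l : ℝ}
    (hg : ∀ u v, |g u - g v| ≤ l * |u - v|) (hl : 0 ≤ l) {b : ℝ} (hb : 0 < b) (y : ℝ) :
    Integrable (fun u => g u * scaledKernel K b (u - y)) ∧
      |(∫ u, g u * scaledKernel K b (u - y)) - g 0| ≤ l * (|y| + b * ∫ u, |u| * K u) := by
  have hgc : Continuous g := continuous_of_abs_sub_le hg hl
  set H : ℝ → ℝ := fun w => K w * g (y + b * w) with hH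
  have hdiff : ∀ w, |K w * (g (y + b * w) - g 0)| ≤ l * |y| * K w + l * b * (|w| * K w) := by
    intro w
    have h1 := hg (y + b * w) 0
    rw [sub_zero] at h1
    have h2 : |y + b * w| ≤ |y| + b * |w| := by
      refine (abs_add_le _ _).trans ?_
      rw [abs_mul, abs_of_pos hb]
    rw [abs_mul, abs_of_nonneg (hK.nonneg w)]
    nlinarith [mul_le_mul_of_nonneg_left (h1.trans (mul_le_mul_of_nonneg_left h2 hl))
      (hK.nonneg w)]
  have hbd : Integrable fun w => l * |y| * K w + l * b * (|w| * K w) :=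
    (hK.integrable.const_mul _).add (hK.integrable_abs_mul.const_mul _)
  have hd : Integrable fun w => K w * (g (y + b * w) - g 0) :=
    hbd.mono' (by have := hK.continuous; fun_prop) (ae_of_all _ hdiff)
  have hHi : Integrable H := by
    refine (hd.add (hK.integrable.mul_const (g 0))).congr (ae_of_all _ fun w => ?_)
    simp only [hH, Pi.add_apply]
    ring
  have hcv : (fun u => g u * scaledKernel K b (u - y)) = fun u => b⁻¹ * H ((u - y) / b) := by
    funext u
    simp only [hH, scaledKernel]
    rw [mul_div_cancel₀ _ hb.ne', add_sub_cancel, div_eq_inv_mul]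
    ring
  have hcomp : Integrable fun u => H ((u - y) / b) :=
    (hHi.comp_div hb.ne').comp_sub_right y
  refine ⟨by rw [hcv]; exact hcomp.const_mul _, ?_⟩
  have e1 : ∫ u, g u * scaledKernel K b (u - y) = ∫ w, H w := by
    rw [hcv, integral_const_mul, integral_sub_right_eq_self (fun u => H (u / b)) y,
      Measure.integral_comp_div, abs_of_pos hb, smul_eq_mul, inv_mul_cancel_left₀ hb.ne']
  have e2 : (∫ w, H w) - g 0 = ∫ w, K w * (g (y + b * w) - g 0) := by
    have : ∫ w, K w * g 0 = g 0 := by rw [integral_mul_const, hK.integral_eq_one, one_mul]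
    calc (∫ w, H w) - g 0 = (∫ w, H w) - ∫ w, K w * g 0 := by rw [this]
      _ = ∫ w, (H w - K w * g 0) := (integral_sub hHi (hK.integrable.mul_const _)).symm
      _ = _ := by simp only [hH, mul_sub]
  rw [e1, e2]
  refine (abs_integral_le_integral_abs).trans ((integral_mono hd.abs hbd hdiff).trans ?_)
  rw [integral_add (hK.integrable.const_mul _) (hK.integrable_abs_mul.const_mul _),
    integral_const_mul, integral_const_mul, hK.integral_eq_one]
  exact le_of_eq (by ring)

open Classical in
/-- `I(u ≤ y) - I(u ≤ 0)`. -/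
noncomputable def indicatorDiff (y u : ℝ) : ℝ := (if u ≤ y then 1 else 0) - if u ≤ 0 then 1 else 0

lemma indicatorDiff_eq (y u : ℝ) : indicatorDiff y u =
    (Set.Ioc 0 y).indicator (fun _ => 1) u - (Set.Ioc y 0).indicator (fun _ => 1) u := by
  unfold indicatorDiff
  by_cases h1 : u ≤ y <;> by_cases h2 : u ≤ 0 <;>
    simp [Set.indicator, h1, h2, not_lt.2, not_le.1]

lemma abs_indicatorDiff_le_one (y u : ℝ) : |indicatorDiff y u| ≤ 1 := by
  unfold indicatorDiff
  split_ifs <;> simp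

lemma abs_indicatorDiff_eq (y u : ℝ) :
    |indicatorDiff y u| = (Set.uIoc 0 y).indicator (fun _ => 1) u := by
  rw [indicatorDiff_eq]
  rcases le_total 0 y with h | h
  · rw [Set.uIoc_of_le h, show Set.Ioc y 0 = ∅ from Set.Ioc_eq_empty (not_lt.2 h)]
    simp only [Set.indicator_empty, sub_zero]
    exact abs_of_nonneg (Set.indicator_nonneg (by simp) _)
  · rw [Set.uIoc_of_ge h, show Set.Ioc 0 y = ∅ from Set.Ioc_eq_empty (not_lt.2 h)]
    simp only [Set.indicator_empty, zero_sub, abs_neg]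
    exact abs_of_nonneg (Set.indicator_nonneg (by simp) _)

lemma measurable_indicatorDiff : Measurable (Function.uncurry indicatorDiff) := by
  unfold indicatorDiff
  refine Measurable.sub ?_ ?_
  · exact Measurable.ite (measurableSet_le measurable_snd measurable_fst) measurable_const
      measurable_const
  · exact Measurable.ite (measurableSet_le measurable_snd measurable_const) measurable_const
      measurable_const

lemma integral_mul_indicatorDiff {g : ℝ → ℝ} {l : ℝ}
    (hg : ∀ u v, |g u - g v| ≤ l * |u - v|) (hl : 0 ≤ l) (hg0 : ∀ u, 0 ≤ g u) (y : ℝ) :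
    |(∫ u, g u * indicatorDiff y u) - g 0 * y| ≤ l * y ^ 2 ∧
      ∫⁻ u, ENNReal.ofReal (g u * |indicatorDiff y u|) ≤
        ENNReal.ofReal ((g 0 + l * |y|) * |y|) := by
  have hgc : Continuous g := continuous_of_abs_sub_le hg hl
  have hnear : ∀ u ∈ Set.uIoc 0 y, |u| ≤ |y| := by
    intro u hu
    rcases le_total 0 y with h | h
    · rw [Set.uIoc_of_le h] at hu
      rw [abs_of_pos hu.1, abs_of_nonneg h]; exact hu.2
    · rw [Set.uIoc_of_ge h] at hu
      rw [abs_of_nonpos hu.2, abs_of_nonpos h]; linarith [hu.1]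
  constructor
  · have hI : ∀ a b : ℝ, Integrable fun u => (Set.Ioc a b).indicator g u := fun a b =>
      (integrable_indicator_iff measurableSet_Ioc).2
        ((hgc.integrableOn_Icc (a := a) (b := b)).mono_set Set.Ioc_subset_Icc_self)
    have e : ∫ u, g u * indicatorDiff y u = ∫ u in (0 : ℝ)..y, g u := by
      rw [intervalIntegral, ← integral_indicator measurableSet_Ioc,
        ← integral_indicator measurableSet_Ioc, ← integral_sub (hI _ _) (hI _ _)]
      refine integral_congr_ae (ae_of_all _ fun u => ?_)
      simp [indicatorDiff_eq, mul_sub, Set.indicator]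
    have e2 : g 0 * y = ∫ _ in (0 : ℝ)..y, g 0 := by
      rw [intervalIntegral.integral_const, smul_eq_mul, sub_zero, mul_comm]
    rw [e, e2, ← intervalIntegral.integral_sub (hgc.intervalIntegrable _ _)
      (intervalIntegrable_const)]
    have := intervalIntegral.norm_integral_le_of_norm_le_const (a := 0) (b := y)
      (f := fun u => g u - g 0) (C := l * |y|) fun u hu => by
        rw [Real.norm_eq_abs]
        refine (hg u 0).trans ?_
        rw [sub_zero]
        exact mul_le_mul_of_nonneg_left (hnear u hu) hl
    rw [sub_zero, Real.norm_eq_abs, mul_assoc, abs_mul_abs_self, ← sq] at this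
    exact this
  · have hle : ∀ u, ENNReal.ofReal (g u * |indicatorDiff y u|) ≤
        (Set.uIoc 0 y).indicator (fun _ => ENNReal.ofReal (g 0 + l * |y|)) u := by
      intro u
      rw [abs_indicatorDiff_eq]
      by_cases hu : u ∈ Set.uIoc 0 y
      · rw [Set.indicator_of_mem hu, Set.indicator_of_mem hu, mul_one]
        apply ENNReal.ofReal_le_ofReal
        have h1 := (abs_le.1 (hg u 0)).2
        rw [sub_zero] at h1
        linarith [mul_le_mul_of_nonneg_left (hnear u hu) hl]
      · simp [Set.indicator_of_notMem hu]
    refine (lintegral_mono hle).trans ?_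
    rw [lintegral_indicator_const measurableSet_uIoc,
      ENNReal.ofReal_mul (add_nonneg (hg0 0) (mul_nonneg hl (abs_nonneg y)))]
    gcongr
    rw [Set.uIoc, Real.volume_Ioc, max_sub_min_eq_abs, sub_zero]

end Law

/-! ### Moments of the summands -/

section Moments

variable {d : ℕ} {Q : Measure ((Fin d → ℝ) × ℝ)} {μ : Measure (Fin d → ℝ)}
  {f : (Fin d → ℝ) → ℝ → ℝ} {f₂ l₀ σ G : ℝ}

lemma IsErrorLaw.measurable_apply_zero (hQ : IsErrorLaw Q μ f f₂ l₀ σ G) :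
    Measurable fun x => f x 0 :=
  hQ.measurable.comp (measurable_id.prodMk measurable_const)

/-- The summand `K_b(ε - a Xᵀu) (Xᵀv)²` of the quadratic form of the local Hessian. -/
noncomputable def kernelQuadratic {d : ℕ} (K : ℝ → ℝ) (a b : ℝ) (u v : Fin d → ℝ)
    (z : (Fin d → ℝ) × ℝ) : ℝ :=
  (z.1 ⬝ᵥ v) ^ 2 * scaledKernel K b (z.2 - a * (z.1 ⬝ᵥ u))

lemma measurable_kernelQuadratic {K : ℝ → ℝ} (hK : IsSmoothingKernel K) (a b : ℝ)
    (u v : Fin d → ℝ) : Measurable (kernelQuadratic K a b u v) := by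
  have := hK.continuous.measurable
  unfold kernelQuadratic scaledKernel
  have h1 : Measurable fun z : (Fin d → ℝ) × ℝ => z.1 ⬝ᵥ v :=
    (measurable_dotProduct_right v).comp measurable_fst
  have h2 : Measurable fun z : (Fin d → ℝ) × ℝ => z.1 ⬝ᵥ u :=
    (measurable_dotProduct_right u).comp measurable_fst
  fun_prop

/-- The variance proxy of the kernel summands is of order `1 / b`, since only one of the two factors
`K_b` is bounded by its supremum and the other one is integrated out. -/
lemma exists_kernelQuadratic_bounds {K : ℝ → ℝ} (hK : IsSmoothingKernel K)
    (f₂ l₀ σ G : ℝ) (hf₂ : 0 ≤ f₂) (hl₀ : 0 ≤ l₀) (hσ : 0 < σ) (hG : 1 ≤ G) :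
    ∃ C > 0, ∃ c > 0, ∀ {d : ℕ} (Q : Measure ((Fin d → ℝ) × ℝ)) (μ : Measure (Fin d → ℝ))
      (f : (Fin d → ℝ) → ℝ → ℝ), IsErrorLaw Q μ f f₂ l₀ σ G →
      ∀ u v : Fin d → ℝ, l2norm u ≤ 2 → l2norm v ≤ 2 → ∀ a b : ℝ, 0 < a → a ≤ 1 → 0 < b → b ≤ 1 →
        (∀ t, 0 ≤ t → t ≤ c * b → ∫⁻ z, ENNReal.ofReal (kernelQuadratic K a b u v z ^ 2 *
          Real.exp (t * |kernelQuadratic K a b u v z|)) ∂Q ≤ ENNReal.ofReal (C / b)) ∧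
        |∫ z, kernelQuadratic K a b u v z ∂Q - ∫ x, (x ⬝ᵥ v) ^ 2 * f x 0 ∂μ| ≤ C * (a + b) := by
  obtain ⟨B₀, hB₀⟩ := hK.bounded
  set B := max B₀ 1 with hBdef
  have hB : ∀ u, K u ≤ B := fun u => (hB₀ u).trans (le_max_left _ _)
  have hBpos : 0 < B := lt_of_lt_of_le one_pos (le_max_right _ _)
  set M := ∫ u, |u| * K u with hM
  have hM0 : 0 ≤ M := integral_nonneg fun u => mul_nonneg (abs_nonneg u) (hK.nonneg u)
  set D := f₂ + l₀ * M + l₀ * (1 + 1 / (σ / 2)) with hD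
  have hD0 : 0 ≤ D := by positivity
  set E := l₀ * (1 + 1 / (σ / 2)) + l₀ * M with hE
  have hE0 : 0 ≤ E := by positivity
  set C₁ := 2 * G * (B * (32 / σ ^ 2) * D) with hC₁
  set C₂ := 2 * G * (1 / (σ / 2) * E) with hC₂
  have hC₁0 : 0 ≤ C₁ := by positivity
  have hC₂0 : 0 ≤ C₂ := by positivity
  refine ⟨C₁ + C₂ + 1, by positivity, σ / (4 * B), by positivity, ?_⟩
  intro d Q μ f hQ u v hu hv a b ha ha1 hb hb1
  have hprob := hQ.prob
  have hQprob := hQ.prob_law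
  -- the inner integral over the error
  have hinner : ∀ᵐ x ∂μ, Integrable (fun e => f x e * scaledKernel K b (e - a * (x ⬝ᵥ u))) ∧
      |(∫ e, f x e * scaledKernel K b (e - a * (x ⬝ᵥ u))) - f x 0| ≤
        l₀ * (|a * (x ⬝ᵥ u)| + b * M) := by
    filter_upwards [hQ.regular] with x hx
    exact integral_mul_scaledKernel hK hx.2 hl₀ hb _
  have hau : ∀ x : Fin d → ℝ, |a * (x ⬝ᵥ u)| ≤
      a * ((1 + 1 / (σ / 2)) * Real.exp (σ / 2 * (x ⬝ᵥ u) ^ 2)) := fun x => by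
    rw [abs_mul, abs_of_pos ha]
    exact mul_le_mul_of_nonneg_left (abs_le_mul_exp (by positivity) _) ha.le
  have hone : ∀ x : Fin d → ℝ, 1 ≤ Real.exp (σ / 2 * (x ⬝ᵥ u) ^ 2) := fun x =>
    Real.one_le_exp (by positivity)
  have hvar : ∀ t, 0 ≤ t → t ≤ σ / (4 * B) * b →
      ∫⁻ z, ENNReal.ofReal (kernelQuadratic K a b u v z ^ 2 *
        Real.exp (t * |kernelQuadratic K a b u v z|)) ∂Q ≤ ENNReal.ofReal (C₁ / b) := by
    intro t ht htb
    have hmφ := measurable_kernelQuadratic (d := d) hK a b u v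
    refine hQ.lintegral_ofReal_le (by fun_prop)
      (H := fun x => (B / b) * ((x ⬝ᵥ v) ^ 4 * Real.exp (σ / 4 * (x ⬝ᵥ v) ^ 2)) *
        (f₂ + l₀ * (|a * (x ⬝ᵥ u)| + b * M))) ?_ ?_
    · filter_upwards [hinner, hQ.regular] with x hx hreg
      have hk : ∀ e, scaledKernel K b e ≤ B / b := fun e => by
        unfold scaledKernel; gcongr; exact hB _
      have hpt : ∀ e, f x e * (kernelQuadratic K a b u v (x, e) ^ 2 *
          Real.exp (t * |kernelQuadratic K a b u v (x, e)|)) ≤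
          (B / b) * ((x ⬝ᵥ v) ^ 4 * Real.exp (σ / 4 * (x ⬝ᵥ v) ^ 2)) *
            (f x e * scaledKernel K b (e - a * (x ⬝ᵥ u))) := by
        intro e
        simp only [kernelQuadratic]
        set k := scaledKernel K b (e - a * (x ⬝ᵥ u)) with hkdef
        have hk0 : 0 ≤ k := scaledKernel_nonneg hK hb _
        have hkB : k ≤ B / b := hk _
        have hexp : t * |(x ⬝ᵥ v) ^ 2 * k| ≤ σ / 4 * (x ⬝ᵥ v) ^ 2 := by
          rw [abs_of_nonneg (by positivity)]
          calc t * ((x ⬝ᵥ v) ^ 2 * k) ≤ (σ / (4 * B) * b) * ((x ⬝ᵥ v) ^ 2 * (B / b)) := by gcongr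
            _ = σ / 4 * (x ⬝ᵥ v) ^ 2 := by field_simp
        have hf := hQ.nonneg x e
        calc f x e * (((x ⬝ᵥ v) ^ 2 * k) ^ 2 * Real.exp (t * |(x ⬝ᵥ v) ^ 2 * k|))
            ≤ f x e * (((x ⬝ᵥ v) ^ 2) ^ 2 * (k * (B / b)) *
                Real.exp (σ / 4 * (x ⬝ᵥ v) ^ 2)) := by
              rw [mul_pow, sq k]
              gcongr
          _ = _ := by ring
      have hc0 : 0 ≤ (B / b) * ((x ⬝ᵥ v) ^ 4 * Real.exp (σ / 4 * (x ⬝ᵥ v) ^ 2)) := by positivity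
      calc ∫⁻ e, ENNReal.ofReal (f x e * (kernelQuadratic K a b u v (x, e) ^ 2 *
          Real.exp (t * |kernelQuadratic K a b u v (x, e)|)))
          ≤ ∫⁻ e, ENNReal.ofReal ((B / b) * ((x ⬝ᵥ v) ^ 4 * Real.exp (σ / 4 * (x ⬝ᵥ v) ^ 2)) *
            (f x e * scaledKernel K b (e - a * (x ⬝ᵥ u)))) :=
            lintegral_mono fun e => ENNReal.ofReal_le_ofReal (hpt e)
        _ = ENNReal.ofReal (∫ e, (B / b) * ((x ⬝ᵥ v) ^ 4 * Real.exp (σ / 4 * (x ⬝ᵥ v) ^ 2)) *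
            (f x e * scaledKernel K b (e - a * (x ⬝ᵥ u)))) :=
            (ofReal_integral_eq_lintegral_ofReal (hx.1.const_mul _) (ae_of_all _ fun e =>
              mul_nonneg hc0 (mul_nonneg (hQ.nonneg x e) (scaledKernel_nonneg hK hb _)))).symm
        _ ≤ _ := by
            rw [integral_const_mul]
            apply ENNReal.ofReal_le_ofReal
            refine mul_le_mul_of_nonneg_left ?_ hc0
            linarith [(abs_le.1 hx.2).2, hreg.1]
    · have hcb : C₁ / b = 2 * G * (B * (32 / σ ^ 2) * D / b) := by rw [hC₁]; ring
      rw [hcb]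
      refine hQ.lintegral_le_of_le_exp (u := u) (v := v) (by positivity) hu hv
        (ae_of_all _ fun x => ?_)
      have hp := fourth_power_mul_exp_le hσ (x ⬝ᵥ v)
      have hz : f₂ + l₀ * (|a * (x ⬝ᵥ u)| + b * M) ≤
          D * Real.exp (σ / 2 * (x ⬝ᵥ u) ^ 2) := by
        have h1 : |a * (x ⬝ᵥ u)| ≤ (1 + 1 / (σ / 2)) * Real.exp (σ / 2 * (x ⬝ᵥ u) ^ 2) :=
          (hau x).trans (mul_le_of_le_one_left (by positivity) ha1)
        have h2 : b * M ≤ M * Real.exp (σ / 2 * (x ⬝ᵥ u) ^ 2) := by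
          nlinarith [hone x, mul_le_mul_of_nonneg_right hb1 hM0,
            mul_le_mul_of_nonneg_left (hone x) hM0]
        have h3 := mul_le_mul_of_nonneg_left (add_le_add h1 h2) hl₀
        have h4 := mul_le_mul_of_nonneg_left (hone x) hf₂
        rw [hD]
        linarith
      have h := mul_le_exp_add_exp (by positivity) hD0 (by positivity) hp hz
      calc _ = (B / b) * ((x ⬝ᵥ v) ^ 4 * Real.exp (σ / 4 * (x ⬝ᵥ v) ^ 2) *
            (f₂ + l₀ * (|a * (x ⬝ᵥ u)| + b * M))) := by ring
        _ ≤ (B / b) * (32 / σ ^ 2 * D * (Real.exp (σ * (x ⬝ᵥ v) ^ 2) +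
            Real.exp (σ * (x ⬝ᵥ u) ^ 2))) := by gcongr
        _ = _ := by ring
  have hf0 := hQ.measurable_apply_zero
  have hqexp : ∀ x : Fin d → ℝ, (x ⬝ᵥ v) ^ 2 ≤ 1 / (σ / 2) * Real.exp (σ / 2 * (x ⬝ᵥ v) ^ 2) :=
    fun x => sq_le_mul_exp (by positivity) _
  constructor
  · intro t ht htb
    refine (hvar t ht htb).trans (ENNReal.ofReal_le_ofReal ?_)
    gcongr
    linarith
  · have hφi : Integrable (kernelQuadratic K a b u v) Q :=
      integrable_of_lintegral_sq_mul_exp_le (measurable_kernelQuadratic hK a b u v) le_rfl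
        (by positivity) (hvar 0 le_rfl (by positivity))
    have hAT := (hQ.integrable_of_le_exp (H := fun x => (x ⬝ᵥ v) ^ 2 * f x 0) (u := u) (v := v)
      (c := 1 / (σ / 2) * f₂) (by fun_prop) (by positivity) hu hv (by
        filter_upwards [hQ.regular] with x hx
        rw [abs_of_nonneg (mul_nonneg (sq_nonneg _) (hQ.nonneg x 0))]
        refine mul_le_exp_add_exp (by positivity) hf₂ (hQ.nonneg x 0) (hqexp x) ?_
        nlinarith [hx.1, hone x])).1
    have hAR := hQ.integrable_of_le_exp
      (H := fun x => |(x ⬝ᵥ v) ^ 2| * (l₀ * (|a * (x ⬝ᵥ u)| + b * M))) (u := u) (v := v)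
      (c := 1 / (σ / 2) * (E * (a + b))) (by fun_prop) (by positivity) hu hv (ae_of_all _ fun x => by
        rw [abs_of_nonneg (a := |(x ⬝ᵥ v) ^ 2| * _) (by positivity), abs_of_nonneg (sq_nonneg _)]
        refine mul_le_exp_add_exp (by positivity) (by positivity) (by positivity) (hqexp x) ?_
        have h1 := hau x
        have h2 : b * M ≤ b * M * Real.exp (σ / 2 * (x ⬝ᵥ u) ^ 2) :=
          le_mul_of_one_le_right (by positivity) (hone x)
        have h3 := mul_le_mul_of_nonneg_left (add_le_add h1 h2) hl₀
        have h4 : 0 ≤ (l₀ * (1 + 1 / (σ / 2)) * b + l₀ * M * a) *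
          Real.exp (σ / 2 * (x ⬝ᵥ u) ^ 2) := by positivity
        rw [hE]
        linarith)
    refine (hQ.abs_integral_sub_le (A := fun x => (x ⬝ᵥ v) ^ 2) (T := fun x => f x 0)
      (ψ := fun x e => scaledKernel K b (e - a * (x ⬝ᵥ u))) hφi
      (hinner.mono fun x hx => hx.2) hAT hAR.1
      ((le_abs_self _).trans hAR.2.1)).trans ?_
    have : 2 * G * (1 / (σ / 2) * (E * (a + b))) = C₂ * (a + b) := by rw [hC₂]; ring
    rw [this]
    gcongr
    linarith

/-- The summand `w(X) {I(ε ≤ a (Xᵀu + ρ)) - I(ε ≤ 0)}`. -/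
noncomputable def indicatorIncrement {d : ℕ} (w : (Fin d → ℝ) → ℝ) (a ρ : ℝ) (u : Fin d → ℝ)
    (z : (Fin d → ℝ) × ℝ) : ℝ :=
  w z.1 * indicatorDiff (a * (z.1 ⬝ᵥ u + ρ)) z.2

lemma measurable_indicatorIncrement {w : (Fin d → ℝ) → ℝ} (hw : Measurable w) (a ρ : ℝ)
    (u : Fin d → ℝ) : Measurable (indicatorIncrement w a ρ u) := by
  unfold indicatorIncrement
  have h2 : Measurable fun z : (Fin d → ℝ) × ℝ => z.1 ⬝ᵥ u :=
    (measurable_dotProduct_right u).comp measurable_fst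
  have h3 : Measurable fun z : (Fin d → ℝ) × ℝ =>
      indicatorDiff (a * (z.1 ⬝ᵥ u + ρ)) z.2 :=
    measurable_indicatorDiff.comp (Measurable.prodMk (by fun_prop) measurable_snd)
  fun_prop

lemma l2norm_single_one (j : Fin d) : l2norm (Pi.single j (1 : ℝ)) = 1 := by
  have h : l2norm (Pi.single j (1 : ℝ)) ^ 2 = 1 := by
    rw [← dotProduct_self_eq_l2norm_sq]; simp
  have := l2norm_nonneg (Pi.single j (1 : ℝ))
  nlinarith

lemma dotProduct_single_one_right (x : Fin d → ℝ) (j : Fin d) :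
    x ⬝ᵥ Pi.single j (1 : ℝ) = x j := by simp

/-- The increments of the indicator process over distance `a` have variance proxy of order `a`, and
their mean is linear up to order `a²`. -/
lemma exists_indicatorIncrement_bounds
    (f₂ l₀ σ G : ℝ) (hf₂ : 0 ≤ f₂) (hl₀ : 0 ≤ l₀) (hσ : 0 < σ) (hG : 1 ≤ G) :
    ∃ C > 0, ∀ {d : ℕ} (Q : Measure ((Fin d → ℝ) × ℝ)) (μ : Measure (Fin d → ℝ))
      (f : (Fin d → ℝ) → ℝ → ℝ), IsErrorLaw Q μ f f₂ l₀ σ G →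
      ∀ (j : Fin d) (w : (Fin d → ℝ) → ℝ), Measurable w → (∀ x, |w x| ≤ |x j|) →
      ∀ (u : Fin d → ℝ) (a ρ : ℝ), l2norm u ≤ 2 → 0 < a → a ≤ 1 → |ρ| ≤ 1 →
        (∀ t, 0 ≤ t → t ≤ 1 → ∫⁻ z, ENNReal.ofReal (indicatorIncrement w a ρ u z ^ 2 *
          Real.exp (t * |indicatorIncrement w a ρ u z|)) ∂Q ≤ ENNReal.ofReal (C * a)) ∧
        |∫ z, indicatorIncrement w a ρ u z ∂Q -
          ∫ x, w x * (f x 0 * (a * (x ⬝ᵥ u + ρ))) ∂μ| ≤ C * a ^ 2 := by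
  set S := 1 + 1 / (σ / 2) with hS
  have hS0 : 0 < S := by positivity
  set C₁ := 2 * G * (4 / σ * Real.exp (1 / σ) * (2 * (f₂ + l₀) * S)) with hC₁
  set C₂ := 2 * G * (S * (2 * l₀ * S)) with hC₂
  have hC₁0 : 0 ≤ C₁ := by positivity
  have hC₂0 : 0 ≤ C₂ := by positivity
  refine ⟨C₁ + C₂ + 1, by positivity, ?_⟩
  intro d Q μ f hQ j w hw hwj u a ρ hu ha ha1 hρ
  have hprob := hQ.prob
  have hQprob := hQ.prob_law
  have hmφ := measurable_indicatorIncrement hw a ρ u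
  set e : Fin d → ℝ := Pi.single j 1 with he
  have hev : l2norm e ≤ 2 := by rw [he, l2norm_single_one]; norm_num
  have hej : ∀ x : Fin d → ℝ, x j = x ⬝ᵥ e := fun x => (dotProduct_single_one_right x j).symm
  have hy : ∀ x : Fin d → ℝ, |a * (x ⬝ᵥ u + ρ)| ≤ a * (|x ⬝ᵥ u| + 1) := fun x => by
    rw [abs_mul, abs_of_pos ha]
    gcongr
    exact (abs_add_le _ _).trans (by linarith)
  have hz2 : ∀ x : Fin d → ℝ, (|x ⬝ᵥ u| + 1) ^ 2 ≤
      2 * S * Real.exp (σ / 2 * (x ⬝ᵥ u) ^ 2) := fun x => by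
    have h1 := one_add_sq_le_mul_exp (show 0 < σ / 2 by positivity) (x ⬝ᵥ u)
    nlinarith [sq_nonneg (|x ⬝ᵥ u| - 1), sq_abs (x ⬝ᵥ u)]
  have hinner : ∀ᵐ x ∂μ, |(∫ e, f x e * indicatorDiff (a * (x ⬝ᵥ u + ρ)) e) -
        f x 0 * (a * (x ⬝ᵥ u + ρ))| ≤ l₀ * (a * (x ⬝ᵥ u + ρ)) ^ 2 ∧
      ∫⁻ e, ENNReal.ofReal (f x e * |indicatorDiff (a * (x ⬝ᵥ u + ρ)) e|) ≤
        ENNReal.ofReal ((f x 0 + l₀ * |a * (x ⬝ᵥ u + ρ)|) * |a * (x ⬝ᵥ u + ρ)|) := by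
    filter_upwards [hQ.regular] with x hx
    exact integral_mul_indicatorDiff hx.2 hl₀ (hQ.nonneg x) _
  have hvar : ∀ t, 0 ≤ t → t ≤ 1 → ∫⁻ z, ENNReal.ofReal (indicatorIncrement w a ρ u z ^ 2 *
      Real.exp (t * |indicatorIncrement w a ρ u z|)) ∂Q ≤ ENNReal.ofReal (C₁ * a) := by
    intro t ht ht1
    refine hQ.lintegral_ofReal_le (by fun_prop)
      (H := fun x => (x ⬝ᵥ e) ^ 2 * Real.exp |x ⬝ᵥ e| *
        ((f x 0 + l₀ * |a * (x ⬝ᵥ u + ρ)|) * |a * (x ⬝ᵥ u + ρ)|)) ?_ ?_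
    · filter_upwards [hinner] with x hx
      have hpt : ∀ s, f x s * (indicatorIncrement w a ρ u (x, s) ^ 2 *
          Real.exp (t * |indicatorIncrement w a ρ u (x, s)|)) ≤
          (x ⬝ᵥ e) ^ 2 * Real.exp |x ⬝ᵥ e| *
            (f x s * |indicatorDiff (a * (x ⬝ᵥ u + ρ)) s|) := by
        intro s
        simp only [indicatorIncrement]
        set i := indicatorDiff (a * (x ⬝ᵥ u + ρ)) s with hi
        have hi1 : |i| ≤ 1 := abs_indicatorDiff_le_one _ _
        have hwx : |w x| ≤ |x ⬝ᵥ e| := by rw [← hej]; exact hwj x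
        have hexp : t * |w x * i| ≤ |x ⬝ᵥ e| := by
          rw [abs_mul]
          calc t * (|w x| * |i|) ≤ 1 * (|x ⬝ᵥ e| * 1) := by gcongr
            _ = _ := by ring
        have hsq : (w x * i) ^ 2 ≤ (x ⬝ᵥ e) ^ 2 * |i| := by
          rw [mul_pow, ← sq_abs (w x), ← sq_abs i, ← sq_abs (x ⬝ᵥ e)]
          gcongr
          rw [sq]
          exact mul_le_of_le_one_left (abs_nonneg _) hi1
        have hf := hQ.nonneg x s
        calc f x s * ((w x * i) ^ 2 * Real.exp (t * |w x * i|))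
            ≤ f x s * ((x ⬝ᵥ e) ^ 2 * |i| * Real.exp |x ⬝ᵥ e|) := by gcongr
          _ = _ := by ring
      have hc0 : 0 ≤ (x ⬝ᵥ e) ^ 2 * Real.exp |x ⬝ᵥ e| := by positivity
      refine (lintegral_mono fun s => ENNReal.ofReal_le_ofReal (hpt s)).trans ?_
      simp only [ENNReal.ofReal_mul hc0]
      rw [lintegral_const_mul' _ _ ENNReal.ofReal_ne_top]
      exact mul_le_mul_right hx.2 _
    · have hca : C₁ * a = 2 * G * (4 / σ * Real.exp (1 / σ) * (2 * (f₂ + l₀) * S * a)) := by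
        rw [hC₁]; ring
      rw [hca]
      refine hQ.lintegral_le_of_le_exp (u := u) (v := e) (by positivity) hu hev ?_
      filter_upwards [hQ.regular] with x hx
      have hf := hQ.nonneg x 0
      refine mul_le_exp_add_exp (by positivity) (by positivity) (by positivity)
        (sq_mul_exp_abs_le hσ _) ?_
      set r := |x ⬝ᵥ u| + 1 with hr
      have hr1 : 1 ≤ r := by rw [hr]; linarith [abs_nonneg (x ⬝ᵥ u)]
      calc (f x 0 + l₀ * |a * (x ⬝ᵥ u + ρ)|) * |a * (x ⬝ᵥ u + ρ)|
          ≤ (f₂ * r + l₀ * (1 * r)) * (a * r) := by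
            have h1 := hy x
            have h2 : |a * (x ⬝ᵥ u + ρ)| ≤ 1 * r := h1.trans (by gcongr)
            have h3 : f x 0 ≤ f₂ * r := hx.1.trans (le_mul_of_one_le_right hf₂ hr1)
            gcongr
        _ = (f₂ + l₀) * a * r ^ 2 := by ring
        _ ≤ (f₂ + l₀) * a * (2 * S * Real.exp (σ / 2 * (x ⬝ᵥ u) ^ 2)) := by
            gcongr
            exact hz2 x
        _ = _ := by ring
  have hf0 := hQ.measurable_apply_zero
  have hwexp : ∀ x : Fin d → ℝ, |w x| ≤ S * Real.exp (σ / 2 * (x ⬝ᵥ e) ^ 2) := fun x => by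
    refine (hwj x).trans ?_
    rw [hej x]
    exact abs_le_mul_exp (by positivity) _
  constructor
  · intro t ht ht1
    refine (hvar t ht ht1).trans (ENNReal.ofReal_le_ofReal ?_)
    gcongr
    linarith
  · have hφi : Integrable (indicatorIncrement w a ρ u) Q :=
      integrable_of_lintegral_sq_mul_exp_le hmφ le_rfl (by positivity)
        (hvar 0 le_rfl zero_le_one)
    have hAT := (hQ.integrable_of_le_exp (H := fun x => w x * (f x 0 * (a * (x ⬝ᵥ u + ρ))))
      (u := u) (v := e) (c := S * (f₂ * (2 * S))) (by fun_prop) (by positivity) hu hev (by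
        filter_upwards [hQ.regular] with x hx
        rw [abs_mul]
        refine mul_le_exp_add_exp (by positivity) (by positivity) (by positivity) (hwexp x) ?_
        rw [abs_mul, abs_of_nonneg (hQ.nonneg x 0), mul_assoc]
        refine mul_le_mul hx.1 ?_ (abs_nonneg _) hf₂
        refine le_trans ?_ (hz2 x)
        have h1 : a * (|x ⬝ᵥ u| + 1) ≤ |x ⬝ᵥ u| + 1 :=
          mul_le_of_le_one_left (by positivity) ha1
        nlinarith [hy x, abs_nonneg (x ⬝ᵥ u)])).1
    have hAR := hQ.integrable_of_le_exp
      (H := fun x => |w x| * (l₀ * (a * (x ⬝ᵥ u + ρ)) ^ 2)) (u := u) (v := e)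
      (c := S * (2 * l₀ * S * a ^ 2)) (by fun_prop) (by positivity) hu hev (ae_of_all _ fun x => by
        rw [abs_of_nonneg (by positivity)]
        refine mul_le_exp_add_exp (by positivity) (by positivity) (by positivity) (hwexp x) ?_
        have h1 : (a * (x ⬝ᵥ u + ρ)) ^ 2 ≤ (a * (|x ⬝ᵥ u| + 1)) ^ 2 := by
          rw [← sq_abs (a * (x ⬝ᵥ u + ρ))]
          gcongr
          exact hy x
        calc l₀ * (a * (x ⬝ᵥ u + ρ)) ^ 2
            ≤ l₀ * (a ^ 2 * (2 * S * Real.exp (σ / 2 * (x ⬝ᵥ u) ^ 2))) := by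
              refine mul_le_mul_of_nonneg_left (h1.trans ?_) hl₀
              rw [mul_pow]
              gcongr
              exact hz2 x
          _ = _ := by ring)
    refine (hQ.abs_integral_sub_le (A := w) (T := fun x => f x 0 * (a * (x ⬝ᵥ u + ρ)))
      (ψ := fun x s => indicatorDiff (a * (x ⬝ᵥ u + ρ)) s) hφi
      (hinner.mono fun x hx => hx.1) hAT hAR.1
      ((le_abs_self _).trans hAR.2.1)).trans ?_
    have : 2 * G * (S * (2 * l₀ * S * a ^ 2)) = C₂ * a ^ 2 := by rw [hC₂]; ring
    rw [this]
    gcongr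
    linarith

/-- The score `X_j {I(ε ≤ 0) - τ}` is centred, with bounded variance proxy. -/
lemma exists_score_bounds (f₂ l₀ σ G : ℝ) (hσ : 0 < σ) (hG : 1 ≤ G) :
    ∃ C > 0, ∀ {d : ℕ} (Q : Measure ((Fin d → ℝ) × ℝ)) (μ : Measure (Fin d → ℝ))
      (f : (Fin d → ℝ) → ℝ → ℝ), IsErrorLaw Q μ f f₂ l₀ σ G →
      ∀ τ : ℝ, 0 < τ → τ < 1 → (∀ᵐ x ∂μ, ∫ u in Set.Iic 0, f x u = τ) → ∀ j : Fin d,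
        (∀ t, 0 ≤ t → t ≤ 1 → ∫⁻ z, ENNReal.ofReal ((z.1 j * signScore τ z.2) ^ 2 *
          Real.exp (t * |z.1 j * signScore τ z.2|)) ∂Q ≤ ENNReal.ofReal C) ∧
        ∫ z, z.1 j * signScore τ z.2 ∂Q = 0 := by
  set C₁ := 2 * G * (4 / σ * Real.exp (1 / σ)) with hC₁
  refine ⟨C₁, by positivity, ?_⟩
  intro d Q μ f hQ τ hτ hτ1 hq j
  have hprob := hQ.prob
  have hQprob := hQ.prob_law
  set e : Fin d → ℝ := Pi.single j 1 with he
  have hev : l2norm e ≤ 2 := by rw [he, l2norm_single_one]; norm_num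
  have hej : ∀ x : Fin d → ℝ, x j = x ⬝ᵥ e := fun x => (dotProduct_single_one_right x j).symm
  have hms : Measurable (signScore τ) := by
    unfold signScore
    exact (Measurable.ite measurableSet_Iic measurable_const measurable_const).sub_const τ
  have hs1 : ∀ s, |signScore τ s| ≤ 1 := fun s => by
    unfold signScore
    rw [abs_le]
    split_ifs <;> constructor <;> linarith
  have hmφ : Measurable fun z : (Fin d → ℝ) × ℝ => z.1 j * signScore τ z.2 := by fun_prop
  have hcov : ∀ H : (Fin d → ℝ) → ℝ≥0∞, Measurable H → ∫⁻ z, H z.1 ∂Q = ∫⁻ x, H x ∂μ := by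
    intro H hH
    rw [← hQ.map_fst, lintegral_map hH measurable_fst]
  have hvar : ∀ t, 0 ≤ t → t ≤ 1 → ∫⁻ z, ENNReal.ofReal ((z.1 j * signScore τ z.2) ^ 2 *
      Real.exp (t * |z.1 j * signScore τ z.2|)) ∂Q ≤ ENNReal.ofReal C₁ := by
    intro t ht ht1
    calc _ ≤ ∫⁻ z, ENNReal.ofReal ((z.1 ⬝ᵥ e) ^ 2 * Real.exp |z.1 ⬝ᵥ e|) ∂Q := by
          refine lintegral_mono fun z => ENNReal.ofReal_le_ofReal ?_
          rw [hej z.1]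
          have h1 : t * |z.1 ⬝ᵥ e * signScore τ z.2| ≤ |z.1 ⬝ᵥ e| := by
            rw [abs_mul]
            calc t * (|z.1 ⬝ᵥ e| * |signScore τ z.2|) ≤ 1 * (|z.1 ⬝ᵥ e| * 1) := by
                  gcongr
                  exact hs1 _
              _ = _ := by ring
          have h2 : (z.1 ⬝ᵥ e * signScore τ z.2) ^ 2 ≤ (z.1 ⬝ᵥ e) ^ 2 := by
            rw [mul_pow]
            refine mul_le_of_le_one_right (sq_nonneg _) ?_
            rw [← sq_abs]
            exact pow_le_one₀ (abs_nonneg _) (hs1 _)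
          gcongr
      _ = ∫⁻ x, ENNReal.ofReal ((x ⬝ᵥ e) ^ 2 * Real.exp |x ⬝ᵥ e|) ∂μ :=
          hcov (fun x => ENNReal.ofReal ((x ⬝ᵥ e) ^ 2 * Real.exp |x ⬝ᵥ e|)) (by fun_prop)
      _ ≤ _ := by
          refine hQ.lintegral_le_of_le_exp (u := e) (v := e) (by positivity) hev hev
            (ae_of_all _ fun x => (sq_mul_exp_abs_le hσ _).trans ?_)
          have h3 : Real.exp (σ / 2 * (x ⬝ᵥ e) ^ 2) ≤ Real.exp (σ * (x ⬝ᵥ e) ^ 2) := by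
            apply Real.exp_le_exp.2
            nlinarith [mul_nonneg hσ.le (sq_nonneg (x ⬝ᵥ e))]
          gcongr
          linarith [Real.exp_pos (σ * (x ⬝ᵥ e) ^ 2)]
  refine ⟨hvar, ?_⟩
  have hxμ : Integrable (fun x : Fin d → ℝ => x j) μ :=
    (hQ.integrable_of_le_exp (u := e) (v := e) (H := fun x : Fin d → ℝ => x j)
      (c := 1 + 1 / σ) (measurable_pi_apply j).aestronglyMeasurable (by positivity) hev hev
      (ae_of_all _ fun x => by
        rw [hej x]
        refine (abs_le_mul_exp hσ _).trans ?_
        gcongr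
        linarith [Real.exp_pos (σ * (x ⬝ᵥ e) ^ 2)])).1
  have hφi : Integrable (fun z : (Fin d → ℝ) × ℝ => z.1 j * signScore τ z.2) Q :=
    integrable_of_lintegral_sq_mul_exp_le hmφ le_rfl (by positivity) (hvar 0 le_rfl zero_le_one)
  have hxQ : Integrable (fun z : (Fin d → ℝ) × ℝ => z.1 j) Q := by
    have : Integrable (fun x : Fin d → ℝ => x j) (Q.map Prod.fst) := by rwa [hQ.map_fst]
    exact this.comp_measurable measurable_fst
  have hI : Integrable (fun z : (Fin d → ℝ) × ℝ => z.1 j * (signScore τ z.2 + τ)) Q := by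
    refine (hφi.add (hxQ.mul_const τ)).congr (ae_of_all _ fun z => ?_)
    simp only [Pi.add_apply]
    ring
  -- conditionally on the covariate, `I(ε ≤ 0)` has mean `τ`
  have h := hQ.abs_integral_sub_le (A := fun x => x j) (T := fun _ => τ)
    (ψ := fun _ s => signScore τ s + τ) (R := fun _ => 0) (c := 0) hI (by
      filter_upwards [hq] with x hx
      rw [← hx, ← integral_indicator measurableSet_Iic]
      simp [signScore, Set.indicator]) (hxμ.mul_const τ) (by simp) (by simp)
  have e1 : ∫ z, z.1 j * (signScore τ z.2 + τ) ∂Q =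
      ∫ z, z.1 j * signScore τ z.2 ∂Q + ∫ z, z.1 j * τ ∂Q := by
    rw [← integral_add hφi (hxQ.mul_const τ)]
    simp only [mul_add]
  have e2 : ∫ z, z.1 j * τ ∂Q = ∫ x, x j * τ ∂μ := by
    have hmj : Measurable fun x : Fin d → ℝ => x j := measurable_pi_apply j
    rw [← hQ.map_fst, integral_map (f := fun x : Fin d → ℝ => x j * τ) measurable_fst.aemeasurable
      (hmj.mul_const τ).aestronglyMeasurable]
  rw [e1, e2, add_sub_cancel_right] at h
  exact abs_nonpos_iff.1 h

lemma IsErrorLaw.measure_lt_abs_le (hQ : IsErrorLaw Q μ f f₂ l₀ σ G) (j : Fin d) {R : ℝ}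
    (hR : 0 ≤ R) : Q {z | R < |z.1 j|} ≤ ENNReal.ofReal (G * Real.exp (-(σ * R ^ 2))) := by
  have hG := hQ.one_le_G
  have hσ := hQ.σ_pos
  set e : Fin d → ℝ := Pi.single j 1 with he
  have hev : l2norm e ≤ 2 := by rw [he, l2norm_single_one]; norm_num
  have hms : MeasurableSet {x : Fin d → ℝ | R < |x j|} :=
    measurableSet_lt measurable_const (measurable_pi_apply j).norm
  have e1 : Q {z | R < |z.1 j|} = μ {x | R < |x j|} := by
    rw [← hQ.map_fst, Measure.map_apply measurable_fst hms]
    rfl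
  have h1 : ENNReal.ofReal (Real.exp (σ * R ^ 2)) * μ {x | R < |x j|} ≤ ENNReal.ofReal G := by
    refine le_trans ?_ ((mul_meas_ge_le_lintegral (μ := μ)
      (f := fun x => ENNReal.ofReal (Real.exp (σ * (x ⬝ᵥ e) ^ 2))) (by fun_prop)
      (ENNReal.ofReal (Real.exp (σ * R ^ 2)))).trans (hQ.exp_moment e hev))
    gcongr with x
    intro hx
    rw [he, dotProduct_single_one_right]
    apply ENNReal.ofReal_le_ofReal
    apply Real.exp_le_exp.2
    rw [← sq_abs (x j)]
    gcongr
  rw [e1, Real.exp_neg, ← div_eq_mul_inv, ENNReal.ofReal_div_of_pos (Real.exp_pos _),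
    ENNReal.le_div_iff_mul_le (Or.inl (by simp [Real.exp_pos])) (Or.inl ENNReal.ofReal_ne_top),
    mul_comm]
  exact h1

lemma IsErrorLaw.integrable_mul_linear (hQ : IsErrorLaw Q μ f f₂ l₀ σ G) (j : Fin d)
    {w : (Fin d → ℝ) → ℝ} (hw : Measurable w) (hwj : ∀ x, |w x| ≤ |x j|) {y : Fin d → ℝ}
    (hy : l2norm y ≤ 2) {a : ℝ} (ha : 0 < a) (ρ : ℝ) :
    Integrable (fun x => w x * (f x 0 * (a * (x ⬝ᵥ y + ρ)))) μ := by
  have hσ := hQ.σ_pos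
  have hf₂ := hQ.f₂_nonneg
  have hf0 := hQ.measurable_apply_zero
  set S := 1 + 1 / (σ / 2) with hS
  have hS1 : 1 ≤ S := by rw [hS]; linarith [show 0 ≤ 1 / (σ / 2) by positivity]
  set e : Fin d → ℝ := Pi.single j 1 with he
  have hev : l2norm e ≤ 2 := by rw [he, l2norm_single_one]; norm_num
  refine (hQ.integrable_of_le_exp (u := y) (v := e)
    (c := S * (f₂ * (a * ((1 + |ρ|) * S)))) (by fun_prop) (by positivity) hy hev ?_).1
  filter_upwards [hQ.regular] with x hx
  have hwexp : |w x| ≤ S * Real.exp (σ / 2 * (x ⬝ᵥ e) ^ 2) := by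
    refine (hwj x).trans ?_
    rw [he, ← dotProduct_single_one_right x j]
    exact abs_le_mul_exp (by positivity) _
  rw [abs_mul]
  refine mul_le_exp_add_exp (by positivity) (by positivity) (by positivity) hwexp ?_
  rw [abs_mul, abs_mul, abs_of_nonneg (hQ.nonneg x 0), abs_of_pos ha, mul_assoc, mul_assoc,
    mul_assoc]
  have h1 : |x ⬝ᵥ y + ρ| ≤ (1 + |ρ|) * (S * Real.exp (σ / 2 * (x ⬝ᵥ y) ^ 2)) := by
    have h2 := abs_le_mul_exp (show 0 < σ / 2 by positivity) (x ⬝ᵥ y)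
    rw [← hS] at h2
    have h3 : 1 ≤ Real.exp (σ / 2 * (x ⬝ᵥ y) ^ 2) := Real.one_le_exp (by positivity)
    have h4 : |ρ| ≤ |ρ| * (S * Real.exp (σ / 2 * (x ⬝ᵥ y) ^ 2)) :=
      le_mul_of_one_le_right (abs_nonneg _) (by nlinarith)
    refine (abs_add_le _ _).trans ?_
    linarith
  gcongr
  exact hx.1

lemma l2norm_le_l1norm (v : Fin d → ℝ) : l2norm v ≤ l1norm v := by
  refine Real.sqrt_le_iff.2 ⟨l1norm_nonneg _, ?_⟩
  unfold l1norm
  calc ∑ j, v j ^ 2 = ∑ j, |v j| ^ 2 := by simp only [sq_abs]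
    _ ≤ _ := Finset.sum_sq_le_sq_sum_of_nonneg fun _ _ => abs_nonneg _

/-- Linear functionals of the covariate weighted by the density at zero depend on the direction in
a Lipschitz way. -/
lemma IsErrorLaw.abs_integral_linear_sub_le (hQ : IsErrorLaw Q μ f f₂ l₀ σ G) (j : Fin d)
    {w : (Fin d → ℝ) → ℝ} (hw : Measurable w) (hwj : ∀ x, |w x| ≤ |x j|) {u u' : Fin d → ℝ}
    (hu : l2norm u ≤ 2) (hu' : l2norm u' ≤ 2) {a ρ r : ℝ} (ha : 0 < a) (hr : 0 < r) (hρ : |ρ| ≤ r)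
    (hd : l1norm (u - u') ≤ r) :
    |∫ x, w x * (f x 0 * (a * (x ⬝ᵥ u' + ρ))) ∂μ - ∫ x, w x * (f x 0 * (a * (x ⬝ᵥ u))) ∂μ| ≤
      4 * G * ((1 + 1 / (σ / 2)) * (f₂ * (1 + 1 / (σ / 2)))) * (a * r) := by
  have hprob := hQ.prob
  have hσ := hQ.σ_pos
  have hf₂ := hQ.f₂_nonneg
  have hG := hQ.one_le_G
  have hf0 := hQ.measurable_apply_zero
  set S := 1 + 1 / (σ / 2) with hS
  have hS1 : 1 ≤ S := by rw [hS]; linarith [show 0 ≤ 1 / (σ / 2) by positivity]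
  set e : Fin d → ℝ := Pi.single j 1 with he
  have hev : l2norm e ≤ 2 := by rw [he, l2norm_single_one]; norm_num
  have hwexp : ∀ x : Fin d → ℝ, |w x| ≤ S * Real.exp (σ / 2 * (x ⬝ᵥ e) ^ 2) := fun x => by
    refine (hwj x).trans ?_
    rw [he, ← dotProduct_single_one_right x j]
    exact abs_le_mul_exp (by positivity) _
  have hz : l2norm (r⁻¹ • (u - u')) ≤ 2 := by
    have h1 := l2norm_le_l1norm (u - u')
    rw [l2norm_smul, abs_of_pos (inv_pos.2 hr), inv_mul_le_iff₀ hr]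
    linarith
  have e0 : ∫ x, w x * (f x 0 * (a * (x ⬝ᵥ u))) ∂μ =
      ∫ x, w x * (f x 0 * (a * (x ⬝ᵥ u + 0))) ∂μ := by simp only [add_zero]
  rw [e0, ← integral_sub (hQ.integrable_mul_linear j hw hwj hu' ha ρ)
    (hQ.integrable_mul_linear j hw hwj hu ha 0)]
  have hfin := (hQ.integrable_of_le_exp
    (H := fun x => w x * (f x 0 * (a * (x ⬝ᵥ u' + ρ))) - w x * (f x 0 * (a * (x ⬝ᵥ u + 0))))
    (u := r⁻¹ • (u - u')) (v := e) (c := S * (f₂ * (a * (2 * r * S)))) (by fun_prop)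
    (by positivity) hz hev ?_).2.1
  · refine hfin.trans (le_of_eq ?_)
    ring
  · filter_upwards [hQ.regular] with x hx
    rw [← mul_sub, abs_mul]
    refine mul_le_exp_add_exp (by positivity) (by positivity) (by positivity) (hwexp x) ?_
    rw [← mul_sub, ← mul_sub, abs_mul, abs_mul, abs_of_nonneg (hQ.nonneg x 0), abs_of_pos ha,
      mul_assoc, mul_assoc, mul_assoc]
    have h1 : |x ⬝ᵥ u' + ρ - (x ⬝ᵥ u + 0)| ≤
        2 * r * (S * Real.exp (σ / 2 * (x ⬝ᵥ (r⁻¹ • (u - u'))) ^ 2)) := by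
      set z := x ⬝ᵥ (r⁻¹ • (u - u')) with hzdef
      have h2 := abs_le_mul_exp (show 0 < σ / 2 by positivity) z
      rw [← hS] at h2
      have h3 : 1 ≤ Real.exp (σ / 2 * z ^ 2) := Real.one_le_exp (by positivity)
      have h4 : x ⬝ᵥ u' + ρ - (x ⬝ᵥ u + 0) = ρ - r * z := by
        rw [hzdef, dotProduct_smul, smul_eq_mul, mul_inv_cancel_left₀ hr.ne', dotProduct_sub]
        ring
      rw [h4]
      refine (abs_sub _ _).trans ?_
      rw [abs_mul, abs_of_pos hr]
      nlinarith [mul_le_mul_of_nonneg_left h2 hr.le, mul_le_mul_of_nonneg_left h3 hr.le,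
        mul_le_mul_of_nonneg_right hS1 (Real.exp_pos (σ / 2 * z ^ 2)).le]
    have h5 := mul_le_mul hx.1 (mul_le_mul_of_nonneg_left h1 ha.le) (by positivity) hf₂
    linarith

end Moments

/-! ### Second-moment matrices and their spectra -/

section Forms

variable {d : ℕ} {μ : Measure (Fin d → ℝ)} {g : (Fin d → ℝ) → ℝ}

lemma dotProduct_weightedMoment_mulVec
    (hint : ∀ i j : Fin d, Integrable (fun x : Fin d → ℝ => g x * (x i * x j)) μ)
    (v u : Fin d → ℝ) :
    v ⬝ᵥ (Matrix.of fun i j : Fin d => ∫ x, g x * (x i * x j) ∂μ) *ᵥ u =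
      ∫ x, g x * ((x ⬝ᵥ v) * (x ⬝ᵥ u)) ∂μ := by
  have e : ∀ x : Fin d → ℝ, g x * ((x ⬝ᵥ v) * (x ⬝ᵥ u)) =
      ∑ i, ∑ j, v i * u j * (g x * (x i * x j)) := fun x => by
    simp only [dotProduct]
    rw [Finset.sum_mul_sum, Finset.mul_sum]
    refine Finset.sum_congr rfl fun i _ => ?_
    rw [Finset.mul_sum]
    exact Finset.sum_congr rfl fun j _ => by ring
  simp only [e]
  rw [integral_finsetSum _ fun i _ => integrable_finsetSum _ fun j _ => (hint i j).const_mul _]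
  simp only [dotProduct, mulVec, Matrix.of_apply]
  refine Finset.sum_congr rfl fun i _ => ?_
  rw [integral_finsetSum _ fun j _ => (hint i j).const_mul _, Finset.mul_sum]
  refine Finset.sum_congr rfl fun j _ => ?_
  rw [integral_const_mul]
  ring

lemma isSymm_weightedMoment : (Matrix.of fun i j : Fin d => ∫ x, g x * (x i * x j) ∂μ).IsSymm := by
  ext i j
  simp only [transpose_apply, of_apply, mul_comm (_ : ℝ) (_ : ℝ)]

lemma quadratic_bounds_of_spectrum {A : Matrix (Fin d) (Fin d) ℝ} (hA : A.IsSymm) {lo hi : ℝ}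
    (h : ∀ t ∈ spectrum ℝ A, lo ≤ t ∧ t ≤ hi) (v : Fin d → ℝ) :
    lo * l2norm v ^ 2 ≤ v ⬝ᵥ A *ᵥ v ∧ v ⬝ᵥ A *ᵥ v ≤ hi * l2norm v ^ 2 := by
  have hAh : A.IsHermitian := by
    rw [Matrix.IsHermitian, conjTranspose_eq_transpose_of_trivial]; exact hA
  have hsc : ∀ r : ℝ, (algebraMap ℝ (Matrix (Fin d) (Fin d) ℝ) r).IsHermitian := fun r => by
    rw [Matrix.IsHermitian, conjTranspose_eq_transpose_of_trivial, algebraMap_eq_diagonal,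
      diagonal_transpose]
  have hform : ∀ r : ℝ, v ⬝ᵥ (algebraMap ℝ (Matrix (Fin d) (Fin d) ℝ) r) *ᵥ v =
      r * l2norm v ^ 2 := fun r => by
    rw [Algebra.algebraMap_eq_smul_one, smul_mulVec, one_mulVec, dotProduct_smul,
      dotProduct_self_eq_l2norm_sq, smul_eq_mul]
  have h1 : (A - algebraMap ℝ _ lo).PosSemidef := by
    refine Matrix.posSemidef_iff_isHermitian_and_spectrum_nonneg.2 ⟨hAh.sub (hsc lo), ?_⟩
    rw [← spectrum.sub_singleton_eq]
    rintro _ ⟨t, ht, s, rfl, rfl⟩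
    exact sub_nonneg.2 (h t ht).1
  have h2 : (algebraMap ℝ _ hi - A).PosSemidef := by
    refine Matrix.posSemidef_iff_isHermitian_and_spectrum_nonneg.2 ⟨(hsc hi).sub hAh, ?_⟩
    rw [← spectrum.singleton_sub_eq]
    rintro _ ⟨s, rfl, t, ht, rfl⟩
    exact sub_nonneg.2 (h t ht).2
  have h3 := h1.dotProduct_mulVec_nonneg v
  have h4 := h2.dotProduct_mulVec_nonneg v
  simp only [star_trivial, sub_mulVec, dotProduct_sub, hform] at h3 h4
  constructor <;> linarith

open scoped MatrixOrder in
/-- The whitening transformation: every direction is `Σ^{-1/2}` applied to a vector whose squared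
length is the quadratic form of `Σ`. -/
lemma exists_inv_sqrt_mulVec_eq {A : Matrix (Fin d) (Fin d) ℝ} (hA : A.IsSymm) {lo : ℝ}
    (hlo : 0 < lo) (h : ∀ v, lo * l2norm v ^ 2 ≤ v ⬝ᵥ A *ᵥ v) (v : Fin d → ℝ) :
    ∃ y, (CFC.sqrt A)⁻¹ *ᵥ y = v ∧ l2norm y ^ 2 = v ⬝ᵥ A *ᵥ v := by
  have hAh : A.IsHermitian := by
    rw [Matrix.IsHermitian, conjTranspose_eq_transpose_of_trivial]; exact hA
  have hpsd : A.PosSemidef := .of_dotProduct_mulVec_nonneg hAh fun x => by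
    rw [star_trivial]
    exact le_trans (by positivity) (h x)
  have hpd : A.PosDef := .of_dotProduct_mulVec_pos hAh fun x hx => by
    rw [star_trivial]
    refine lt_of_lt_of_le (mul_pos hlo ?_) (h x)
    rw [← dotProduct_self_eq_l2norm_sq]
    have h1 := dotProduct_star_self_pos_iff.2 hx
    simpa using h1
  have hsq : CFC.sqrt A * CFC.sqrt A = A :=
    CFC.sqrt_mul_sqrt_self A (Matrix.nonneg_iff_posSemidef.2 hpsd)
  have hsym : (CFC.sqrt A).IsHermitian :=
    (Matrix.nonneg_iff_posSemidef.1 (CFC.sqrt_nonneg A)).isHermitian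
  have hdet : IsUnit (CFC.sqrt A).det := by
    have h1 : (CFC.sqrt A).det * (CFC.sqrt A).det = A.det := by rw [← det_mul, hsq]
    rw [isUnit_iff_ne_zero]
    intro h0
    rw [h0, mul_zero] at h1
    exact hpd.det_pos.ne h1
  refine ⟨CFC.sqrt A *ᵥ v, ?_, ?_⟩
  · rw [mulVec_mulVec, nonsing_inv_mul _ hdet, one_mulVec]
  · rw [← dotProduct_self_eq_l2norm_sq, dotProduct_mulVec, ← mulVec_transpose,
      ← conjTranspose_eq_transpose_of_trivial, hsym.eq, mulVec_mulVec, hsq, dotProduct_comm]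

end Forms

/-! ### The quantile model as an error law -/

section Model

variable {p : ℕ} {τ : ℝ} {ν : Measure ((Fin (p + 1) → ℝ) × ℝ)} {β : Fin (p + 1) → ℝ}
  {f : (Fin (p + 1) → ℝ) → ℝ → ℝ}

/-- The map `(x, y) ↦ (x, y - xᵀβ)` to covariate and error. -/
def toError (β : Fin (p + 1) → ℝ) (z : (Fin (p + 1) → ℝ) × ℝ) : (Fin (p + 1) → ℝ) × ℝ :=
  (z.1, z.2 - z.1 ⬝ᵥ β)

lemma measurable_toError (β : Fin (p + 1) → ℝ) : Measurable (toError β) := by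
  unfold toError
  have h2 : Measurable fun z : (Fin (p + 1) → ℝ) × ℝ => z.1 ⬝ᵥ β :=
    (measurable_dotProduct_right β).comp measurable_fst
  fun_prop

/-- A Lipschitz density puts mass exactly `τ` below its `τ`-quantile. -/
lemma setIntegral_Iic_eq_of_isLeast {g : ℝ → ℝ} {l q : ℝ} (hg0 : ∀ u, 0 ≤ g u)
    (hg : ∀ u v, |g u - g v| ≤ l * |u - v|) (hl : 0 ≤ l) (hτ : 0 < τ)
    (h : IsLeast {y : ℝ | τ ≤ ∫ u in Set.Iic (y - q), g u} q) :
    ∫ u in Set.Iic 0, g u = τ := by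
  have h1 : τ ≤ ∫ u in Set.Iic (q - q), g u := h.1
  rw [sub_self] at h1
  refine le_antisymm ?_ h1
  have hint : IntegrableOn g (Set.Iic 0) := by
    by_contra hcon
    rw [integral_undef hcon] at h1
    linarith
  -- mass above `τ` would leave room to move the quantile to the left, by continuity of the mass
  by_contra! hcon
  set A := ∫ u in Set.Iic 0, g u with hA
  set δ := min 1 ((A - τ) / (g 0 + l + 1)) with hδ
  have hden : 0 < g 0 + l + 1 := by linarith [hg0 0]
  have hδ0 : 0 < δ := lt_min one_pos (div_pos (by linarith) hden)
  have hint' : IntegrableOn g (Set.Iic (-δ)) := hint.mono_set (Set.Iic_subset_Iic.2 (by linarith))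
  have h2 := intervalIntegral.integral_Iic_sub_Iic hint' hint
  have h3 := intervalIntegral.norm_integral_le_of_norm_le_const (a := -δ) (b := 0)
    (f := g) (C := g 0 + l) fun u hu => by
      rw [Set.uIoc_of_le (by linarith)] at hu
      rw [Real.norm_eq_abs, abs_of_nonneg (hg0 u)]
      have h4 := (abs_le.1 (hg u 0)).2
      have h5 : |u - 0| ≤ 1 := by
        rw [sub_zero, abs_of_nonpos hu.2]
        linarith [hu.1, min_le_left 1 ((A - τ) / (g 0 + l + 1))]
      nlinarith
  rw [← h2, sub_neg_eq_add, zero_add, abs_of_pos hδ0, Real.norm_eq_abs] at h3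
  have h4 : (g 0 + l) * δ ≤ A - τ := by
    have h5 : δ * (g 0 + l + 1) ≤ A - τ := by
      rw [← le_div_iff₀ hden]; exact min_le_right _ _
    nlinarith
  have h5 : q ≤ q - δ := h.2 (show τ ≤ ∫ u in Set.Iic (q - δ - q), g u by
    rw [show q - δ - q = -δ by ring]
    linarith [(abs_le.1 h3).2])
  linarith

/-- The assumptions on the population in the form in which they are used. The constant in the
Gaussian-square moment: `v = Σ^{-1/2} y` with `|y|₂² = vᵀΣv ≤ 4 lamHi / f₁` when `|v|₂ ≤ 2`, so that
`Xᵀv / (c₁ |y|₂)` has standard Gaussian tails, and its square divided by four has bounded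
exponential moment. -/
lemma IsLinearQuantileModel.isErrorLaw_and_hessian (hmodel : IsLinearQuantileModel τ ν β f)
    (hτ : 0 < τ) {f₁ f₂ l₀ c₁ lamLo lamHi : ℝ} (hf₁ : 0 < f₁) (hf₁₂ : f₁ ≤ f₂)
    (hdens : CondDensityRegular ν f f₁ f₂ l₀) (hc₁ : 0 < c₁) (hsub : SubGaussianCovariates ν c₁)
    (hlo : 0 < lamLo) (hhi : 0 < lamHi) (heig : EigenvaluesIn (populationHessian ν f) lamLo lamHi)
    {G : ℝ} (hG : 1 ≤ G) (hGprop : ∀ {α : Type} [MeasurableSpace α] (μ : Measure α)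
      [IsProbabilityMeasure μ] (Z : α → ℝ), Measurable Z →
      (∀ t : ℝ, 0 < t → μ.real {x | t ≤ |Z x|} ≤ 2 * Real.exp (-t ^ 2 / 2)) →
      ∫⁻ x, ENNReal.ofReal (Real.exp (Z x ^ 2 / 4)) ∂μ ≤ ENNReal.ofReal G) :
    IsErrorLaw (ν.map (toError β)) ν.fst f f₂ (max l₀ 0) (f₁ / (16 * c₁ ^ 2 * lamHi)) G ∧
      (∀ᵐ x ∂ν.fst, ∫ u in Set.Iic 0, f x u = τ) ∧
      (populationHessian ν f).IsSymm ∧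
      (∀ v, lamLo * l2norm v ^ 2 ≤ v ⬝ᵥ populationHessian ν f *ᵥ v ∧
        v ⬝ᵥ populationHessian ν f *ᵥ v ≤ lamHi * l2norm v ^ 2) ∧
      (∀ v u, v ⬝ᵥ populationHessian ν f *ᵥ u = ∫ x, f x 0 * ((x ⬝ᵥ v) * (x ⬝ᵥ u)) ∂ν.fst) := by
  have hνp := hmodel.isProbabilityMeasure
  have hprob : IsProbabilityMeasure ν.fst := inferInstance
  have hreg : ∀ᵐ x ∂ν.fst, f x 0 ≤ f₂ ∧ ∀ u v, |f x u - f x v| ≤ max l₀ 0 * |u - v| := by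
    filter_upwards [hdens] with x hx
    exact ⟨hx.2.1, fun u v => (hx.2.2 u v).trans
      (mul_le_mul_of_nonneg_right (le_max_left _ _) (abs_nonneg _))⟩
  have hf0 : Measurable fun x => f x 0 :=
    hmodel.density.measurable.comp (measurable_id.prodMk measurable_const)
  have hxx : ∀ i j, Integrable (fun x : Fin (p + 1) → ℝ => x i * x j) ν.fst := fun i j =>
    (hmodel.memLp i).integrable_mul (hmodel.memLp j)
  have hint : ∀ i j, Integrable (fun x : Fin (p + 1) → ℝ => f x 0 * (x i * x j)) ν.fst :=
    fun i j => (hxx i j).bdd_mul (c := f₂) hf0.aestronglyMeasurable (by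
      filter_upwards [hreg] with x hx
      rw [Real.norm_eq_abs, abs_of_nonneg (hmodel.density.nonneg x 0)]
      exact hx.1)
  have hform : ∀ v u, v ⬝ᵥ populationHessian ν f *ᵥ u =
      ∫ x, f x 0 * ((x ⬝ᵥ v) * (x ⬝ᵥ u)) ∂ν.fst := dotProduct_weightedMoment_mulVec hint
  have hsymm : (populationHessian ν f).IsSymm := isSymm_weightedMoment
  have hquad := quadratic_bounds_of_spectrum hsymm heig
  have hint1 : ∀ i j, Integrable (fun x : Fin (p + 1) → ℝ => 1 * (x i * x j)) ν.fst := by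
    simpa only [one_mul] using hxx
  have hmom : secondMoment ν = Matrix.of fun i j => ∫ x, 1 * (x i * x j) ∂ν.fst := by
    simp only [one_mul]; rfl
  have hmomform : ∀ v, v ⬝ᵥ secondMoment ν *ᵥ v = ∫ x, (x ⬝ᵥ v) ^ 2 ∂ν.fst := fun v => by
    rw [hmom, dotProduct_weightedMoment_mulVec hint1]
    simp only [one_mul, sq]
  have hmomsymm : (secondMoment ν).IsSymm := by rw [hmom]; exact isSymm_weightedMoment
  have hsqi : ∀ v : Fin (p + 1) → ℝ, Integrable (fun x : Fin (p + 1) → ℝ => (x ⬝ᵥ v) ^ 2) ν.fst := by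
    intro v
    have : MemLp (fun x : Fin (p + 1) → ℝ => x ⬝ᵥ v) 2 ν.fst := by
      simp only [dotProduct]
      exact memLp_finsetSum _ fun j _ => (hmodel.memLp j).mul_const (v j)
    exact this.integrable_sq
  have hfsqi : ∀ v : Fin (p + 1) → ℝ,
      Integrable (fun x : Fin (p + 1) → ℝ => f x 0 * ((x ⬝ᵥ v) * (x ⬝ᵥ v))) ν.fst := fun v => by
    refine ((hsqi v).bdd_mul (c := f₂) hf0.aestronglyMeasurable (by
      filter_upwards [hreg] with x hx
      rw [Real.norm_eq_abs, abs_of_nonneg (hmodel.density.nonneg x 0)]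
      exact hx.1)).congr (ae_of_all _ fun x => ?_)
    simp only [sq]
  have hup : ∀ v, f₁ * (v ⬝ᵥ secondMoment ν *ᵥ v) ≤ v ⬝ᵥ populationHessian ν f *ᵥ v := fun v => by
    rw [hform, hmomform, ← integral_const_mul]
    refine integral_mono_ae ((hsqi v).const_mul _) (hfsqi v) ?_
    filter_upwards [hdens] with x hx
    simp only [sq]
    exact mul_le_mul_of_nonneg_right hx.1 (mul_self_nonneg _)
  have hdown : ∀ v, v ⬝ᵥ populationHessian ν f *ᵥ v ≤ f₂ * (v ⬝ᵥ secondMoment ν *ᵥ v) := fun v => by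
    rw [hform, hmomform, ← integral_const_mul]
    refine integral_mono_ae (hfsqi v) ((hsqi v).const_mul _) ?_
    filter_upwards [hdens] with x hx
    simp only [sq]
    exact mul_le_mul_of_nonneg_right hx.2.1 (mul_self_nonneg _)
  have hf₂ : 0 < f₂ := hf₁.trans_le hf₁₂
  have hmomlo : ∀ v, lamLo / f₂ * l2norm v ^ 2 ≤ v ⬝ᵥ secondMoment ν *ᵥ v := fun v => by
    rw [div_mul_eq_mul_div, div_le_iff₀ hf₂, mul_comm _ f₂]
    exact (hquad v).1.trans (hdown v)
  refine ⟨⟨hprob, hmodel.density.measurable, hmodel.density.nonneg, hmodel.density.law_eq, ?_, hreg,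
    hf₂.le, le_max_right _ _, by positivity, hG, ?_⟩, ?_, hsymm, hquad, hform⟩
  · rw [Measure.map_map measurable_fst (measurable_toError β)]
    rfl
  · intro v hv
    obtain ⟨y, hy, hy2⟩ := exists_inv_sqrt_mulVec_eq hmomsymm (div_pos hlo hf₂) hmomlo v
    have hyle : l2norm y ^ 2 ≤ 4 * lamHi / f₁ := by
      rw [hy2, le_div_iff₀ hf₁, mul_comm]
      refine (hup v).trans ((hquad v).2.trans ?_)
      have : l2norm v ^ 2 ≤ 2 ^ 2 := by
        gcongr
        exact l2norm_nonneg v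
      nlinarith
    -- `y = 0` forces `v = 0`, because the quadratic form of `Σ` is positive definite
    rcases (l2norm_nonneg y).eq_or_lt with h0 | hpos
    · have hv0 : l2norm v = 0 := by
        have h1 := hmomlo v
        rw [← hy2, ← h0] at h1
        have h2 : 0 < lamLo / f₂ := div_pos hlo hf₂
        have h3 : l2norm v ^ 2 = 0 := le_antisymm (by nlinarith) (sq_nonneg _)
        exact pow_eq_zero_iff (two_ne_zero) |>.1 h3
      have hvz : v = 0 := by
        funext j
        have := abs_apply_le_l2norm v j
        rw [hv0] at this
        simpa using this
      subst hvz
      simpa using hG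
    · refine le_trans ?_ (hGprop ν.fst (fun x => (x ⬝ᵥ v) / (c₁ * l2norm y)) (by fun_prop) ?_)
      · gcongr with x
        rw [div_pow, div_div, mul_comm, ← mul_div_assoc, div_le_div_iff₀ (by positivity)
          (by positivity), mul_pow]
        rw [le_div_iff₀ hf₁] at hyle
        have := mul_le_mul_of_nonneg_left hyle
          (show 0 ≤ (x ⬝ᵥ v) ^ 2 * (4 * c₁ ^ 2) by positivity)
        linarith
      · intro t ht
        have h1 := hsub ((l2norm y)⁻¹ • y) (by
          rw [l2norm_smul, abs_of_pos (inv_pos.2 hpos), inv_mul_cancel₀ hpos.ne']) t ht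
        rw [mulVec_smul, hy] at h1
        refine le_trans (le_of_eq ?_) h1
        congr 1
        ext x
        simp only [Set.mem_ofPred_eq]
        rw [dotProduct_smul, smul_eq_mul, abs_mul, abs_of_pos (inv_pos.2 hpos), abs_div,
          abs_of_pos (mul_pos hc₁ hpos), le_div_iff₀ (mul_pos hc₁ hpos), inv_mul_eq_div,
          le_div_iff₀ hpos]
        rw [← mul_assoc, mul_comm t c₁]
  · filter_upwards [hreg, hmodel.quantile] with x hx hqx
    exact setIntegral_Iic_eq_of_isLeast (hmodel.density.nonneg x) hx.2 (le_max_right _ _) hτ hqx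

/-- Covariates and errors of an i.i.d. sample follow the product of the error laws. -/
lemma IsIIDSample.hasLaw_pi {Ω : Type*} [MeasurableSpace Ω] {P : Measure Ω} {N : ℕ}
    {X : Fin N → Ω → Fin (p + 1) → ℝ} {Y : Fin N → Ω → ℝ} (h : IsIIDSample P ν X Y)
    (β : Fin (p + 1) → ℝ) :
    HasLaw (fun ω i => toError β (X i ω, Y i ω)) (Measure.pi fun _ => ν.map (toError β)) P := by
  refine iIndepFun.hasLaw_pi (fun i => ?_) (h.indep.comp _ fun _ => measurable_toError β)
  exact HasLaw.comp ⟨(measurable_toError β).aemeasurable, rfl⟩ (h.hasLaw i)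

end Model

/-! ### Uniform deviations over sparse directions -/

section Uniform

variable {ι : Type*}

/-- The average of `φ` over the observations with index in `J`. -/
noncomputable def sampleMean {S : Type*} (J : Finset ι) (φ : S → ℝ) (W : ι → S) : ℝ :=
  1 / (J.card : ℝ) * ∑ i ∈ J, φ (W i)

lemma sampleMean_mono {S : Type*} {J : Finset ι} {φ ψ : S → ℝ} {W : ι → S}
    (h : ∀ i ∈ J, φ (W i) ≤ ψ (W i)) : sampleMean J φ W ≤ sampleMean J ψ W :=
  mul_le_mul_of_nonneg_left (Finset.sum_le_sum h) (by positivity)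

lemma sampleMean_sub {S : Type*} (J : Finset ι) (φ ψ : S → ℝ) (W : ι → S) :
    sampleMean J (fun z => φ z - ψ z) W = sampleMean J φ W - sampleMean J ψ W := by
  simp only [sampleMean, Finset.sum_sub_distrib, mul_sub]

lemma sampleMean_add {S : Type*} (J : Finset ι) (φ ψ : S → ℝ) (W : ι → S) :
    sampleMean J (fun z => φ z + ψ z) W = sampleMean J φ W + sampleMean J ψ W := by
  simp only [sampleMean, Finset.sum_add_distrib, mul_add]

lemma abs_sampleMean_sub_le {S : Type*} {J : Finset ι} (hJ : J.Nonempty) {φ ψ : S → ℝ} {W : ι → S}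
    {c : ℝ} (h : ∀ i ∈ J, |φ (W i) - ψ (W i)| ≤ c) :
    |sampleMean J φ W - sampleMean J ψ W| ≤ c := by
  have hJ0 : (0 : ℝ) < J.card := by exact_mod_cast hJ.card_pos
  rw [← sampleMean_sub, sampleMean, abs_mul, abs_of_nonneg (by positivity), one_div,
    inv_mul_le_iff₀ hJ0]
  calc |∑ i ∈ J, (φ (W i) - ψ (W i))| ≤ ∑ i ∈ J, |φ (W i) - ψ (W i)| :=
        Finset.abs_sum_le_sum_abs _ _
    _ ≤ ∑ _i ∈ J, c := Finset.sum_le_sum h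
    _ = J.card * c := by rw [Finset.sum_const, nsmul_eq_mul]

lemma measure_exists_mem_le {S T : Type*} [MeasurableSpace S] (μ : Measure S) (F : Finset T)
    {p : T → S → Prop} {c : ℝ≥0∞} (h : ∀ u ∈ F, μ {W | p u W} ≤ c) :
    μ {W | ∃ u ∈ F, p u W} ≤ F.card * c := by
  have e : {W | ∃ u ∈ F, p u W} = ⋃ u ∈ F, {W | p u W} := by
    ext W; simp
  rw [e]
  refine (measure_biUnion_finset_le _ _).trans ((Finset.sum_le_sum h).trans ?_)
  rw [Finset.sum_const, nsmul_eq_mul]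

lemma abs_dotProduct_le_of_abs_le {d : ℕ} {x : Fin d → ℝ} {R : ℝ} (hx : ∀ j, |x j| ≤ R)
    (v : Fin d → ℝ) : |x ⬝ᵥ v| ≤ R * l1norm v := by
  rw [dotProduct_comm]
  exact abs_dotProduct_le_mul_l1norm v x R hx

lemma IsSparse.l1norm_le {d k : ℕ} {v : Fin d → ℝ} (hv : IsSparse k v) (h1 : l2norm v ≤ 1) :
    l1norm v ≤ k := by
  obtain ⟨A, hA, hv⟩ := hv
  have habs : ∀ j, |v j| ≤ 1 := fun j => (abs_apply_le_l2norm v j).trans h1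
  calc l1norm v = ∑ j ∈ A, |v j| := by
        unfold l1norm
        refine (Finset.sum_subset (Finset.subset_univ A) fun j _ hj => ?_).symm
        simp [hv j hj]
    _ ≤ ∑ _j ∈ A, (1 : ℝ) := Finset.sum_le_sum fun j _ => habs j
    _ = A.card := by simp
    _ ≤ k := by exact_mod_cast hA

variable {d : ℕ} {Q : Measure ((Fin d → ℝ) × ℝ)} {μ : Measure (Fin d → ℝ)}
  {f : (Fin d → ℝ) → ℝ → ℝ} {f₂ l₀ σ G : ℝ}

lemma quadratic_sub_le_of_le {A : Matrix (Fin d) (Fin d) ℝ} (hA : A.IsSymm) {hi : ℝ}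
    (hA0 : ∀ v, 0 ≤ v ⬝ᵥ A *ᵥ v) (hA1 : ∀ v, v ⬝ᵥ A *ᵥ v ≤ hi * l2norm v ^ 2) (hhi : 0 ≤ hi)
    {v v' : Fin d → ℝ} {r : ℝ} (hr : 0 < r) (hr1 : r ≤ 1) (hv' : l2norm v' ≤ 2)
    (hd : l1norm (v - v') ≤ r) :
    |v ⬝ᵥ A *ᵥ v - v' ⬝ᵥ A *ᵥ v'| ≤ 6 * hi * r := by
  set e := v - v' with he
  have hs : e ⬝ᵥ A *ᵥ v' = v' ⬝ᵥ A *ᵥ e := by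
    rw [dotProduct_mulVec, ← mulVec_transpose, hA.eq, dotProduct_comm]
  have h1 : v ⬝ᵥ A *ᵥ v - v' ⬝ᵥ A *ᵥ v' = 2 * (v' ⬝ᵥ A *ᵥ e) + e ⬝ᵥ A *ᵥ e := by
    have : v = v' + e := by rw [he]; abel
    rw [this]
    simp only [mulVec_add, dotProduct_add, add_dotProduct, hs]
    ring
  have hQe : e ⬝ᵥ A *ᵥ e ≤ hi * r ^ 2 := by
    refine (hA1 e).trans (mul_le_mul_of_nonneg_left ?_ hhi)
    have := (l2norm_le_l1norm e).trans hd
    have h0 := l2norm_nonneg e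
    gcongr
  have hQv : v' ⬝ᵥ A *ᵥ v' ≤ hi * 4 := by
    refine (hA1 v').trans (mul_le_mul_of_nonneg_left ?_ hhi)
    have h0 := l2norm_nonneg v'
    nlinarith
  have hp := hA0 (r • v' + e)
  have hm := hA0 (r • v' - e)
  simp only [mulVec_add, dotProduct_add, add_dotProduct, mulVec_sub, dotProduct_sub,
    sub_dotProduct, mulVec_smul, dotProduct_smul, smul_dotProduct, smul_eq_mul, hs] at hp hm
  have hQe0 := hA0 e
  have hQv0 := hA0 v'
  rw [h1, abs_le]
  have h2 : r * (2 * (v' ⬝ᵥ A *ᵥ e)) ≤ r * (5 * hi * r) := by nlinarith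
  have h3 : -(r * (5 * hi * r)) ≤ r * (2 * (v' ⬝ᵥ A *ᵥ e)) := by nlinarith
  have h4 := le_of_mul_le_mul_left h2 hr
  have h5 : -(5 * hi * r) ≤ 2 * (v' ⬝ᵥ A *ᵥ e) := by
    refine le_of_mul_le_mul_left ?_ hr
    linarith
  have h6 : hi * r ^ 2 ≤ hi * r := mul_le_mul_of_nonneg_left (by nlinarith) hhi
  constructor <;> nlinarith [mul_nonneg hhi hr.le]

lemma exists_scaledKernel_bounds {K : ℝ → ℝ} (hK : IsSmoothingKernel K) :
    ∃ B > 0, ∀ b, 0 < b → b ≤ 1 → (∀ s, scaledKernel K b s ≤ B / b ^ 2) ∧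
      ∀ s s', |scaledKernel K b s - scaledKernel K b s'| ≤ B / b ^ 2 * |s - s'| := by
  obtain ⟨B₀, hB₀⟩ := hK.bounded
  obtain ⟨B₁, hB₁⟩ := hK.deriv_bounded
  have hB₁0 : 0 ≤ B₁ := (abs_nonneg _).trans (hB₁ 0)
  refine ⟨max B₀ (max B₁ 1), lt_max_of_lt_right (lt_max_of_lt_right one_pos),
    fun b hb hb1 => ⟨fun s => ?_, fun s s' => ?_⟩⟩
  · have hB : K (s / b) ≤ max B₀ (max B₁ 1) := (hB₀ _).trans (le_max_left _ _)
    have h0 : 0 ≤ max B₀ (max B₁ 1) := (hK.nonneg _).trans hB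
    unfold scaledKernel
    calc K (s / b) / b ≤ max B₀ (max B₁ 1) / b := by gcongr
      _ ≤ max B₀ (max B₁ 1) / b ^ 2 := by
        gcongr
        nlinarith
  · have hlip : |K (s / b) - K (s' / b)| ≤ B₁ * |s / b - s' / b| := by
      have := Convex.norm_image_sub_le_of_norm_deriv_le (𝕜 := ℝ) (f := K) (s := Set.univ)
        (x := s' / b) (y := s / b) (C := B₁) (fun x _ => hK.differentiable x)
        (fun x _ => by rw [Real.norm_eq_abs]; exact hB₁ x) convex_univ
        (Set.mem_univ _) (Set.mem_univ _)
      simpa only [Real.norm_eq_abs] using this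
    unfold scaledKernel
    rw [← sub_div, abs_div, abs_of_pos hb]
    calc |K (s / b) - K (s' / b)| / b ≤ B₁ * |s / b - s' / b| / b := by gcongr
      _ = B₁ / b ^ 2 * |s - s'| := by
        rw [← sub_div, abs_div, abs_of_pos hb]
        field_simp
      _ ≤ _ := by
        gcongr
        exact (le_max_left _ _).trans (le_max_right _ _)

lemma kernelQuadratic_sub_le {K : ℝ → ℝ} (hK : IsSmoothingKernel K) {B a b : ℝ} (hb : 0 < b)
    (ha : 0 < a) (ha1 : a ≤ 1) (hB0 : 0 < B)
    (hB : ∀ s, scaledKernel K b s ≤ B / b ^ 2)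
    (hL : ∀ s s', |scaledKernel K b s - scaledKernel K b s'| ≤ B / b ^ 2 * |s - s'|)
    {u u' v v' : Fin d → ℝ} {z : (Fin d → ℝ) × ℝ} {δ T : ℝ} (hT1 : 1 ≤ T)
    (hu : |z.1 ⬝ᵥ (u - u')| ≤ δ) (hv : |z.1 ⬝ᵥ (v - v')| ≤ δ) (hvT : |z.1 ⬝ᵥ v| ≤ T)
    (hvT' : |z.1 ⬝ᵥ v'| ≤ T) :
    |kernelQuadratic K a b u v z - kernelQuadratic K a b u' v' z| ≤ 3 * B * T ^ 2 * δ / b ^ 2 := by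
  have hδ : 0 ≤ δ := (abs_nonneg _).trans hu
  simp only [kernelQuadratic]
  rw [dotProduct_sub] at hu hv
  set k := scaledKernel K b (z.2 - a * (z.1 ⬝ᵥ u)) with hk
  set k' := scaledKernel K b (z.2 - a * (z.1 ⬝ᵥ u')) with hk'
  have hk0 : 0 ≤ k' := scaledKernel_nonneg hK hb _
  have h1 : |k - k'| ≤ B / b ^ 2 * δ := by
    refine (hL _ _).trans ?_
    gcongr
    have e : z.2 - a * (z.1 ⬝ᵥ u) - (z.2 - a * (z.1 ⬝ᵥ u')) =
      -(a * (z.1 ⬝ᵥ u - z.1 ⬝ᵥ u')) := by ring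
    rw [e, abs_neg, abs_mul, abs_of_pos ha]
    exact (mul_le_of_le_one_left (abs_nonneg _) ha1).trans hu
  have h2 : |(z.1 ⬝ᵥ v) ^ 2 - (z.1 ⬝ᵥ v') ^ 2| ≤ 2 * T * δ := by
    rw [sq_sub_sq, abs_mul]
    have : |z.1 ⬝ᵥ v + z.1 ⬝ᵥ v'| ≤ 2 * T := (abs_add_le _ _).trans (by linarith)
    gcongr
  have e : (z.1 ⬝ᵥ v) ^ 2 * k - (z.1 ⬝ᵥ v') ^ 2 * k' =
      (z.1 ⬝ᵥ v) ^ 2 * (k - k') + ((z.1 ⬝ᵥ v) ^ 2 - (z.1 ⬝ᵥ v') ^ 2) * k' := by ring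
  have h3 : (z.1 ⬝ᵥ v) ^ 2 ≤ T ^ 2 := by
    rw [← sq_abs]
    gcongr
  rw [e]
  refine (abs_add_le _ _).trans ?_
  rw [abs_mul, abs_mul, abs_of_nonneg (sq_nonneg _), abs_of_nonneg hk0]
  calc (z.1 ⬝ᵥ v) ^ 2 * |k - k'| + |(z.1 ⬝ᵥ v) ^ 2 - (z.1 ⬝ᵥ v') ^ 2| * k'
      ≤ T ^ 2 * (B / b ^ 2 * δ) + 2 * T * δ * (B / b ^ 2) := by
        gcongr
        exact hB _
    _ ≤ T ^ 2 * (B / b ^ 2 * δ) + 2 * T ^ 2 * δ * (B / b ^ 2) := by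
        gcongr
        nlinarith
    _ = _ := by ring

/-- Uniform closeness of the local Hessian at the shifts `a u` to the population Hessian: deviations
at the grid, the smoothing bias, and the rounding error. -/
lemma abs_sampleMean_kernelQuadratic_sub_le
    {K : ℝ → ℝ} (hK : IsSmoothingKernel K) {A : Matrix (Fin d) (Fin d) ℝ} (hA : A.IsSymm) {hi : ℝ}
    (hA0 : ∀ v, 0 ≤ v ⬝ᵥ A *ᵥ v) (hA1 : ∀ v, v ⬝ᵥ A *ᵥ v ≤ hi * l2norm v ^ 2) (hhi : 0 ≤ hi)
    (hAint : ∀ v : Fin d → ℝ, v ⬝ᵥ A *ᵥ v = ∫ x, (x ⬝ᵥ v) ^ 2 * f x 0 ∂μ)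
    {B C a b R x : ℝ} {J : Finset ι} (hJ : J.Nonempty) {q k : ℕ} (hk : 0 < k) (hkq : k ≤ q)
    (hb : 0 < b) (ha : 0 < a) (ha1 : a ≤ 1) (hB0 : 0 < B) (hR1 : 1 ≤ R)
    (hB : ∀ s, scaledKernel K b s ≤ B / b ^ 2)
    (hL : ∀ s s', |scaledKernel K b s - scaledKernel K b s'| ≤ B / b ^ 2 * |s - s'|)
    (hmean : ∀ u v : Fin d → ℝ, l2norm u ≤ 2 → l2norm v ≤ 2 →
      |∫ z, kernelQuadratic K a b u v z ∂Q - ∫ x, (x ⬝ᵥ v) ^ 2 * f x 0 ∂μ| ≤ C * (a + b))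
    {W : ι → (Fin d → ℝ) × ℝ} (hWR : ∀ i j, |(W i).1 j| ≤ R)
    (hW : ∀ u ∈ sparseGrid d q k, ∀ v ∈ sparseGrid d q k, l2norm u ≤ 2 → l2norm v ≤ 2 →
      |sampleMean J (kernelQuadratic K a b u v) W - ∫ z, kernelQuadratic K a b u v z ∂Q| ≤ x)
    {u v : Fin d → ℝ} (hu : IsSparse k u) (hu1 : l2norm u ≤ 1) (hv : IsSparse k v) :
    |sampleMean J (kernelQuadratic K a b u v) W - v ⬝ᵥ A *ᵥ v| ≤
      (x + C * (a + b) + (3 * B * (R * (k + 1)) ^ 2 * (R * (k / q)) / b ^ 2 + 6 * hi * (k / q))) *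
        l2norm v ^ 2 := by
  have hq : 0 < q := hk.trans_le hkq
  have hq0 : (0 : ℝ) < q := by exact_mod_cast hq
  have hk0 : (0 : ℝ) < k := by exact_mod_cast hk
  have hkq1 : (k : ℝ) / q ≤ 1 := by rw [div_le_one hq0]; exact_mod_cast hkq
  have main : ∀ v : Fin d → ℝ, IsSparse k v → l2norm v ≤ 1 →
      |sampleMean J (kernelQuadratic K a b u v) W - v ⬝ᵥ A *ᵥ v| ≤
      x + C * (a + b) + (3 * B * (R * (k + 1)) ^ 2 * (R * (k / q)) / b ^ 2 + 6 * hi * (k / q)) := by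
    intro v hv hv1
    obtain ⟨u', hu'G, hu'2, hu'd⟩ := exists_mem_sparseGrid hq hkq hu hu1
    obtain ⟨v', hv'G, hv'2, hv'd⟩ := exists_mem_sparseGrid hq hkq hv hv1
    have h1 := hW u' hu'G v' hv'G hu'2 hv'2
    have h2 := hmean u' v' hu'2 hv'2
    rw [← hAint] at h2
    have h3 := quadratic_sub_le_of_le hA hA0 hA1 hhi (div_pos hk0 hq0) hkq1 hv'2 hv'd
    have h4 : |sampleMean J (kernelQuadratic K a b u v) W -
        sampleMean J (kernelQuadratic K a b u' v') W| ≤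
        3 * B * (R * (k + 1)) ^ 2 * (R * (k / q)) / b ^ 2 := by
      refine abs_sampleMean_sub_le hJ fun i _ => ?_
      have hz : ∀ y : Fin d → ℝ, |(W i).1 ⬝ᵥ y| ≤ R * l1norm y :=
        abs_dotProduct_le_of_abs_le (hWR i)
      have hzv : |(W i).1 ⬝ᵥ v| ≤ R * k :=
        (hz v).trans (mul_le_mul_of_nonneg_left (hv.l1norm_le hv1) (by linarith))
      have hzd : |(W i).1 ⬝ᵥ (v - v')| ≤ R * (k / q) :=
        (hz _).trans (mul_le_mul_of_nonneg_left hv'd (by linarith))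
      refine kernelQuadratic_sub_le hK hb ha ha1 hB0 hB hL (by nlinarith)
        ((hz _).trans (mul_le_mul_of_nonneg_left hu'd (by linarith))) hzd (by nlinarith) ?_
      have e : (W i).1 ⬝ᵥ v' = (W i).1 ⬝ᵥ v - (W i).1 ⬝ᵥ (v - v') := by
        rw [dotProduct_sub]; ring
      rw [e]
      refine (abs_sub _ _).trans ?_
      nlinarith [mul_le_mul_of_nonneg_left hkq1 (by linarith : (0 : ℝ) ≤ R)]
    have e : sampleMean J (kernelQuadratic K a b u v) W - v ⬝ᵥ A *ᵥ v =
        (sampleMean J (kernelQuadratic K a b u v) W -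
          sampleMean J (kernelQuadratic K a b u' v') W) +
        (sampleMean J (kernelQuadratic K a b u' v') W - ∫ z, kernelQuadratic K a b u' v' z ∂Q) +
        (∫ z, kernelQuadratic K a b u' v' z ∂Q - v' ⬝ᵥ A *ᵥ v') -
        (v ⬝ᵥ A *ᵥ v - v' ⬝ᵥ A *ᵥ v') := by ring
    rw [e]
    refine (abs_sub _ _).trans ?_
    have h5 := abs_add_three (sampleMean J (kernelQuadratic K a b u v) W -
          sampleMean J (kernelQuadratic K a b u' v') W)
        (sampleMean J (kernelQuadratic K a b u' v') W - ∫ z, kernelQuadratic K a b u' v' z ∂Q)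
        (∫ z, kernelQuadratic K a b u' v' z ∂Q - v' ⬝ᵥ A *ᵥ v')
    linarith
  rcases (l2norm_nonneg v).eq_or_lt with h0 | hpos
  · have hvz : v = 0 := by
      funext j
      have := abs_apply_le_l2norm v j
      rw [← h0] at this
      simpa using this
    simp [hvz, kernelQuadratic, sampleMean, l2norm]
  · have h1 := main ((l2norm v)⁻¹ • v) (hv.smul _) (by
      rw [l2norm_smul, abs_of_pos (inv_pos.2 hpos), inv_mul_cancel₀ hpos.ne'])
    have e1 : sampleMean J (kernelQuadratic K a b u ((l2norm v)⁻¹ • v)) W =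
        (l2norm v ^ 2)⁻¹ * sampleMean J (kernelQuadratic K a b u v) W := by
      simp only [sampleMean, kernelQuadratic, dotProduct_smul, smul_eq_mul, mul_pow, inv_pow,
        mul_assoc, ← Finset.mul_sum]
      ring
    have e2 : ((l2norm v)⁻¹ • v) ⬝ᵥ A *ᵥ ((l2norm v)⁻¹ • v) =
        (l2norm v ^ 2)⁻¹ * (v ⬝ᵥ A *ᵥ v) := by
      rw [mulVec_smul, dotProduct_smul, smul_dotProduct, smul_eq_mul, smul_eq_mul, ← mul_assoc,
        ← sq, inv_pow]
    rw [e1, e2, ← mul_sub, abs_mul, abs_of_nonneg (by positivity), inv_mul_le_iff₀ (by positivity),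
      mul_comm (l2norm v ^ 2)] at h1
    exact h1

lemma indicatorDiff_mono {y y' : ℝ} (h : y ≤ y') (s : ℝ) :
    indicatorDiff y s ≤ indicatorDiff y' s := by
  unfold indicatorDiff
  split_ifs <;> linarith

/-- Uniform linearization of the indicator process at the shifts `a u`. The indicator is monotone in
the shift, so two grid points, moved by `± ρ`, bracket its values between grid points. -/
lemma abs_sampleMean_indicatorIncrement_sub_le (hQ : IsErrorLaw Q μ f f₂ l₀ σ G)
    {C a R x : ℝ} {J : Finset ι} {q k : ℕ} (hk : 0 < k) (hkq : k ≤ q) (ha : 0 < a) (hR1 : 1 ≤ R)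
    (j : Fin d) {w : (Fin d → ℝ) → ℝ} (hwm : Measurable w) (hwj : ∀ x, |w x| ≤ |x j|)
    (hw0 : ∀ x, 0 ≤ w x)
    (hmean : ∀ (u : Fin d → ℝ) (ρ : ℝ), l2norm u ≤ 2 → |ρ| ≤ R * (k / q) →
      |∫ z, indicatorIncrement w a ρ u z ∂Q -
          ∫ x, w x * (f x 0 * (a * (x ⬝ᵥ u + ρ))) ∂μ| ≤ C * a ^ 2)
    {W : ι → (Fin d → ℝ) × ℝ} (hWR : ∀ i j, |(W i).1 j| ≤ R)
    (hW : ∀ u ∈ sparseGrid d q k, l2norm u ≤ 2 → ∀ ρ : ℝ, (ρ = R * (k / q) ∨ ρ = -(R * (k / q))) →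
      |sampleMean J (indicatorIncrement w a ρ u) W - ∫ z, indicatorIncrement w a ρ u z ∂Q| ≤ x)
    {u : Fin d → ℝ} (hu : IsSparse k u) (hu1 : l2norm u ≤ 1) :
    |sampleMean J (indicatorIncrement w a 0 u) W - ∫ x, w x * (f x 0 * (a * (x ⬝ᵥ u))) ∂μ| ≤
      x + C * a ^ 2 +
        4 * G * ((1 + 1 / (σ / 2)) * (f₂ * (1 + 1 / (σ / 2)))) * (a * (R * (k / q))) := by
  have hq : 0 < q := hk.trans_le hkq
  have hq0 : (0 : ℝ) < q := by exact_mod_cast hq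
  have hk0 : (0 : ℝ) < k := by exact_mod_cast hk
  obtain ⟨u', hu'G, hu'2, hu'd⟩ := exists_mem_sparseGrid hq hkq hu hu1
  set r := R * ((k : ℝ) / q) with hr
  have hr0 : 0 < r := by positivity
  have hd : l1norm (u - u') ≤ r := hu'd.trans (le_mul_of_one_le_left (by positivity) hR1)
  have habs : |r| ≤ r := (abs_of_pos hr0).le
  have habs' : |(-r)| ≤ r := by rw [abs_neg]; exact habs
  have hz : ∀ i, |(W i).1 ⬝ᵥ u - (W i).1 ⬝ᵥ u'| ≤ r := fun i => by
    rw [← dotProduct_sub]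
    exact (abs_dotProduct_le_of_abs_le (hWR i) _).trans
      (mul_le_mul_of_nonneg_left hu'd (by linarith))
  have hup : sampleMean J (indicatorIncrement w a 0 u) W ≤
      sampleMean J (indicatorIncrement w a r u') W := by
    refine sampleMean_mono fun i _ => mul_le_mul_of_nonneg_left (indicatorDiff_mono ?_ _) (hw0 _)
    refine mul_le_mul_of_nonneg_left ?_ ha.le
    linarith [(abs_le.1 (hz i)).2]
  have hdn : sampleMean J (indicatorIncrement w a (-r) u') W ≤
      sampleMean J (indicatorIncrement w a 0 u) W := by
    refine sampleMean_mono fun i _ => mul_le_mul_of_nonneg_left (indicatorDiff_mono ?_ _) (hw0 _)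
    refine mul_le_mul_of_nonneg_left ?_ ha.le
    linarith [(abs_le.1 (hz i)).1]
  have hu2 : l2norm u ≤ 2 := by linarith
  have a1 := abs_le.1 (hW u' hu'G hu'2 r (Or.inl rfl))
  have a2 := abs_le.1 (hW u' hu'G hu'2 (-r) (Or.inr rfl))
  have b1 := abs_le.1 (hmean u' r hu'2 habs)
  have b2 := abs_le.1 (hmean u' (-r) hu'2 habs')
  have c1 := abs_le.1 (hQ.abs_integral_linear_sub_le j hwm hwj hu2 hu'2 ha hr0 habs hd)
  have c2 := abs_le.1 (hQ.abs_integral_linear_sub_le j hwm hwj hu2 hu'2 ha hr0 habs' hd)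
  rw [abs_le]
  constructor <;> linarith [a1.1, a1.2, a2.1, a2.2, b1.1, b1.2, b2.1, b2.2, c1.1, c1.2, c2.1, c2.2]

end Uniform

/-! ### The gradient of the shifted loss -/

section Gradient

variable {p m n : ℕ}

lemma dotProduct_sum_vecMulVec_mulVec {ι : Type*} (J : Finset ι) (c : ℝ)
    (y : ι → Fin (p + 1) → ℝ) (v u : Fin (p + 1) → ℝ) :
    v ⬝ᵥ (c • ∑ i ∈ J, vecMulVec (y i) (y i)) *ᵥ u = c * ∑ i ∈ J, (y i ⬝ᵥ v) * (y i ⬝ᵥ u) := by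
  rw [smul_mulVec, dotProduct_smul, sum_mulVec, dotProduct_sum, smul_eq_mul]
  congr 1
  refine Finset.sum_congr rfl fun i _ => ?_
  rw [vecMulVec_mulVec, dotProduct_comm v]
  simp only [smul_dotProduct, MulOpposite.smul_eq_mul_unop, MulOpposite.unop_op]

lemma isSymm_sum_vecMulVec {ι : Type*} (J : Finset ι) (c : ℝ) (y : ι → Fin (p + 1) → ℝ) :
    (c • ∑ i ∈ J, vecMulVec (y i) (y i)).IsSymm := by
  rw [Matrix.IsSymm, transpose_smul, transpose_sum]
  simp only [transpose_vecMulVec]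

lemma card_centralMachine (hm : 1 ≤ m) : (centralMachine m n).card = n := by
  have hle : n ≤ m * n := Nat.le_mul_of_pos_left n hm
  unfold centralMachine
  rw [Fin.card_filter_val_lt]
  omega

lemma shiftedLoss_eq (K : ℝ → ℝ) (τ h b : ℝ) (β₀ : Fin (p + 1) → ℝ)
    (x : Fin (m * n) → Fin (p + 1) → ℝ) (y : Fin (m * n) → ℝ) (β : Fin (p + 1) → ℝ) :
    shiftedLoss K τ h b β₀ x y β = 1 / 2 * (β ⬝ᵥ localHessian K b β₀ x y *ᵥ β) -
      β ⬝ᵥ (globalMoment K h τ β₀ x y +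
        (localHessian K b β₀ x y - globalHessian K h β₀ x y) *ᵥ β₀) := by
  unfold shiftedLoss
  congr 1
  rw [localHessian, dotProduct_sum_vecMulVec_mulVec]
  simp only [← sq]
  rw [← mul_assoc]
  congr 1
  ring

/-- The global Hessian cancels from the gradient at `βs`: only the local Hessian, applied to the
initial error, and the average score remain. -/
lemma gradient_shiftedLoss_apply (K : ℝ → ℝ) (τ h b : ℝ) (β₀ βs : Fin (p + 1) → ℝ)
    (x : Fin (m * n) → Fin (p + 1) → ℝ) (y : Fin (m * n) → ℝ) (j : Fin (p + 1)) :
    (localHessian K b β₀ x y *ᵥ βs - (globalMoment K h τ β₀ x y +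
        (localHessian K b β₀ x y - globalHessian K h β₀ x y) *ᵥ β₀)) j =
      1 / ((m * n : ℕ) : ℝ) * ∑ i, x i j * signScore τ (residualAt β₀ (x i) (y i)) -
        (localHessian K b β₀ x y *ᵥ (β₀ - βs)) j := by
  have hG : (globalHessian K h β₀ x y *ᵥ β₀) j = 1 / ((m * n : ℕ) : ℝ) *
      ∑ i, pseudoCovariate K h β₀ (x i) (y i) j * (pseudoCovariate K h β₀ (x i) (y i) ⬝ᵥ β₀) := by
    have := dotProduct_sum_vecMulVec_mulVec Finset.univ (1 / ((m * n : ℕ) : ℝ))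
      (fun i => pseudoCovariate K h β₀ (x i) (y i)) (Pi.single j 1) β₀
    rw [single_one_dotProduct] at this
    simpa only [globalHessian, dotProduct_single_one_right] using this
  have hM : globalMoment K h τ β₀ x y j = 1 / ((m * n : ℕ) : ℝ) *
      ∑ i, ((pseudoCovariate K h β₀ (x i) (y i) ⬝ᵥ β₀) * pseudoCovariate K h β₀ (x i) (y i) j -
        signScore τ (residualAt β₀ (x i) (y i)) * x i j) := by
    simp [globalMoment, pseudoProduct, Finset.sum_apply]
  have hsplit : globalMoment K h τ β₀ x y j = (globalHessian K h β₀ x y *ᵥ β₀) j -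
      1 / ((m * n : ℕ) : ℝ) * ∑ i, x i j * signScore τ (residualAt β₀ (x i) (y i)) := by
    rw [hG, hM, ← mul_sub, ← Finset.sum_sub_distrib]
    congr 1
    exact Finset.sum_congr rfl fun i _ => by ring
  simp only [sub_mulVec, mulVec_sub, Pi.sub_apply, Pi.add_apply]
  rw [hsplit]
  ring

lemma residualAt_eq (βs u : Fin (p + 1) → ℝ) (a : ℝ) {β₀ : Fin (p + 1) → ℝ} (hβ : β₀ - βs = a • u)
    (x : Fin (p + 1) → ℝ) (y : ℝ) :
    residualAt β₀ x y = (toError βs (x, y)).2 - a * ((toError βs (x, y)).1 ⬝ᵥ u) := by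
  have : β₀ = βs + a • u := by rw [← hβ]; abel
  simp only [residualAt, toError, this, dotProduct_add, dotProduct_smul, smul_eq_mul]
  ring

lemma signScore_sub (τ e y : ℝ) : signScore τ (e - y) = signScore τ e + indicatorDiff y e := by
  simp only [signScore, indicatorDiff, sub_nonpos]
  ring

lemma quadratic_localHessian_eq {K : ℝ → ℝ} (hK : IsSmoothingKernel K) (hm : 1 ≤ m) {b : ℝ}
    (hb : 0 < b) (βs u : Fin (p + 1) → ℝ) (a : ℝ) {β₀ : Fin (p + 1) → ℝ} (hβ : β₀ - βs = a • u)
    (x : Fin (m * n) → Fin (p + 1) → ℝ) (y : Fin (m * n) → ℝ) (v : Fin (p + 1) → ℝ) :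
    v ⬝ᵥ localHessian K b β₀ x y *ᵥ v =
      sampleMean (centralMachine m n) (kernelQuadratic K a b u v)
        (fun i => toError βs (x i, y i)) := by
  rw [localHessian, dotProduct_sum_vecMulVec_mulVec, sampleMean, card_centralMachine hm]
  congr 1
  refine Finset.sum_congr rfl fun i _ => ?_
  simp only [pseudoCovariate, smul_dotProduct, smul_eq_mul, kernelQuadratic]
  rw [residualAt_eq βs u a hβ]
  set k := scaledKernel K b ((toError βs (x i, y i)).2 - a * ((toError βs (x i, y i)).1 ⬝ᵥ u))
  have hk : 0 ≤ k := scaledKernel_nonneg hK hb _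
  have e : √k * (x i ⬝ᵥ v) * (√k * (x i ⬝ᵥ v)) = (√k * √k) * (x i ⬝ᵥ v) ^ 2 := by ring
  rw [e, Real.mul_self_sqrt hk, mul_comm]
  rfl

/-- The deterministic core: on the event where the local Hessian is close to the population Hessian
on sparse vectors, the score at the truth is small and the indicator process is nearly linear, the
one-step estimator exists and is accurate. Positive and negative parts of the covariates are treated
separately, because the bracketing of the indicator needs nonnegative weights. -/
lemma oneStepWithin_of_uniform {μ : Measure (Fin (p + 1) → ℝ)}
    {Q : Measure ((Fin (p + 1) → ℝ) × ℝ)} {f : (Fin (p + 1) → ℝ) → ℝ → ℝ} {f₂ l₀ σ G : ℝ}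
    (hQ : IsErrorLaw Q μ f f₂ l₀ σ G)
    {A : Matrix (Fin (p + 1)) (Fin (p + 1)) ℝ} (hA : A.IsSymm) {lo hi : ℝ} (hlo : 0 < lo)
    (hA0 : ∀ v, lo * l2norm v ^ 2 ≤ v ⬝ᵥ A *ᵥ v) (hA1 : ∀ v, v ⬝ᵥ A *ᵥ v ≤ hi * l2norm v ^ 2)
    (hAint : ∀ v u, v ⬝ᵥ A *ᵥ u = ∫ x, f x 0 * ((x ⬝ᵥ v) * (x ⬝ᵥ u)) ∂μ)
    {K : ℝ → ℝ} (hK : IsSmoothingKernel K) (hm : 1 ≤ m) {b : ℝ} (hb : 0 < b)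
    {βs u β₀ : Fin (p + 1) → ℝ} {a : ℝ} (ha : 0 < a) (hβ : β₀ - βs = a • u) {τ h : ℝ}
    {x : Fin (m * n) → Fin (p + 1) → ℝ} {y : Fin (m * n) → ℝ} {t k : ℕ} (hu : IsSparse t u)
    (hu1 : l2norm u ≤ 1) (hβs : IsSparse t βs) (htk : t + 1 ≤ k) (hk1 : 1 < k)
    (hk : 64 * t * hi < lo * (k - 1)) {θ x₁ x₂ lam : ℝ} (hθ : θ ≤ lo / 4) (hlam : 0 < lam)
    (hHess : ∀ v, IsSparse k v → |sampleMean (centralMachine m n) (kernelQuadratic K a b u v)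
        (fun i => toError βs (x i, y i)) - v ⬝ᵥ A *ᵥ v| ≤ θ * l2norm v ^ 2)
    (hscore : ∀ j, |sampleMean Finset.univ (fun z : (Fin (p + 1) → ℝ) × ℝ => z.1 j * signScore τ z.2)
        (fun i => toError βs (x i, y i))| ≤ x₁)
    (hpos : ∀ j, |sampleMean Finset.univ (indicatorIncrement (fun x => max (x j) 0) a 0 u)
        (fun i => toError βs (x i, y i)) - ∫ x, max (x j) 0 * (f x 0 * (a * (x ⬝ᵥ u))) ∂μ| ≤ x₂)
    (hneg : ∀ j, |sampleMean Finset.univ (indicatorIncrement (fun x => max (-x j) 0) a 0 u)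
        (fun i => toError βs (x i, y i)) - ∫ x, max (-x j) 0 * (f x 0 * (a * (x ⬝ᵥ u))) ∂μ| ≤ x₂)
    (hpen : x₁ + 2 * x₂ + a * θ ≤ lam / 2) :
    OneStepWithin K τ h b lam β₀ x y βs (3 * √t * lam / (lo / 2)) := by
  have hprob := hQ.prob
  set W : Fin (m * n) → (Fin (p + 1) → ℝ) × ℝ := fun i => toError βs (x i, y i) with hW
  set D := localHessian K b β₀ x y with hD
  have hDsymm : D.IsSymm := isSymm_sum_vecMulVec _ _ _
  have hDq : ∀ v, v ⬝ᵥ D *ᵥ v = sampleMean (centralMachine m n) (kernelQuadratic K a b u v) W :=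
    quadratic_localHessian_eq hK hm hb βs u a hβ x y
  have hDpsd : ∀ v, 0 ≤ v ⬝ᵥ D *ᵥ v := fun v => by
    rw [hDq]
    exact mul_nonneg (by positivity) (Finset.sum_nonneg fun i _ =>
      mul_nonneg (sq_nonneg _) (scaledKernel_nonneg hK hb _))
  have hDA : ∀ v, IsSparse k v → |v ⬝ᵥ D *ᵥ v - v ⬝ᵥ A *ᵥ v| ≤ θ * l2norm v ^ 2 := fun v hv => by
    rw [hDq]; exact hHess v hv
  set w := globalMoment K h τ β₀ x y + (D - globalHessian K h β₀ x y) *ᵥ β₀ with hw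
  have hgrad : ∀ j, |(D *ᵥ βs - w) j| ≤ lam / 2 := by
    intro j
    have hDu := abs_mulVec_sub_le_of_sparse hDsymm hA (fun v hv => hDA v (hv.mono htk)) u hu hu1 j
    -- the linear parts of the indicator increments add up to `a A u`, which the same term of
    -- the local Hessian compensates
    have hiu : a * (A *ᵥ u) j = ∫ x, max (x j) 0 * (f x 0 * (a * (x ⬝ᵥ u))) ∂μ -
        ∫ x, max (-x j) 0 * (f x 0 * (a * (x ⬝ᵥ u))) ∂μ := by
      have hmj : Measurable fun x : Fin (p + 1) → ℝ => x j := measurable_pi_apply j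
      have i1 := hQ.integrable_mul_linear j (w := fun x => max (x j) 0)
        (hmj.max measurable_const) (fun x => by
          rw [abs_of_nonneg (le_max_right _ _)]
          exact max_le (le_abs_self _) (abs_nonneg _)) (by linarith : l2norm u ≤ 2) ha 0
      have i2 := hQ.integrable_mul_linear j (w := fun x => max (-x j) 0)
        (hmj.neg.max measurable_const) (fun x => by
          rw [abs_of_nonneg (le_max_right _ _)]
          exact max_le (neg_le_abs _) (abs_nonneg _)) (by linarith : l2norm u ≤ 2) ha 0
      simp only [add_zero] at i1 i2
      have h1 := hAint (Pi.single j 1) u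
      rw [single_one_dotProduct] at h1
      rw [← integral_sub i1 i2, h1, ← integral_const_mul]
      refine integral_congr_ae (ae_of_all _ fun x => ?_)
      simp only [dotProduct_single_one_right]
      rw [← sub_mul]
      rw [max_zero_sub_max_neg_zero_eq_self]
      ring
    have hsc : 1 / ((m * n : ℕ) : ℝ) * ∑ i, x i j * signScore τ (residualAt β₀ (x i) (y i)) =
        sampleMean Finset.univ (fun z : (Fin (p + 1) → ℝ) × ℝ => z.1 j * signScore τ z.2) W +
        (sampleMean Finset.univ (indicatorIncrement (fun x => max (x j) 0) a 0 u) W -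
          sampleMean Finset.univ (indicatorIncrement (fun x => max (-x j) 0) a 0 u) W) := by
      rw [← sampleMean_sub, ← sampleMean_add, sampleMean, Finset.card_univ, Fintype.card_fin]
      congr 1
      refine Finset.sum_congr rfl fun i _ => ?_
      rw [residualAt_eq βs u a hβ, signScore_sub]
      simp only [indicatorIncrement, add_zero]
      rw [← sub_mul, max_zero_sub_max_neg_zero_eq_self, ← mul_add]
      rfl
    rw [gradient_shiftedLoss_apply, hsc, hβ, mulVec_smul, Pi.smul_apply, smul_eq_mul]
    have h1 := abs_le.1 (hscore j)
    have h2 := abs_le.1 (hpos j)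
    have h3 := abs_le.1 (hneg j)
    have h4 := abs_le.1 hDu
    have h5 := mul_le_mul_of_nonneg_left h4.1 ha.le
    have h6 := mul_le_mul_of_nonneg_left h4.2 ha.le
    rw [abs_le]
    constructor <;> linarith [h1.1, h1.2, h2.1, h2.2, h3.1, h3.2]
  have hobj : (fun β' => shiftedLoss K τ h b β₀ x y β' + lam * l1norm β') =
      fun β => (1 / 2 * (β ⬝ᵥ D *ᵥ β) - β ⬝ᵥ w) + lam * l1norm β := by
    funext β
    rw [shiftedLoss_eq]
  unfold OneStepWithin IsOneStepEstimator
  rw [hobj]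
  refine ⟨exists_isMinOn_penalized hDsymm hDpsd w βs hlam hgrad, fun β hβmin => ?_⟩
  exact l2norm_sub_le_of_isMinOn hDsymm hDpsd w βs hlam (by positivity) hgrad hβs
    (fun v hv => quadratic_lower_on_cone hDsymm hlo hA0 hA1 (fun v hv => (hDA v hv).trans
      (mul_le_mul_of_nonneg_right hθ (sq_nonneg _))) hk hk1 v hv) hβmin

end Gradient

/-! ### Probabilities of the exceptional events -/

section Probability

variable {ι : Type*} [Fintype ι] {d : ℕ} {Q : Measure ((Fin d → ℝ) × ℝ)} {μ : Measure (Fin d → ℝ)}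
  {f : (Fin d → ℝ) → ℝ → ℝ} {f₂ l₀ σ G : ℝ}

lemma natCast_mul_ofReal (n : ℕ) (x : ℝ) :
    (n : ℝ≥0∞) * ENNReal.ofReal x = ENNReal.ofReal (n * x) := by
  rw [ENNReal.ofReal_mul (Nat.cast_nonneg n), ENNReal.ofReal_natCast]

/-- The choice `t = x / (2v)` in `measure_lt_abs_average_sub_le`. -/
lemma measure_lt_abs_sampleMean_sub_le [IsProbabilityMeasure Q] {J : Finset ι} (hJ : J.Nonempty)
    {φ : (Fin d → ℝ) × ℝ → ℝ} (hφ : Measurable φ) {v x : ℝ} (hx : 0 ≤ x) (hv0 : 0 < v)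
    (hv : ∫⁻ z, ENNReal.ofReal (φ z ^ 2 * Real.exp (x / (2 * v) * |φ z|)) ∂Q ≤ ENNReal.ofReal v) :
    (Measure.pi fun _ : ι => Q) {W | x < |sampleMean J φ W - ∫ z, φ z ∂Q|} ≤
      ENNReal.ofReal (2 * Real.exp (-(J.card * (x ^ 2 / (4 * v))))) := by
  refine (measure_lt_abs_average_sub_le Q J hJ hφ x (by positivity) hv0.le hv).trans (le_of_eq ?_)
  congr 4
  field_simp
  ring

lemma measure_kernelQuadratic_deviation_le (hQ : IsErrorLaw Q μ f f₂ l₀ σ G) {K : ℝ → ℝ}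
    (hK : IsSmoothingKernel K) {J : Finset ι} (hJ : J.Nonempty) {C c a b x : ℝ} (hC : 0 < C)
    (hb : 0 < b) (hx : 0 ≤ x) (hxc : x ≤ 2 * C * c)
    (hvar : ∀ u v : Fin d → ℝ, l2norm u ≤ 2 → l2norm v ≤ 2 → ∀ t, 0 ≤ t → t ≤ c * b →
      ∫⁻ z, ENNReal.ofReal (kernelQuadratic K a b u v z ^ 2 *
        Real.exp (t * |kernelQuadratic K a b u v z|)) ∂Q ≤ ENNReal.ofReal (C / b))
    (q k : ℕ) :
    (Measure.pi fun _ : ι => Q) {W | ∃ u ∈ sparseGrid d q k, ∃ v ∈ sparseGrid d q k,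
        l2norm u ≤ 2 ∧ l2norm v ≤ 2 ∧ x < |sampleMean J (kernelQuadratic K a b u v) W -
          ∫ z, kernelQuadratic K a b u v z ∂Q|} ≤
      ENNReal.ofReal ((sparseGrid d q k).card * ((sparseGrid d q k).card *
        (2 * Real.exp (-(J.card * (b * x ^ 2 / (4 * C))))))) := by
  have := hQ.prob_law
  rw [← natCast_mul_ofReal, ← natCast_mul_ofReal]
  refine measure_exists_mem_le _ _ fun u _ => measure_exists_mem_le _ _ fun v _ => ?_
  by_cases hu : l2norm u ≤ 2
  · by_cases hv : l2norm v ≤ 2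
    · refine (measure_mono fun W hW => hW.2.2).trans
        ((measure_lt_abs_sampleMean_sub_le hJ (measurable_kernelQuadratic hK a b u v) hx
          (div_pos hC hb) (hvar u v hu hv _ (by positivity) ?_)).trans (le_of_eq ?_))
      · rw [div_le_iff₀ (by positivity)]
        calc x ≤ 2 * C * c := hxc
          _ = c * b * (2 * (C / b)) := by field_simp
      · congr 5
        field_simp
    · simp [hv]
  · simp [hu]

lemma measure_indicatorIncrement_deviation_le [Nonempty ι] (hQ : IsErrorLaw Q μ f f₂ l₀ σ G)
    {C a x ρ : ℝ} (hC : 0 < C) (ha : 0 < a) (hx : 0 ≤ x) (hxc : x ≤ 2 * C * a)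
    {w : Fin d → (Fin d → ℝ) → ℝ} (hw : ∀ j, Measurable (w j))
    (hvar : ∀ j u, l2norm u ≤ 2 → ∀ t, 0 ≤ t → t ≤ 1 →
      ∫⁻ z, ENNReal.ofReal (indicatorIncrement (w j) a ρ u z ^ 2 *
        Real.exp (t * |indicatorIncrement (w j) a ρ u z|)) ∂Q ≤ ENNReal.ofReal (C * a))
    (q k : ℕ) :
    (Measure.pi fun _ : ι => Q) {W | ∃ j ∈ (Finset.univ : Finset (Fin d)),
        ∃ u ∈ sparseGrid d q k, l2norm u ≤ 2 ∧
          x < |sampleMean Finset.univ (indicatorIncrement (w j) a ρ u) W -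
            ∫ z, indicatorIncrement (w j) a ρ u z ∂Q|} ≤
      ENNReal.ofReal (d * ((sparseGrid d q k).card *
        (2 * Real.exp (-(Fintype.card ι * (x ^ 2 / (4 * (C * a)))))))) := by
  have := hQ.prob_law
  rw [← natCast_mul_ofReal, ← natCast_mul_ofReal]
  refine (measure_exists_mem_le _ _ (c := (sparseGrid d q k).card * ENNReal.ofReal
    (2 * Real.exp (-(Fintype.card ι * (x ^ 2 / (4 * (C * a))))))) fun j _ =>
      measure_exists_mem_le _ _ fun u _ => ?_).trans (by
    rw [Finset.card_univ, Fintype.card_fin])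
  by_cases hu : l2norm u ≤ 2
  · refine (measure_mono fun W hW => hW.2).trans
      ((measure_lt_abs_sampleMean_sub_le Finset.univ_nonempty
        (measurable_indicatorIncrement (hw j) a ρ u) hx (mul_pos hC ha)
        (hvar j u hu _ (by positivity) ?_)).trans (le_of_eq ?_))
    · rw [div_le_one (by positivity)]
      linarith
    · rw [Finset.card_univ]
  · simp [hu]

lemma measure_score_deviation_le [Nonempty ι] (hQ : IsErrorLaw Q μ f f₂ l₀ σ G)
    {C x τ : ℝ} (hC : 0 < C) (hx : 0 ≤ x) (hxc : x ≤ 2 * C)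
    (hvar : ∀ j : Fin d, (∀ t, 0 ≤ t → t ≤ 1 →
      ∫⁻ z, ENNReal.ofReal ((z.1 j * signScore τ z.2) ^ 2 *
        Real.exp (t * |z.1 j * signScore τ z.2|)) ∂Q ≤ ENNReal.ofReal C) ∧
      ∫ z, z.1 j * signScore τ z.2 ∂Q = 0) :
    (Measure.pi fun _ : ι => Q) {W | ∃ j ∈ (Finset.univ : Finset (Fin d)),
        x < |sampleMean Finset.univ
          (fun z : (Fin d → ℝ) × ℝ => z.1 j * signScore τ z.2) W|} ≤
      ENNReal.ofReal (d * (2 * Real.exp (-(Fintype.card ι * (x ^ 2 / (4 * C)))))) := by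
  have := hQ.prob_law
  rw [← natCast_mul_ofReal]
  refine (measure_exists_mem_le _ _ (c := ENNReal.ofReal
    (2 * Real.exp (-(Fintype.card ι * (x ^ 2 / (4 * C)))))) fun j _ => ?_).trans (by
    rw [Finset.card_univ, Fintype.card_fin])
  have hms : Measurable (signScore τ) := by
    unfold signScore
    exact (Measurable.ite measurableSet_Iic measurable_const measurable_const).sub_const τ
  have h := measure_lt_abs_sampleMean_sub_le (ι := ι) (Q := Q) Finset.univ_nonempty
    (φ := fun z : (Fin d → ℝ) × ℝ => z.1 j * signScore τ z.2) (by fun_prop) hx hC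
    ((hvar j).1 _ (by positivity) (by rw [div_le_one (by positivity)]; linarith))
  rw [(hvar j).2, Finset.card_univ] at h
  simpa only [sub_zero] using h

lemma measure_covariate_large_le (hQ : IsErrorLaw Q μ f f₂ l₀ σ G) {R : ℝ} (hR : 0 ≤ R) :
    (Measure.pi fun _ : ι => Q) {W | ∃ i ∈ (Finset.univ : Finset ι),
        ∃ j ∈ (Finset.univ : Finset (Fin d)), R < |(W i).1 j|} ≤
      ENNReal.ofReal (Fintype.card ι * (d * (G * Real.exp (-(σ * R ^ 2))))) := by
  have := hQ.prob_law
  rw [← natCast_mul_ofReal, ← natCast_mul_ofReal]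
  refine (measure_exists_mem_le _ _ (c := d * ENNReal.ofReal (G * Real.exp (-(σ * R ^ 2))))
    fun i _ => (measure_exists_mem_le _ _ (c := ENNReal.ofReal (G * Real.exp (-(σ * R ^ 2))))
      fun j _ => ?_).trans (by rw [Finset.card_univ, Fintype.card_fin])).trans (by
    rw [Finset.card_univ])
  have hms : MeasurableSet {z : (Fin d → ℝ) × ℝ | R < |z.1 j|} :=
    measurableSet_lt measurable_const ((measurable_pi_apply j).comp measurable_fst).norm
  have h := (measurePreserving_eval (fun _ : ι => Q) i).measure_preimage hms.nullMeasurableSet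
  exact (le_of_eq h).trans (hQ.measure_lt_abs_le j hR)

end Probability

lemma isSparse_of_slopeSupport_subset {p : ℕ} {β : Fin (p + 1) → ℝ} {S : Finset (Fin (p + 1))}
    (h : slopeSupport β ⊆ S) : IsSparse (S.card + 1) β := by
  classical
  refine ⟨insert 0 S, Finset.card_insert_le _ _, fun j hj => ?_⟩
  rw [Finset.mem_insert, not_or] at hj
  by_contra hne
  exact hj.2 (h (by simp [slopeSupport, hj.1, hne]))

/-- Constants, depending only on the constants of the model, for which the finite-sample bound
holds: variance proxies and biases of the three kinds of summands, and the kernel bounds. -/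
structure DeviationConstants (K : ℝ → ℝ) (f₂ l₀ σ G C₁ C₂ C₃ c₃ B : ℝ) : Prop where
  pos₁ : 0 < C₁
  pos₂ : 0 < C₂
  pos₃ : 0 < C₃
  pos_c : 0 < c₃
  pos_B : 0 < B
  score : ∀ {d : ℕ} (Q : Measure ((Fin d → ℝ) × ℝ)) (μ : Measure (Fin d → ℝ))
      (f : (Fin d → ℝ) → ℝ → ℝ), IsErrorLaw Q μ f f₂ l₀ σ G →
      ∀ τ : ℝ, 0 < τ → τ < 1 → (∀ᵐ x ∂μ, ∫ u in Set.Iic 0, f x u = τ) → ∀ j : Fin d,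
        (∀ t, 0 ≤ t → t ≤ 1 → ∫⁻ z, ENNReal.ofReal ((z.1 j * signScore τ z.2) ^ 2 *
          Real.exp (t * |z.1 j * signScore τ z.2|)) ∂Q ≤ ENNReal.ofReal C₁) ∧
        ∫ z, z.1 j * signScore τ z.2 ∂Q = 0
  indicator : ∀ {d : ℕ} (Q : Measure ((Fin d → ℝ) × ℝ)) (μ : Measure (Fin d → ℝ))
      (f : (Fin d → ℝ) → ℝ → ℝ), IsErrorLaw Q μ f f₂ l₀ σ G →
      ∀ (j : Fin d) (w : (Fin d → ℝ) → ℝ), Measurable w → (∀ x, |w x| ≤ |x j|) →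
      ∀ (u : Fin d → ℝ) (a ρ : ℝ), l2norm u ≤ 2 → 0 < a → a ≤ 1 → |ρ| ≤ 1 →
        (∀ t, 0 ≤ t → t ≤ 1 → ∫⁻ z, ENNReal.ofReal (indicatorIncrement w a ρ u z ^ 2 *
          Real.exp (t * |indicatorIncrement w a ρ u z|)) ∂Q ≤ ENNReal.ofReal (C₂ * a)) ∧
        |∫ z, indicatorIncrement w a ρ u z ∂Q -
          ∫ x, w x * (f x 0 * (a * (x ⬝ᵥ u + ρ))) ∂μ| ≤ C₂ * a ^ 2
  kernel : ∀ {d : ℕ} (Q : Measure ((Fin d → ℝ) × ℝ)) (μ : Measure (Fin d → ℝ))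
      (f : (Fin d → ℝ) → ℝ → ℝ), IsErrorLaw Q μ f f₂ l₀ σ G →
      ∀ u v : Fin d → ℝ, l2norm u ≤ 2 → l2norm v ≤ 2 → ∀ a b : ℝ, 0 < a → a ≤ 1 → 0 < b → b ≤ 1 →
        (∀ t, 0 ≤ t → t ≤ c₃ * b → ∫⁻ z, ENNReal.ofReal (kernelQuadratic K a b u v z ^ 2 *
          Real.exp (t * |kernelQuadratic K a b u v z|)) ∂Q ≤ ENNReal.ofReal (C₃ / b)) ∧
        |∫ z, kernelQuadratic K a b u v z ∂Q - ∫ x, (x ⬝ᵥ v) ^ 2 * f x 0 ∂μ| ≤ C₃ * (a + b)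
  lipschitz : ∀ b, 0 < b → b ≤ 1 → (∀ s, scaledKernel K b s ≤ B / b ^ 2) ∧
      ∀ s s', |scaledKernel K b s - scaledKernel K b s'| ≤ B / b ^ 2 * |s - s'|

lemma exists_deviationConstants {K : ℝ → ℝ} (hK : IsSmoothingKernel K) (f₂ l₀ σ G : ℝ)
    (hf₂ : 0 ≤ f₂) (hl₀ : 0 ≤ l₀) (hσ : 0 < σ) (hG : 1 ≤ G) :
    ∃ C₁ C₂ C₃ c₃ B, DeviationConstants K f₂ l₀ σ G C₁ C₂ C₃ c₃ B := by
  obtain ⟨C₁, h₁, score⟩ := exists_score_bounds f₂ l₀ σ G hσ hG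
  obtain ⟨C₂, h₂, indicator⟩ := exists_indicatorIncrement_bounds f₂ l₀ σ G hf₂ hl₀ hσ hG
  obtain ⟨C₃, h₃, c₃, hc, kernel⟩ := exists_kernelQuadratic_bounds hK f₂ l₀ σ G hf₂ hl₀ hσ hG
  obtain ⟨B, hB, lipschitz⟩ := exists_scaledKernel_bounds hK
  exact ⟨C₁, C₂, C₃, c₃, B, h₁, h₂, h₃, hc, hB, score, indicator, kernel, lipschitz⟩

/-- Finite-sample bound: the probability that the initial estimator is good and the one-step
estimator is not, in terms of free deviation levels `x₁, x₂, x₃`, the covariate bound `R` and the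
grid parameters `q, k`. -/
lemma measure_not_oneStepWithin_le {Ω : Type*} [MeasurableSpace Ω] {P : Measure Ω} {p m n s : ℕ}
    {ν : Measure ((Fin (p + 1) → ℝ) × ℝ)} {βs : Fin (p + 1) → ℝ}
    {f : (Fin (p + 1) → ℝ) → ℝ → ℝ} {X : Fin (m * n) → Ω → Fin (p + 1) → ℝ}
    {Y : Fin (m * n) → Ω → ℝ} (hsample : IsIIDSample P ν X Y)
    {f₂ l₀ σ G τ : ℝ} (hQ : IsErrorLaw (ν.map (toError βs)) ν.fst f f₂ l₀ σ G)
    (hτ : 0 < τ) (hτ1 : τ < 1) (hq : ∀ᵐ x ∂ν.fst, ∫ u in Set.Iic 0, f x u = τ)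
    (hs : s = (slopeSupport βs).card)
    {A : Matrix (Fin (p + 1)) (Fin (p + 1)) ℝ} (hA : A.IsSymm) {lo hi : ℝ} (hlo : 0 < lo)
    (hA0 : ∀ v, lo * l2norm v ^ 2 ≤ v ⬝ᵥ A *ᵥ v) (hA1 : ∀ v, v ⬝ᵥ A *ᵥ v ≤ hi * l2norm v ^ 2)
    (hhi : 0 ≤ hi)
    (hAint : ∀ v u, v ⬝ᵥ A *ᵥ u = ∫ x, f x 0 * ((x ⬝ᵥ v) * (x ⬝ᵥ u)) ∂ν.fst)
    {K : ℝ → ℝ} (hK : IsSmoothingKernel K) {C₁ C₂ C₃ c₃ B : ℝ}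
    (hC : DeviationConstants K f₂ l₀ σ G C₁ C₂ C₃ c₃ B)
    (hm : 1 ≤ m) (hn : 1 ≤ n) {a b h R x₁ x₂ x₃ lam : ℝ} {q k : ℕ}
    (ha : 0 < a) (ha1 : a ≤ 1) (hb : 0 < b) (hb1 : b ≤ 1) (hR : 1 ≤ R)
    (hkq : k ≤ q) (hr : R * (k / q) ≤ 1) (hsk : s + 2 ≤ k)
    (hk : 64 * (s + 1 : ℕ) * hi < lo * (k - 1))
    (hx₁ : 0 ≤ x₁) (hx₁' : x₁ ≤ 2 * C₁) (hx₂ : 0 ≤ x₂) (hx₂' : x₂ ≤ 2 * C₂ * a)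
    (hx₃ : 0 ≤ x₃) (hx₃' : x₃ ≤ 2 * C₃ * c₃) {θ : ℝ}
    (hθ : x₃ + C₃ * (a + b) +
      (3 * B * (R * (k + 1)) ^ 2 * (R * (k / q)) / b ^ 2 + 6 * hi * (k / q)) ≤ θ)
    (hθlo : θ ≤ lo / 4) (hlam : 0 < lam)
    (hpen : x₁ + 2 * (x₂ + C₂ * a ^ 2 +
      4 * G * ((1 + 1 / (σ / 2)) * (f₂ * (1 + 1 / (σ / 2)))) * (a * (R * (k / q)))) + a * θ ≤
        lam / 2)
    (βinit : Ω → Fin (p + 1) → ℝ) :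
    P {ω | slopeSupport (βinit ω) ⊆ slopeSupport βs ∧ l2norm (βinit ω - βs) ≤ a ∧
        ¬ OneStepWithin K τ h b lam (βinit ω) (fun i => X i ω) (fun i => Y i ω) βs
          (3 * √((s + 1 : ℕ) : ℝ) * lam / (lo / 2))} ≤
      ENNReal.ofReal
        ((m * n : ℕ) * ((p + 1 : ℕ) * (G * Real.exp (-(σ * R ^ 2)))) +
        (p + 1 : ℕ) * (2 * Real.exp (-((m * n : ℕ) * (x₁ ^ 2 / (4 * C₁))))) +
        4 * ((p + 1 : ℕ) * ((sparseGrid (p + 1) q k).card *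
          (2 * Real.exp (-((m * n : ℕ) * (x₂ ^ 2 / (4 * (C₂ * a)))))))) +
        (sparseGrid (p + 1) q k).card * ((sparseGrid (p + 1) q k).card *
          (2 * Real.exp (-(n * (b * x₃ ^ 2 / (4 * C₃))))))) := by
  have hprob := hQ.prob
  have hG := hQ.one_le_G
  have hk0 : 0 < k := by omega
  set Q := ν.map (toError βs) with hQdef
  have hN0 : 0 < m * n := Nat.mul_pos hm hn
  have : Nonempty (Fin (m * n)) := ⟨⟨0, hN0⟩⟩
  set J := centralMachine m n with hJdef
  have hJcard : J.card = n := card_centralMachine hm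
  have hJ : J.Nonempty := by rw [← Finset.card_pos, hJcard]; exact hn
  set Pr : Measure (Fin (m * n) → (Fin (p + 1) → ℝ) × ℝ) := Measure.pi fun _ => Q
  set wp : Fin (p + 1) → (Fin (p + 1) → ℝ) → ℝ := fun j x => max (x j) 0 with hwp
  set wn : Fin (p + 1) → (Fin (p + 1) → ℝ) → ℝ := fun j x => max (-x j) 0 with hwn
  have hwpm : ∀ j, Measurable (wp j) := fun j => (measurable_pi_apply j).max measurable_const
  have hwnm : ∀ j, Measurable (wn j) := fun j =>
    (measurable_pi_apply (X := fun _ : Fin (p + 1) => ℝ) j).neg.max measurable_const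
  have hwpj : ∀ j x, |wp j x| ≤ |x j| := fun j x => by
    rw [abs_of_nonneg (le_max_right _ _)]
    exact max_le (le_abs_self _) (abs_nonneg _)
  have hwnj : ∀ j x, |wn j x| ≤ |x j| := fun j x => by
    rw [abs_of_nonneg (le_max_right _ _)]
    exact max_le (neg_le_abs _) (abs_nonneg _)
  set r := R * ((k : ℝ) / q) with hrdef
  have hr0 : 0 ≤ r := by positivity
  -- the exceptional events, as sets of samples
  let E₀ : Set (Fin (m * n) → (Fin (p + 1) → ℝ) × ℝ) :=
    {W | ∃ i ∈ (Finset.univ : Finset (Fin (m * n))),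
    ∃ j ∈ (Finset.univ : Finset (Fin (p + 1))), R < |(W i).1 j|}
  let E₁ : Set (Fin (m * n) → (Fin (p + 1) → ℝ) × ℝ) :=
    {W | ∃ j ∈ (Finset.univ : Finset (Fin (p + 1))), x₁ < |sampleMean Finset.univ
      (fun z : (Fin (p + 1) → ℝ) × ℝ => z.1 j * signScore τ z.2) W|}
  let E₂ : (Fin (p + 1) → (Fin (p + 1) → ℝ) → ℝ) → ℝ → Set (Fin (m * n) → (Fin (p + 1) → ℝ) × ℝ) :=
    fun w ρ => {W | ∃ j ∈ (Finset.univ : Finset (Fin (p + 1))),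
      ∃ u ∈ sparseGrid (p + 1) q k, l2norm u ≤ 2 ∧
        x₂ < |sampleMean Finset.univ (indicatorIncrement (w j) a ρ u) W -
          ∫ z, indicatorIncrement (w j) a ρ u z ∂Q|}
  let E₃ : Set (Fin (m * n) → (Fin (p + 1) → ℝ) × ℝ) :=
    {W | ∃ u ∈ sparseGrid (p + 1) q k, ∃ v ∈ sparseGrid (p + 1) q k,
      l2norm u ≤ 2 ∧ l2norm v ≤ 2 ∧ x₃ < |sampleMean J (kernelQuadratic K a b u v) W -
        ∫ z, kernelQuadratic K a b u v z ∂Q|}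
  set p₂ : ℝ := (p + 1 : ℕ) * ((sparseGrid (p + 1) q k).card *
    (2 * Real.exp (-((m * n : ℕ) * (x₂ ^ 2 / (4 * (C₂ * a))))))) with hp₂
  have hE₀ : Pr E₀ ≤ _ := measure_covariate_large_le hQ (by linarith)
  have hE₁ : Pr E₁ ≤ _ := measure_score_deviation_le hQ hC.pos₁ hx₁ hx₁'
    (hC.score Q ν.fst f hQ τ hτ hτ1 hq)
  have hE₂ : ∀ w : Fin (p + 1) → (Fin (p + 1) → ℝ) → ℝ, (∀ j, Measurable (w j)) →
      (∀ j x, |w j x| ≤ |x j|) → ∀ ρ, |ρ| ≤ 1 → Pr (E₂ w ρ) ≤ ENNReal.ofReal p₂ := by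
    intro w hw hwj ρ hρ
    have := measure_indicatorIncrement_deviation_le (ι := Fin (m * n)) hQ hC.pos₂ ha hx₂ hx₂' hw
      (fun j u hu => (hC.indicator Q ν.fst f hQ j (w j) (hw j) (hwj j) u a ρ hu ha ha1 hρ).1) q k
    rwa [Fintype.card_fin] at this
  have hE₃ : Pr E₃ ≤ _ := measure_kernelQuadratic_deviation_le hQ hK hJ hC.pos₃ hb hx₃ hx₃'
    (fun u v hu hv => (hC.kernel Q ν.fst f hQ u v hu hv a b ha ha1 hb hb1).1) q k
  rw [Fintype.card_fin] at hE₀ hE₁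
  rw [hJcard] at hE₃
  have hr1 : |r| ≤ 1 := by rw [abs_of_nonneg hr0]; exact hr
  have hr1' : |(-r)| ≤ 1 := by rw [abs_neg]; exact hr1
  -- outside the exceptional events, the deterministic bound applies
  have hsub : {ω | slopeSupport (βinit ω) ⊆ slopeSupport βs ∧ l2norm (βinit ω - βs) ≤ a ∧
        ¬ OneStepWithin K τ h b lam (βinit ω) (fun i => X i ω) (fun i => Y i ω) βs
          (3 * √((s + 1 : ℕ) : ℝ) * lam / (lo / 2))} ⊆
      (fun ω i => toError βs (X i ω, Y i ω)) ⁻¹'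
        (E₀ ∪ E₁ ∪ ((E₂ wp r ∪ E₂ wp (-r)) ∪ (E₂ wn r ∪ E₂ wn (-r))) ∪ E₃) := by
    rintro ω ⟨hsupp, hl2, hnot⟩
    rw [Set.mem_preimage]
    by_contra hgood
    simp only [Set.mem_union, not_or] at hgood
    obtain ⟨⟨⟨g₀, g₁⟩, ⟨gp, gp'⟩, gn, gn'⟩, g₃⟩ := hgood
    refine hnot ?_
    set W : Fin (m * n) → (Fin (p + 1) → ℝ) × ℝ := fun i => toError βs (X i ω, Y i ω) with hW
    have hWR : ∀ i j, |(W i).1 j| ≤ R := fun i j => by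
      by_contra hcon
      exact g₀ ⟨i, Finset.mem_univ _, j, Finset.mem_univ _, not_le.1 hcon⟩
    set u : Fin (p + 1) → ℝ := a⁻¹ • (βinit ω - βs) with hu
    have hβ : βinit ω - βs = a • u := by rw [hu, smul_inv_smul₀ ha.ne']
    have hu1 : l2norm u ≤ 1 := by
      rw [hu, l2norm_smul, abs_of_pos (inv_pos.2 ha), inv_mul_le_iff₀ ha, mul_one]
      exact hl2
    have hβsp : IsSparse (s + 1) βs := by
      rw [hs]; exact isSparse_of_slopeSupport_subset (Finset.Subset.refl _)
    have husp : IsSparse (s + 1) u := by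
      rw [hs]
      obtain ⟨S, hS, hS0⟩ := isSparse_of_slopeSupport_subset (β := βinit ω - βs)
        (S := slopeSupport βs) fun j hj => by
          by_contra hjs
          have h0 : j ≠ 0 := by
            simp only [slopeSupport, Finset.mem_filter] at hj; exact hj.2.1
          have hb0 : βs j = 0 := by
            by_contra hne
            exact hjs (by simp [slopeSupport, h0, hne])
          have hi0 : βinit ω j = 0 := by
            by_contra hne
            exact hjs (hsupp (by simp [slopeSupport, h0, hne]))
          simp [slopeSupport, hb0, hi0] at hj
      exact IsSparse.smul ⟨S, hS, hS0⟩ _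
    have husp' : IsSparse k u := husp.mono (by omega)
    have hind : ∀ (w : Fin (p + 1) → (Fin (p + 1) → ℝ) → ℝ), (∀ j, Measurable (w j)) →
        (∀ j x, |w j x| ≤ |x j|) → (∀ j x, 0 ≤ w j x) → W ∉ E₂ w r → W ∉ E₂ w (-r) → ∀ j,
        |sampleMean Finset.univ (indicatorIncrement (w j) a 0 u) W -
          ∫ x, w j x * (f x 0 * (a * (x ⬝ᵥ u))) ∂ν.fst| ≤ x₂ + C₂ * a ^ 2 +
            4 * G * ((1 + 1 / (σ / 2)) * (f₂ * (1 + 1 / (σ / 2)))) * (a * (R * (k / q))) := by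
      intro w hw hwj hw0 hg hg' j
      refine abs_sampleMean_indicatorIncrement_sub_le hQ hk0 hkq ha hR j (hw j) (hwj j) (hw0 j)
        (fun u ρ hu2 hρ => (hC.indicator Q ν.fst f hQ j (w j) (hw j) (hwj j) u a ρ hu2 ha ha1
          (hρ.trans hr)).2) hWR ?_ husp' hu1
      rintro u' hu' hu'2 ρ (rfl | rfl)
      · by_contra hcon
        exact hg ⟨j, Finset.mem_univ _, u', hu', hu'2, not_le.1 hcon⟩
      · by_contra hcon
        exact hg' ⟨j, Finset.mem_univ _, u', hu', hu'2, not_le.1 hcon⟩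
    obtain ⟨hBd, hLip⟩ := hC.lipschitz b hb hb1
    refine oneStepWithin_of_uniform hQ hA hlo hA0 hA1 hAint hK hm hb ha hβ husp hu1 hβsp
      (by omega) (by omega) hk hθlo hlam (fun v hv => ?_) (fun j => ?_)
      (hind wp hwpm hwpj (fun j x => le_max_right _ _) gp gp')
      (hind wn hwnm hwnj (fun j x => le_max_right _ _) gn gn') hpen
    · refine (abs_sampleMean_kernelQuadratic_sub_le (Q := Q) (μ := ν.fst) (f := f) (C := C₃)
        (x := x₃) hK hA
        (fun v => le_trans (by positivity) (hA0 v)) hA1 hhi (fun v => ?_) hJ hk0 hkq hb ha ha1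
        hC.pos_B hR hBd hLip (fun u v hu hv => (hC.kernel Q ν.fst f hQ u v hu hv a b ha ha1 hb hb1).2)
        hWR (fun u' hu' v' hv' hu'2 hv'2 => ?_) husp' hu1 hv).trans
        (mul_le_mul_of_nonneg_right hθ (sq_nonneg _))
      · rw [hAint]
        exact integral_congr_ae (ae_of_all _ fun x => by simp only; ring)
      · by_contra hcon
        exact g₃ ⟨u', hu', v', hv', hu'2, hv'2, not_le.1 hcon⟩
    · by_contra hcon
      exact g₁ ⟨j, Finset.mem_univ _, not_le.1 hcon⟩
  have hlaw := hsample.hasLaw_pi βs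
  have hpull : ∀ E : Set (Fin (m * n) → (Fin (p + 1) → ℝ) × ℝ),
      P ((fun ω i => toError βs (X i ω, Y i ω)) ⁻¹' E) ≤ Pr E := fun E => by
    have := Measure.le_map_apply hlaw.aemeasurable E
    rwa [hlaw.map_eq] at this
  refine (measure_mono hsub).trans ((hpull _).trans ?_)
  have hfour : Pr ((E₂ wp r ∪ E₂ wp (-r)) ∪ (E₂ wn r ∪ E₂ wn (-r))) ≤ ENNReal.ofReal (4 * p₂) := by
    have hp0 : 0 ≤ p₂ := by positivity
    rw [show 4 * p₂ = (p₂ + p₂) + (p₂ + p₂) by ring,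
      ENNReal.ofReal_add (by positivity) (by positivity), ENNReal.ofReal_add hp0 hp0]
    exact (measure_union_le _ _).trans (add_le_add
      ((measure_union_le _ _).trans (add_le_add (hE₂ wp hwpm hwpj r hr1) (hE₂ wp hwpm hwpj _ hr1')))
      ((measure_union_le _ _).trans (add_le_add (hE₂ wn hwnm hwnj r hr1) (hE₂ wn hwnm hwnj _ hr1'))))
  rw [ENNReal.ofReal_add (by positivity) (by positivity),
    ENNReal.ofReal_add (by positivity) (by positivity),
    ENNReal.ofReal_add (by positivity) (by positivity)]
  exact (measure_union_le _ _).trans (add_le_add ((measure_union_le _ _).trans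
    (add_le_add ((measure_union_le _ _).trans (add_le_add hE₀ hE₁)) hfour)) hE₃)

/-! ### Rates along the sequence of problems -/

lemma bandwidthRate_nonneg (s n : ℕ) : 0 ≤ bandwidthRate s n :=
  Real.rpow_nonneg (div_nonneg (mul_nonneg (Nat.cast_nonneg _) (Real.log_natCast_nonneg _))
    (Nat.cast_nonneg _)) _

lemma bandwidthRate_pow_three (s n : ℕ) : bandwidthRate s n ^ 3 = s * Real.log n / n := by
  rw [bandwidthRate, ← Real.rpow_natCast, ← Real.rpow_mul (div_nonneg (mul_nonneg
    (Nat.cast_nonneg _) (Real.log_natCast_nonneg _)) (Nat.cast_nonneg _))]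
  norm_num

/-- The only consequence of the growth conditions that the rates need: `s³ log n / n → 0`,
because `s = O(n^r)` with `r < 1/3`. -/
lemma tendsto_cube_mul_log_div {n s : ℕ → ℕ} (hn : Tendsto n atTop atTop) {r : ℝ} (hr : r < 1 / 3)
    (hsn : (fun k => (s k : ℝ)) =O[atTop] fun k => (n k : ℝ) ^ r) :
    Tendsto (fun k => (s k : ℝ) ^ 3 * Real.log (n k) / n k) atTop (𝓝 0) := by
  obtain ⟨C, hC⟩ := hsn.bound
  have hlog : Tendsto (fun x : ℝ => Real.log x / x ^ (1 - 3 * r)) atTop (𝓝 0) :=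
    (isLittleO_log_rpow_atTop (by linarith)).tendsto_div_nhds_zero
  have hlim : Tendsto (fun k => C ^ 3 * (Real.log (n k) / (n k : ℝ) ^ (1 - 3 * r))) atTop
      (𝓝 0) := by
    simpa using (hlog.comp (tendsto_natCast_atTop_atTop.comp hn)).const_mul (C ^ 3)
  refine squeeze_zero' (Eventually.of_forall fun k => ?_) ?_ hlim
  · exact div_nonneg (mul_nonneg (by positivity) (Real.log_natCast_nonneg _)) (Nat.cast_nonneg _)
  · filter_upwards [hC, hn.eventually_ge_atTop 1] with k hk hn1
    have hn0 : (0 : ℝ) < n k := by exact_mod_cast hn1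
    have hk' : (s k : ℝ) ≤ C * (n k : ℝ) ^ r := by
      simpa [Real.norm_of_nonneg (Real.rpow_nonneg hn0.le r)] using hk
    have h3 : (s k : ℝ) ^ 3 ≤ C ^ 3 * (n k : ℝ) ^ (3 * r) := by
      refine (pow_le_pow_left₀ (Nat.cast_nonneg _) hk' 3).trans (le_of_eq ?_)
      rw [mul_pow, ← Real.rpow_natCast ((n k : ℝ) ^ r), ← Real.rpow_mul hn0.le]
      norm_num [mul_comm]
    have hlog0 : 0 ≤ Real.log (n k) := Real.log_natCast_nonneg _
    rw [Real.rpow_sub hn0, Real.rpow_one, div_le_iff₀ hn0]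
    calc (s k : ℝ) ^ 3 * Real.log (n k) ≤ C ^ 3 * (n k : ℝ) ^ (3 * r) * Real.log (n k) :=
          mul_le_mul_of_nonneg_right h3 hlog0
      _ = _ := by
          have : 0 < (n k : ℝ) ^ (3 * r) := Real.rpow_pos_of_pos hn0 _
          field_simp

lemma one_le_log_of_three_le {n : ℕ} (hn : 3 ≤ n) : 1 ≤ Real.log n := by
  rw [Real.le_log_iff_exp_le (by positivity)]
  have : (3 : ℝ) ≤ n := by exact_mod_cast hn
  linarith [Real.exp_one_lt_d9]

lemma rate_bounds {N n s : ℕ} (h3 : 3 ≤ n) (hN : n ≤ N) (hs : 1 ≤ s) :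
    1 / (N : ℝ) ≤ bandwidthRate s n ∧ 1 / (N : ℝ) ≤ √(Real.log N / N) ∧
      √(Real.log N / N) ≤ initialRate s N n := by
  have hn0 : (0 : ℝ) < n := by positivity
  have hnN : (n : ℝ) ≤ N := by exact_mod_cast hN
  have hN0 : (0 : ℝ) < N := by linarith
  have hs1 : (1 : ℝ) ≤ s := by exact_mod_cast hs
  have hlogn := one_le_log_of_three_le h3
  have hlogN := one_le_log_of_three_le (h3.trans hN)
  have hN1 : (1 : ℝ) ≤ N := by exact_mod_cast (by omega : 1 ≤ N)
  refine ⟨?_, ?_, ?_⟩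
  · refine le_of_pow_le_pow_left₀ (n := 3) (by norm_num) (bandwidthRate_nonneg s n) ?_
    rw [bandwidthRate_pow_three]
    have h1 : (1 / (N : ℝ)) ^ 3 ≤ 1 / N :=
      pow_le_of_le_one (by positivity) ((div_le_one hN0).2 hN1) (by norm_num)
    refine h1.trans ((one_div_le_one_div_of_le hn0 hnN).trans ?_)
    gcongr
    nlinarith
  · refine Real.le_sqrt_of_sq_le ?_
    rw [div_pow, one_pow, div_le_div_iff₀ (by positivity) hN0]
    nlinarith
  · refine Real.sqrt_le_sqrt ?_
    rw [div_le_div_iff₀ hN0 hn0]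
    have : 0 ≤ Real.log N * n := by positivity
    calc Real.log N * n ≤ Real.log N * N := by gcongr
      _ ≤ s * (Real.log N * N) := le_mul_of_one_le_left (by positivity) hs1
      _ = s * Real.log N * N := by ring

lemma mul_initialRate_sq_le {c : ℝ} (hc : 0 < c) {N n s : ℕ}
    (hlog : c * Real.log N ≤ Real.log n) :
    (s * initialRate s N n) ^ 2 ≤ (s : ℝ) ^ 3 * Real.log n / n / c := by
  have hl : 0 ≤ Real.log N := Real.log_natCast_nonneg _
  rw [mul_pow, initialRate, Real.sq_sqrt (by positivity), div_div, div_eq_mul_inv,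
    div_eq_mul_inv, mul_inv]
  have : Real.log N ≤ Real.log n * c⁻¹ := by rw [← div_eq_mul_inv, le_div_iff₀ hc]; linarith
  calc (s : ℝ) ^ 2 * (s * Real.log N * (n : ℝ)⁻¹) = s ^ 3 * (n : ℝ)⁻¹ * Real.log N := by ring
    _ ≤ s ^ 3 * (n : ℝ)⁻¹ * (Real.log n * c⁻¹) := by gcongr
    _ = _ := by ring

lemma tendsto_rates {N n s : ℕ → ℕ} {c : ℝ} (hc : 0 < c) (hs : ∀ k, 1 ≤ s k)
    (hlog : ∀ᶠ k in atTop, c * Real.log (N k) ≤ Real.log (n k))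
    (hT : Tendsto (fun k => (s k : ℝ) ^ 3 * Real.log (n k) / n k) atTop (𝓝 0)) :
    Tendsto (fun k => s k * initialRate (s k) (N k) (n k)) atTop (𝓝 0) ∧
      Tendsto (fun k => etaRate (s k) (N k) (n k)) atTop (𝓝 0) := by
  have h1 : Tendsto (fun k => s k * initialRate (s k) (N k) (n k)) atTop (𝓝 0) := by
    have hlim : Tendsto (fun k => √((s k : ℝ) ^ 3 * Real.log (n k) / n k / c)) atTop (𝓝 0) := by
      simpa using (hT.div_const c).sqrt
    refine squeeze_zero' (Eventually.of_forall fun k =>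
      mul_nonneg (Nat.cast_nonneg _) (Real.sqrt_nonneg _)) ?_ hlim
    filter_upwards [hlog] with k hk
    exact Real.le_sqrt_of_sq_le (mul_initialRate_sq_le hc hk)
  refine ⟨h1, ?_⟩
  have h2 : Tendsto (fun k => initialRate (s k) (N k) (n k)) atTop (𝓝 0) :=
    squeeze_zero (fun k => Real.sqrt_nonneg _) (fun k => le_mul_of_one_le_left
      (Real.sqrt_nonneg _) (by exact_mod_cast hs k)) h1
  have h3 : Tendsto (fun k => bandwidthRate (s k) (n k)) atTop (𝓝 0) := by
    have hlim : Tendsto (fun k => ((s k : ℝ) ^ 3 * Real.log (n k) / n k) ^ ((1 : ℝ) / 3)) atTop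
        (𝓝 0) := by
      simpa using hT.rpow_const (p := (1 : ℝ) / 3) (Or.inr (by norm_num))
    refine squeeze_zero (fun k => bandwidthRate_nonneg _ _) (fun k => ?_) hlim
    have hlog0 : 0 ≤ Real.log (n k) := Real.log_natCast_nonneg _
    have hs1 : (1 : ℝ) ≤ s k := by exact_mod_cast hs k
    have : (s k : ℝ) ≤ (s k : ℝ) ^ 3 := le_self_pow₀ hs1 (by norm_num)
    unfold bandwidthRate
    gcongr
  simpa [etaRate] using h3.max h2

/-! ### The exceptional probability at the chosen parameters -/

lemma natCast_le_exp_log {N d A : ℕ} (hN : 1 ≤ N) (hd : d ≤ N ^ A) :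
    (d : ℝ) ≤ Real.exp (A * Real.log N) := by
  have h0 : (0 : ℝ) < N := by exact_mod_cast hN
  rw [Real.exp_nat_mul, Real.exp_log h0]
  exact_mod_cast hd

lemma one_div_eq_exp_neg_log {N : ℕ} (hN : 1 ≤ N) : 1 / (N : ℝ) = Real.exp (-Real.log N) := by
  have h0 : (0 : ℝ) < N := by exact_mod_cast hN
  rw [Real.exp_neg, Real.exp_log h0, one_div]

/-- One sparse coordinate of the grid costs at most `(A + 17) log N` in the exponent: `A` for its
position among `d ≤ N^A`, and `17` for its value and the leftover constants. -/
lemma card_sparseGrid_le_exp {N d A : ℕ} (hN : 2 ≤ N) (hd : d ≤ N ^ A) (k : ℕ) :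
    ((sparseGrid d (N ^ 15) k).card : ℝ) ≤ Real.exp ((A + 17) * k * Real.log N) := by
  have h1 : 1 + d * (2 * N ^ 15 + 1) ≤ N ^ (A + 17) := by
    have hA : 1 ≤ N ^ A := Nat.one_le_pow _ _ (by omega)
    have h15 : 1 ≤ N ^ 15 := Nat.one_le_pow _ _ (by omega)
    calc 1 + d * (2 * N ^ 15 + 1) ≤ N ^ A * N ^ 15 + N ^ A * (2 * N ^ 15 + N ^ 15) := by
          gcongr
          exact Nat.mul_pos hA h15
      _ = N ^ A * N ^ 15 * (2 * 2) := by ring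
      _ ≤ N ^ A * N ^ 15 * (N * N) := by gcongr
      _ = N ^ (A + 17) := by ring
  have h2 : (sparseGrid d (N ^ 15) k).card ≤ N ^ ((A + 17) * k) := by
    refine (card_sparseGrid_le d (N ^ 15) k).trans ((Nat.pow_le_pow_left h1 k).trans (le_of_eq ?_))
    rw [← pow_mul]
  have := natCast_le_exp_log (by omega) h2
  push_cast at this
  exact this

lemma score_tail_le {N d A : ℕ} (hN : 1 ≤ N) (hd : d ≤ N ^ A) {C κ : ℝ}
    (hκ : A + 1 ≤ κ ^ 2 / (4 * C)) :
    (d : ℝ) * (2 * Real.exp (-(N * ((κ * √(Real.log N / N)) ^ 2 / (4 * C))))) ≤ 2 * (1 / N) := by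
  have h0 : (0 : ℝ) < N := by exact_mod_cast hN
  have hl : 0 ≤ Real.log N := Real.log_natCast_nonneg _
  rw [one_div_eq_exp_neg_log hN, mul_pow, Real.sq_sqrt (by positivity)]
  have hexp : (N : ℝ) * (κ ^ 2 * (Real.log N / N) / (4 * C)) =
      κ ^ 2 / (4 * C) * Real.log N := by field_simp
  rw [hexp]
  calc (d : ℝ) * (2 * Real.exp (-(κ ^ 2 / (4 * C) * Real.log N)))
      ≤ Real.exp (A * Real.log N) * (2 * Real.exp (-((A + 1) * Real.log N))) := by
        gcongr
        exact natCast_le_exp_log hN hd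
    _ = 2 * (Real.exp (A * Real.log N) * Real.exp (-((A + 1) * Real.log N))) := by ring
    _ = _ := by rw [← Real.exp_add]; ring_nf

/-- At deviation level `√(log N / N)` and variance proxy `D` the exponent is `log N / (4 D)`, so the
union bound over a grid of sparsity `k` needs `k D` to be small. -/
lemma indicator_tail_le {N d A k : ℕ} (hN : 2 ≤ N) (hd : d ≤ N ^ A) {D : ℝ} (hD : 0 < D)
    (hsmall : (A + (A + 17) * k + 1) * (4 * D) ≤ 1) :
    (d : ℝ) * ((sparseGrid d (N ^ 15) k).card *
      (2 * Real.exp (-(N * (√(Real.log N / N) ^ 2 / (4 * D)))))) ≤ 2 * (1 / N) := by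
  have hN1 : 1 ≤ N := by omega
  have h0 : (0 : ℝ) < N := by exact_mod_cast hN1
  have hl : 0 ≤ Real.log N := Real.log_natCast_nonneg _
  rw [one_div_eq_exp_neg_log hN1, Real.sq_sqrt (by positivity)]
  have hexp : (N : ℝ) * (Real.log N / N / (4 * D)) = 1 / (4 * D) * Real.log N := by field_simp
  rw [hexp]
  have hle : (A + (A + 17) * k + 1 : ℝ) ≤ 1 / (4 * D) := by
    rw [le_div_iff₀ (by positivity)]; exact hsmall
  calc (d : ℝ) * ((sparseGrid d (N ^ 15) k).card *
        (2 * Real.exp (-(1 / (4 * D) * Real.log N))))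
      ≤ Real.exp (A * Real.log N) * (Real.exp ((A + 17) * k * Real.log N) *
        (2 * Real.exp (-((A + (A + 17) * k + 1) * Real.log N)))) := by
        gcongr
        · exact natCast_le_exp_log hN1 hd
        · exact card_sparseGrid_le_exp hN hd k
    _ = 2 * (Real.exp (A * Real.log N) * Real.exp ((A + 17) * k * Real.log N) *
        Real.exp (-((A + (A + 17) * k + 1) * Real.log N))) := by ring
    _ = _ := by rw [← Real.exp_add, ← Real.exp_add]; ring_nf

/-- The two directions of the local Hessian cost `2 (A + 17) L s log N`, which a large multiple `κ` of
`η` as the deviation level outweighs because `n b η² ≥ c₄ s log N`. -/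
lemma kernel_tail_le {N n d A L s : ℕ} (hN : 2 ≤ N) (hd : d ≤ N ^ A) (hs : 1 ≤ s)
    {b η κ C c₄ : ℝ} (hC : 0 < C) (hnb : c₄ * (s * Real.log N) ≤ n * (b * η ^ 2))
    (hκ : 2 * ((A + 17) * L) + 1 ≤ κ ^ 2 * c₄ / (4 * C)) :
    ((sparseGrid d (N ^ 15) (L * s)).card : ℝ) * ((sparseGrid d (N ^ 15) (L * s)).card *
      (2 * Real.exp (-(n * (b * (κ * η) ^ 2 / (4 * C)))))) ≤ 2 * (1 / N) := by
  have hN1 : 1 ≤ N := by omega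
  have hl : 0 ≤ Real.log N := Real.log_natCast_nonneg _
  have hs1 : (1 : ℝ) ≤ s := by exact_mod_cast hs
  rw [one_div_eq_exp_neg_log hN1]
  have hcard := card_sparseGrid_le_exp hN hd (L * s)
  have hle : (2 * ((A + 17) * L) + 1) * (s * Real.log N) ≤
      n * (b * (κ * η) ^ 2 / (4 * C)) := by
    calc (2 * ((A + 17) * L) + 1) * (s * Real.log N)
        ≤ κ ^ 2 * c₄ / (4 * C) * (s * Real.log N) := by gcongr
      _ = κ ^ 2 / (4 * C) * (c₄ * (s * Real.log N)) := by ring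
      _ ≤ κ ^ 2 / (4 * C) * (n * (b * η ^ 2)) := by gcongr
      _ = _ := by ring
  calc _ ≤ Real.exp ((A + 17) * (L * s : ℕ) * Real.log N) *
        (Real.exp ((A + 17) * (L * s : ℕ) * Real.log N) *
        (2 * Real.exp (-((2 * ((A + 17) * L) + 1) * (s * Real.log N))))) := by
        gcongr
    _ = 2 * (Real.exp ((A + 17) * (L * s : ℕ) * Real.log N) *
        Real.exp ((A + 17) * (L * s : ℕ) * Real.log N) *
        Real.exp (-((2 * ((A + 17) * L) + 1) * (s * Real.log N)))) := by ring
    _ = 2 * Real.exp (-(s * Real.log N)) := by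
        rw [← Real.exp_add, ← Real.exp_add]; push_cast; ring_nf
    _ ≤ _ := by
        gcongr
        exact le_mul_of_one_le_left hl hs1

/-- Covariates larger than `N` are so unlikely that any power of `N` is absorbed. -/
lemma eventually_covariate_tail_le (A : ℕ) (G : ℝ) {σ : ℝ} (hσ : 0 < σ) :
    ∀ᶠ N : ℕ in atTop, ∀ d : ℕ, d ≤ N ^ A → 0 ≤ G →
      (N : ℝ) * (d * (G * Real.exp (-(σ * (N : ℝ) ^ 2)))) ≤ 1 / N := by
  have hlim : Tendsto (fun N : ℕ => G * ((N : ℝ) ^ ((A + 2 : ℕ) : ℝ) * Real.exp (-σ * N)))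
      atTop (𝓝 0) := by
    simpa using ((tendsto_rpow_mul_exp_neg_mul_atTop_nhds_zero ((A + 2 : ℕ) : ℝ) σ hσ).comp
      tendsto_natCast_atTop_atTop).const_mul G
  filter_upwards [hlim.eventually (ge_mem_nhds one_pos), eventually_ge_atTop 1] with N h1 hN d hd hG
  have hN1 : (1 : ℝ) ≤ N := by exact_mod_cast hN
  have h0 : (0 : ℝ) < N := by linarith
  rw [Real.rpow_natCast] at h1
  have hd' : (d : ℝ) ≤ (N : ℝ) ^ A := by exact_mod_cast hd
  rw [le_div_iff₀ h0]
  calc (N : ℝ) * (d * (G * Real.exp (-(σ * (N : ℝ) ^ 2)))) * N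
      ≤ N * (N ^ A * (G * Real.exp (-σ * N))) * N := by
        gcongr
        have : (N : ℝ) ≤ (N : ℝ) ^ 2 := le_self_pow₀ hN1 (by norm_num)
        nlinarith
    _ = G * ((N : ℝ) ^ (A + 2) * Real.exp (-σ * N)) := by ring
    _ ≤ 1 := h1

/-! ### The finite-sample bound at the chosen parameters -/

/-- With sparsity `L s ≤ N²` and grid spacing `N⁻¹⁵`, the rounding error of a sparse vector,
multiplied by the bound `N` on the covariates, is at most `N⁻¹²`. -/
lemma grid_ratio_le {N L s : ℕ} (hN : 1 ≤ N) (hL : L ≤ N) (hs : s ≤ N) :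
    (N : ℝ) * ((L * s : ℕ) / (N ^ 15 : ℕ)) ≤ 1 / (N : ℝ) ^ 12 := by
  have h0 : (0 : ℝ) < N := by exact_mod_cast hN
  have h : ((L * s : ℕ) : ℝ) ≤ (N : ℝ) ^ 2 := by
    rw [pow_two]; exact_mod_cast Nat.mul_le_mul hL hs
  calc (N : ℝ) * ((L * s : ℕ) / (N ^ 15 : ℕ)) ≤ N * (N ^ 2 / (N ^ 15 : ℕ)) := by gcongr
    _ = _ := by push_cast; field_simp

/-- The rounding error in the local Hessian is negligible, since `b` is at least of order `1 / N`. -/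
lemma grid_error_le {N L s : ℕ} (hN : 1 ≤ N) (hL : L ≤ N) (hs : s ≤ N) {B b c hi η : ℝ}
    (hB : 0 < B) (hc : 0 < c) (hb : c * (1 / N) ≤ b) (hη : 1 / (N : ℝ) ≤ η)
    (hNB : 12 * B / c ^ 2 ≤ N) (hNhi : 6 * hi ≤ N) :
    3 * B * ((N : ℝ) * ((L * s : ℕ) + 1)) ^ 2 * ((N : ℝ) * ((L * s : ℕ) / (N ^ 15 : ℕ))) / b ^ 2 +
      6 * hi * ((L * s : ℕ) / (N ^ 15 : ℕ)) ≤ 2 * η := by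
  have h0 : (0 : ℝ) < N := by exact_mod_cast hN
  have hN1 : (1 : ℝ) ≤ N := by exact_mod_cast hN
  have hr := grid_ratio_le hN hL hs
  have hk : ((L * s : ℕ) : ℝ) + 1 ≤ 2 * (N : ℝ) ^ 2 := by
    have : ((L * s : ℕ) : ℝ) ≤ (N : ℝ) ^ 2 := by
      rw [pow_two]; exact_mod_cast Nat.mul_le_mul hL hs
    have : (1 : ℝ) ≤ (N : ℝ) ^ 2 := one_le_pow₀ hN1
    linarith
  have h1 : 3 * B * ((N : ℝ) * ((L * s : ℕ) + 1)) ^ 2 *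
      ((N : ℝ) * ((L * s : ℕ) / (N ^ 15 : ℕ))) / b ^ 2 ≤ 1 / N := by
    calc _ ≤ 3 * B * ((N : ℝ) * (2 * (N : ℝ) ^ 2)) ^ 2 * (1 / (N : ℝ) ^ 12) /
          (c * (1 / N)) ^ 2 := by gcongr
      _ = 12 * B / c ^ 2 * (1 / (N : ℝ) ^ 4) := by field_simp; ring
      _ ≤ N * (1 / (N : ℝ) ^ 4) := by gcongr
      _ = 1 / (N : ℝ) ^ 3 := by field_simp
      _ ≤ _ := one_div_le_one_div_of_le h0 (le_self_pow₀ hN1 (by norm_num))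
  have h2 : 6 * hi * (((L * s : ℕ) : ℝ) / (N ^ 15 : ℕ)) ≤ 1 / N := by
    have hle : ((L * s : ℕ) : ℝ) / (N ^ 15 : ℕ) ≤ 1 / (N : ℝ) ^ 12 * (1 / N) := by
      rw [mul_one_div, le_div_iff₀ h0, mul_comm]; exact hr
    calc _ ≤ N * (1 / (N : ℝ) ^ 12 * (1 / N)) := by gcongr
      _ = 1 / (N : ℝ) ^ 12 := by field_simp
      _ ≤ _ := one_div_le_one_div_of_le h0 (le_self_pow₀ hN1 (by norm_num))
  linarith

lemma OneStepWithin.mono {p m n : ℕ} {K : ℝ → ℝ} {τ h b lam : ℝ} {β₀ : Fin (p + 1) → ℝ}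
    {x : Fin (m * n) → Fin (p + 1) → ℝ} {y : Fin (m * n) → ℝ} {βs : Fin (p + 1) → ℝ} {r r' : ℝ}
    (h₁ : OneStepWithin K τ h b lam β₀ x y βs r) (hr : r ≤ r') :
    OneStepWithin K τ h b lam β₀ x y βs r' :=
  ⟨h₁.1, fun β hβ => (h₁.2 β hβ).trans hr⟩

lemma sqrt_mul_penaltyLevel (C a : ℝ) (s N n : ℕ) :
    √(s : ℝ) * penaltyLevel C a s N n = C * oneStepRate a s N n := by
  have h : √(s : ℝ) * √(Real.log N / N) = √(s * Real.log N / N) := by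
    rw [← Real.sqrt_mul (Nat.cast_nonneg s), mul_div_assoc]
  rw [penaltyLevel, oneStepRate, ← h]
  ring

lemma radius_le {s : ℕ} (hs : 1 ≤ s) {lo C a : ℝ} (hlo : 0 < lo) {N n : ℕ}
    (hpen : 0 ≤ penaltyLevel C a s N n) :
    3 * √((s + 1 : ℕ) : ℝ) * penaltyLevel C a s N n / (lo / 2) ≤
      12 * C / lo * oneStepRate a s N n := by
  have h1 : √((s + 1 : ℕ) : ℝ) ≤ 2 * √(s : ℝ) := by
    refine Real.sqrt_le_iff.2 ⟨by positivity, ?_⟩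
    rw [mul_pow, Real.sq_sqrt (Nat.cast_nonneg s)]
    have : (1 : ℝ) ≤ s := by exact_mod_cast hs
    push_cast
    linarith
  calc 3 * √((s + 1 : ℕ) : ℝ) * penaltyLevel C a s N n / (lo / 2)
      ≤ 3 * (2 * √(s : ℝ)) * penaltyLevel C a s N n / (lo / 2) := by gcongr
    _ = 12 / lo * (√(s : ℝ) * penaltyLevel C a s N n) := by field_simp; ring
    _ = _ := by rw [sqrt_mul_penaltyLevel]; ring

lemma add_two_le_mul {L s : ℕ} (hL : 3 ≤ L) (hs : 1 ≤ s) : s + 2 ≤ L * s := by nlinarith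

/-- The factor `256` leaves room for the intercept (`s + 1 ≤ 2 s`) and for `L s - 1 ≥ L s / 2` next to
the `64` of `quadratic_lower_on_cone`. -/
lemma sparsity_condition {L s : ℕ} (hL : 3 ≤ L) (hs : 1 ≤ s) {lo hi : ℝ} (hlo : 0 ≤ lo)
    (hhi : 0 ≤ hi) (hLlo : 256 * hi < lo * L) :
    64 * ((s + 1 : ℕ) : ℝ) * hi < lo * ((L * s : ℕ) - 1) := by
  have hs' : (1 : ℝ) ≤ s := by exact_mod_cast hs
  have hLs : (2 : ℝ) ≤ L * s := by exact_mod_cast (by have := add_two_le_mul hL hs; omega)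
  push_cast
  have e₁ : 256 * hi * s < lo * L * s := mul_lt_mul_of_pos_right hLlo (by linarith)
  have e₂ : 0 ≤ hi * (s - 1) := mul_nonneg hhi (by linarith)
  have e₃ : 0 ≤ lo * (L * s - 2) := mul_nonneg hlo (by linarith)
  linarith

/-- The finite-sample bound with covariate bound `N`, grid spacing `N⁻¹⁵`, sparsity `L s`, and
deviation levels of orders `√(log N / N)` (twice) and `η`. All hypotheses on the size of the rates
hold for large `N`. -/
lemma measure_not_oneStepWithin_le_div {Ω : Type*} [MeasurableSpace Ω] {P : Measure Ω}
    {p m n s : ℕ} {ν : Measure ((Fin (p + 1) → ℝ) × ℝ)} {βs : Fin (p + 1) → ℝ}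
    {f : (Fin (p + 1) → ℝ) → ℝ → ℝ} {X : Fin (m * n) → Ω → Fin (p + 1) → ℝ}
    {Y : Fin (m * n) → Ω → ℝ} (hsample : IsIIDSample P ν X Y)
    {f₂ l₀ σ G τ : ℝ} (hQ : IsErrorLaw (ν.map (toError βs)) ν.fst f f₂ l₀ σ G)
    (hτ : 0 < τ) (hτ1 : τ < 1) (hq : ∀ᵐ x ∂ν.fst, ∫ u in Set.Iic 0, f x u = τ)
    (hs : s = (slopeSupport βs).card)
    {A : Matrix (Fin (p + 1)) (Fin (p + 1)) ℝ} (hA : A.IsSymm) {lo hi : ℝ} (hlo : 0 < lo)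
    (hA0 : ∀ v, lo * l2norm v ^ 2 ≤ v ⬝ᵥ A *ᵥ v ∧ v ⬝ᵥ A *ᵥ v ≤ hi * l2norm v ^ 2)
    (hhi : 0 ≤ hi)
    (hAint : ∀ v u, v ⬝ᵥ A *ᵥ u = ∫ x, f x 0 * ((x ⬝ᵥ v) * (x ⬝ᵥ u)) ∂ν.fst)
    {K : ℝ → ℝ} (hK : IsSmoothingKernel K) {C₁ C₂ C₃ c₃ B : ℝ}
    (hdev : DeviationConstants K f₂ l₀ σ G C₁ C₂ C₃ c₃ B)
    (hm : 1 ≤ m) (hn : 3 ≤ n) (hs1 : 1 ≤ s) (hsn : s ≤ n)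
    {D L : ℕ} (hL : 3 ≤ L) (hLN : L ≤ m * n) (hLlo : 256 * hi < lo * L)
    (hd : p + 1 ≤ (m * n) ^ D)
    {c ca Ca cb Cb M κ₁ κ θ a b h C : ℝ} (hca : 0 < ca) (hCa : 0 < Ca) (hcb : 0 < cb)
    (hM : 1 ≤ M) (hM₂ : 1 ≤ M * (2 * C₂ * ca)) (hκ₁0 : 0 ≤ κ₁) (hκ0 : 0 ≤ κ)
    (hκ₁ : D + 1 ≤ κ₁ ^ 2 / (4 * C₁))
    (hκ : 2 * ((D + 17) * L) + 1 ≤ κ ^ 2 * (cb * c) / (4 * C₃))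
    (hθ : κ + C₃ * (M * Ca + Cb) + 2 ≤ θ)
    (hlog : c * Real.log (m * n : ℕ) ≤ Real.log n)
    (ha : ca * initialRate s (m * n) n ≤ a ∧ a ≤ Ca * initialRate s (m * n) n)
    (hb : cb * bandwidthRate s n ≤ b ∧ b ≤ Cb * bandwidthRate s n) (hCb : 0 < Cb)
    (hC₁ : 2 * (κ₁ + 2 + 2 * (4 * G * ((1 + 1 / (σ / 2)) * (f₂ * (1 + 1 / (σ / 2)))))) ≤ C)
    (hC₂ : 2 * (2 * (C₂ * M ^ 2 * Ca) + M * θ) ≤ C)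
    (h₁ : M * (Ca * initialRate s (m * n) n) ≤ 1)
    (h₂ : κ₁ * initialRate s (m * n) n ≤ 2 * C₁)
    (h₃ : κ * etaRate s (m * n) n ≤ 2 * C₃ * c₃) (h₄ : Cb * etaRate s (m * n) n ≤ 1)
    (h₅ : θ * etaRate s (m * n) n ≤ lo / 4)
    (h₆ : (D + (D + 17) * L + 1) * (4 * (C₂ * (M * Ca))) * (s * initialRate s (m * n) n) ≤ 1)
    (h₇ : 12 * B / cb ^ 2 ≤ (m * n : ℕ)) (h₈ : 6 * hi ≤ (m * n : ℕ))
    (h₉ : ((m * n : ℕ) : ℝ) * ((p + 1 : ℕ) * (G * Real.exp (-(σ * ((m * n : ℕ) : ℝ) ^ 2)))) ≤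
      1 / (m * n : ℕ))
    (βinit : Ω → Fin (p + 1) → ℝ) :
    P {ω | slopeSupport (βinit ω) ⊆ slopeSupport βs ∧ l2norm (βinit ω - βs) ≤ M * a ∧
        ¬ OneStepWithin K τ h b (penaltyLevel C a s (m * n) n) (βinit ω) (fun i => X i ω)
          (fun i => Y i ω) βs (12 * C / lo * oneStepRate a s (m * n) n)} ≤
      ENNReal.ofReal (13 * (1 / (m * n : ℕ))) := by
  have hG := hQ.one_le_G
  have hσ := hQ.σ_pos
  have hf₂ := hQ.f₂_nonneg
  have hnN : n ≤ m * n := Nat.le_mul_of_pos_left n hm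
  obtain ⟨hN3, hsN⟩ : 3 ≤ m * n ∧ s ≤ m * n := ⟨hn.trans hnN, hsn.trans hnN⟩
  have hN1 : 1 ≤ m * n := by omega
  obtain ⟨r₁, r₂, r₃⟩ := rate_bounds hn hnN hs1
  have hbη : bandwidthRate s n ≤ etaRate s (m * n) n := le_max_left _ _
  have hiη : initialRate s (m * n) n ≤ etaRate s (m * n) n := le_max_right _ _
  set N : ℝ := ((m * n : ℕ) : ℝ) with hN
  set ρ := √(Real.log N / N)
  set i := initialRate s (m * n) n
  set w := bandwidthRate s n
  set η := etaRate s (m * n) n with hη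
  set G₂ := 4 * G * ((1 + 1 / (σ / 2)) * (f₂ * (1 + 1 / (σ / 2)))) with hG₂
  have hN0 : 1 ≤ N := Nat.one_le_cast.2 hN1
  have hNpos : 0 < N := by linarith
  have hρ0 : 0 < ρ := lt_of_lt_of_le (by positivity) r₂
  have hi0 : 0 < i := hρ0.trans_le r₃
  have hw0 : 0 < w := lt_of_lt_of_le (by positivity) r₁
  have hη0 : 0 < η := hw0.trans_le hbη
  have ha0 : 0 < a := lt_of_lt_of_le (mul_pos hca hi0) ha.1
  have hb0 : 0 < b := lt_of_lt_of_le (mul_pos hcb hw0) hb.1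
  have hM0 : 0 < M := by linarith
  have hC₁0 := hdev.pos₁
  have hC₂0 := hdev.pos₂
  have hC₃0 := hdev.pos₃
  have hMa0 : 0 < M * a := mul_pos hM0 ha0
  have hMa : M * a ≤ M * (Ca * i) := mul_le_mul_of_nonneg_left ha.2 hM0.le
  have hMa1 : M * a ≤ 1 := hMa.trans h₁
  have hb1 : b ≤ 1 := hb.2.trans ((mul_le_mul_of_nonneg_left hbη hCb.le).trans h₄)
  have hG2 : 0 ≤ G₂ := by positivity
  have hCpos : 0 < C := by linarith
  have hs1' : (1 : ℝ) ≤ s := by exact_mod_cast hs1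
  have hL' : (3 : ℝ) ≤ L := by exact_mod_cast hL
  have hratio := grid_ratio_le (L := L) hN1 hLN hsN
  rw [← hN] at hratio
  have hpow : 1 / N ^ 12 ≤ 1 / N := one_div_le_one_div_of_le hNpos (le_self_pow₀ hN0 (by norm_num))
  have hpenpos : 0 < penaltyLevel C a s (m * n) n :=
    mul_pos hCpos (add_pos_of_pos_of_nonneg hρ0 (mul_nonneg ha0.le hη0.le))
  have hgrid := grid_error_le (L := L) hN1 hLN hsN hdev.pos_B hcb
    ((mul_le_mul_of_nonneg_left r₁ hcb.le).trans hb.1) (r₁.trans hbη) h₇ h₈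
  rw [← hN] at hgrid
  have hkq : L * s ≤ (m * n) ^ 15 :=
    (Nat.mul_le_mul hLN hsN).trans (by
      rw [← pow_two]; exact Nat.pow_le_pow_right hN1 (by norm_num))
  have hr1 : N * ((L * s : ℕ) / ((m * n) ^ 15 : ℕ)) ≤ 1 :=
    (hratio.trans hpow).trans ((div_le_one hNpos).2 hN0)
  have hk := sparsity_condition hL hs1 hlo.le hhi hLlo
  -- the deviation level stays in the Gaussian regime because `a` is at least of order `√(log N / N)`
  have hx₂ : ρ ≤ 2 * C₂ * (M * a) := by
    calc ρ ≤ i := r₃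
      _ ≤ M * (2 * C₂ * ca) * i := le_mul_of_one_le_left hi0.le hM₂
      _ = 2 * C₂ * M * (ca * i) := by ring
      _ ≤ 2 * C₂ * M * a := mul_le_mul_of_nonneg_left ha.1 (by positivity)
      _ = _ := by ring
  have hθ' : κ * η + C₃ * (M * a + b) +
      (3 * B * (N * ((L * s : ℕ) + 1)) ^ 2 * (N * ((L * s : ℕ) / ((m * n) ^ 15 : ℕ))) / b ^ 2 +
        6 * hi * ((L * s : ℕ) / ((m * n) ^ 15 : ℕ))) ≤ θ * η := by
    have e₁ : M * a ≤ M * Ca * η := by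
      refine hMa.trans ?_
      rw [mul_assoc]
      gcongr
    have e₂ : b ≤ Cb * η := hb.2.trans (mul_le_mul_of_nonneg_left hbη hCb.le)
    calc _ ≤ κ * η + C₃ * (M * Ca * η + Cb * η) + 2 * η := by gcongr
      _ = (κ + C₃ * (M * Ca + Cb) + 2) * η := by ring
      _ ≤ _ := mul_le_mul_of_nonneg_right hθ hη0.le
  -- gradient terms of order `ρ = √(log N / N)` and of order `a η` are matched separately
  have hpen : κ₁ * ρ + 2 * (ρ + C₂ * (M * a) ^ 2 + G₂ * (M * a *
      (N * ((L * s : ℕ) / ((m * n) ^ 15 : ℕ))))) + M * a * (θ * η) ≤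
        penaltyLevel C a s (m * n) n / 2 := by
    have e₁ : M * a * (N * ((L * s : ℕ) / ((m * n) ^ 15 : ℕ))) ≤ ρ := by
      calc M * a * (N * ((L * s : ℕ) / ((m * n) ^ 15 : ℕ)))
          ≤ 1 * (N * ((L * s : ℕ) / ((m * n) ^ 15 : ℕ))) := by gcongr
        _ ≤ ρ := by rw [one_mul]; exact (hratio.trans hpow).trans r₂
    have e₂ : C₂ * (M * a) ^ 2 ≤ C₂ * M ^ 2 * Ca * (a * η) := by
      calc C₂ * (M * a) ^ 2 = C₂ * M ^ 2 * a * a := by ring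
        _ ≤ C₂ * M ^ 2 * a * (Ca * η) := by
          gcongr
          exact ha.2.trans (mul_le_mul_of_nonneg_left hiη hCa.le)
        _ = _ := by ring
    calc _ ≤ κ₁ * ρ + 2 * (ρ + C₂ * M ^ 2 * Ca * (a * η) + G₂ * ρ) + M * a * (θ * η) := by gcongr
      _ = (κ₁ + 2 + 2 * G₂) * ρ + (2 * (C₂ * M ^ 2 * Ca) + M * θ) * (a * η) := by ring
      _ ≤ C / 2 * ρ + C / 2 * (a * η) := by
          gcongr
          · linarith
          · linarith
      _ = penaltyLevel C a s (m * n) n / 2 := by rw [penaltyLevel]; ring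
  have key := measure_not_oneStepWithin_le hsample hQ hτ hτ1 hq hs hA hlo (fun v => (hA0 v).1)
    (fun v => (hA0 v).2) hhi hAint hK hdev hm (by omega : 1 ≤ n) (h := h) hMa0 hMa1 hb0 hb1 hN0 hkq
    hr1 (add_two_le_mul hL hs1) hk (by positivity : 0 ≤ κ₁ * ρ)
    ((mul_le_mul_of_nonneg_left r₃ hκ₁0).trans h₂) hρ0.le hx₂ (by positivity : 0 ≤ κ * η) h₃ hθ'
    h₅ hpenpos hpen βinit
  refine (measure_mono ?_).trans (key.trans (ENNReal.ofReal_le_ofReal ?_))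
  · rintro ω ⟨w₁, w₂, w₃⟩
    exact ⟨w₁, w₂, fun hw => w₃ (hw.mono (radius_le hs1 hlo hpenpos.le))⟩
  · have t₁ := score_tail_le hN1 hd hκ₁
    have t₂ := indicator_tail_le (k := L * s) (by omega) hd (mul_pos hC₂0 hMa0) (by
      refine le_trans ?_ h₆
      push_cast
      calc (D + (D + 17) * (L * s) + 1 : ℝ) * (4 * (C₂ * (M * a)))
          ≤ ((D + (D + 17) * L + 1) * s) * (4 * (C₂ * (M * (Ca * i)))) := by
            gcongr
            linarith [mul_le_mul_of_nonneg_left hs1' (by positivity : (0 : ℝ) ≤ D + 1)]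
        _ = _ := by ring)
    have t₃ := kernel_tail_le (n := n) (L := L) (b := b) (η := η) (c₄ := cb * c) (by omega) hd hs1
      hC₃0 ?_ hκ
    · linarith
    -- `n b η² ≥ c_b n w³ = c_b s log n`, where `w` is the bandwidth rate
    · have hw3 : w ^ 3 = s * Real.log n / n := bandwidthRate_pow_three s n
      have hn0 : (0 : ℝ) < n := by exact_mod_cast (by omega : 0 < n)
      calc cb * c * (s * Real.log N) = cb * s * (c * Real.log N) := by ring
        _ ≤ cb * s * Real.log n := by gcongr
        _ = n * (cb * w ^ 3) := by rw [hw3]; field_simp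
        _ = n * (cb * w * w ^ 2) := by ring
        _ ≤ n * (b * η ^ 2) := by
          gcongr
          exact hb.1

/-! ### The limit along the sequence of problems -/

lemma exists_eventually_le_pow {N p : ℕ → ℕ} (hN : Tendsto N atTop atTop) {g : ℝ} (hg : 0 < g)
    (hp : (fun k => (p k : ℝ)) =O[atTop] fun k => (N k : ℝ) ^ g) :
    ∃ D : ℕ, ∀ᶠ k in atTop, p k + 1 ≤ N k ^ D := by
  obtain ⟨C, hC⟩ := hp.bound
  refine ⟨⌈g⌉₊ + 1, ?_⟩
  filter_upwards [hC, hN.eventually_ge_atTop (max 1 ⌈C + 1⌉₊)] with k hk hNk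
  have hN1 : (1 : ℝ) ≤ N k := by exact_mod_cast (le_max_left _ _).trans hNk
  have hNC : C + 1 ≤ N k := (Nat.le_ceil _).trans (by exact_mod_cast (le_max_right _ _).trans hNk)
  have hk' : (p k : ℝ) ≤ C * (N k : ℝ) ^ g := by
    simpa [Real.norm_of_nonneg (Real.rpow_nonneg (zero_le_one.trans hN1) g)] using hk
  have h1 : 1 ≤ (N k : ℝ) ^ g := Real.one_le_rpow hN1 hg.le
  have h2 : (N k : ℝ) ^ g ≤ (N k : ℝ) ^ ⌈g⌉₊ := by
    rw [← Real.rpow_natCast]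
    exact Real.rpow_le_rpow_of_exponent_le hN1 (Nat.le_ceil g)
  have : (p k : ℝ) + 1 ≤ (N k : ℝ) ^ (⌈g⌉₊ + 1) := by
    calc (p k : ℝ) + 1 ≤ (C + 1) * (N k : ℝ) ^ g := by linarith
      _ ≤ N k * (N k : ℝ) ^ ⌈g⌉₊ := by gcongr
      _ = _ := by ring
  exact_mod_cast this

lemma tendsto_of_rpow_le {N n : ℕ → ℕ} (hN : Tendsto N atTop atTop) {c : ℝ} (hc : 0 < c)
    (hn : ∀ᶠ k in atTop, (N k : ℝ) ^ c ≤ (n k : ℝ)) :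
    Tendsto n atTop atTop ∧ ∀ᶠ k in atTop, c * Real.log (N k) ≤ Real.log (n k) := by
  refine ⟨tendsto_natCast_atTop_iff.1 (tendsto_atTop_mono' _ hn
    ((tendsto_rpow_atTop hc).comp (tendsto_natCast_atTop_atTop.comp hN))), ?_⟩
  filter_upwards [hn, hN.eventually_ge_atTop 1] with k hk hNk
  have h0 : (0 : ℝ) < N k := by exact_mod_cast hNk
  rw [← Real.log_rpow h0]
  exact Real.log_le_log (Real.rpow_pos_of_pos h0 c) hk

lemma eventually_const_mul_le {u : ℕ → ℝ} (hu : Tendsto u atTop (𝓝 0)) (C : ℝ) {x : ℝ}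
    (hx : 0 < x) : ∀ᶠ k in atTop, C * u k ≤ x := by
  have : Tendsto (fun k => C * u k) atTop (𝓝 0) := by simpa using hu.const_mul C
  exact this.eventually (ge_mem_nhds hx)

/-- For each bound `M a` on the initial error there is one constant `C₀` for which the one-step
estimator fails, while the initial estimator obeys the bound, with probability tending to zero. -/
theorem eventually_measure_not_oneStepWithin_le
    {Ω : ℕ → Type*} [∀ k, MeasurableSpace (Ω k)] {P : ∀ k, Measure (Ω k)}
    {τ : ℝ} (hτ : 0 < τ ∧ τ < 1) {m n p s : ℕ → ℕ}
    {ν : ∀ k, Measure ((Fin (p k + 1) → ℝ) × ℝ)} {βstar : ∀ k, Fin (p k + 1) → ℝ}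
    {f : ∀ k, (Fin (p k + 1) → ℝ) → ℝ → ℝ} {X : ∀ k, Fin (m k * n k) → Ω k → Fin (p k + 1) → ℝ}
    {Y : ∀ k, Fin (m k * n k) → Ω k → ℝ}
    (hmodel : ∀ k, IsLinearQuantileModel τ (ν k) (βstar k) (f k))
    (hsample : ∀ k, IsIIDSample (P k) (ν k) (X k) (Y k))
    (hN : Tendsto (fun k => m k * n k) atTop atTop)
    (hs : ∀ k, s k = (slopeSupport (βstar k)).card) (hs_pos : ∀ k, 1 ≤ s k)
    {K : ℝ → ℝ} (hK : IsSmoothingKernel K)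
    {f₁ f₂ l₀ : ℝ} (hf₁ : 0 < f₁) (hf₁₂ : f₁ ≤ f₂)
    (hdens : ∀ k, CondDensityRegular (ν k) (f k) f₁ f₂ l₀)
    {c₁ : ℝ} (hc₁ : 0 < c₁) (hsub : ∀ k, SubGaussianCovariates (ν k) c₁)
    {lamLo lamHi : ℝ} (hlamLo : 0 < lamLo) (hlamHi : 0 < lamHi)
    (heig : ∀ k, EigenvaluesIn (populationHessian (ν k) (f k)) lamLo lamHi)
    {growthP : ℝ} (hgrowthP : 0 < growthP)
    (hp : (fun k => (p k : ℝ)) =O[atTop] fun k => ((m k * n k : ℕ) : ℝ) ^ growthP)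
    {c : ℝ} (hc : 0 < c) (hn : ∀ᶠ k in atTop, ((m k * n k : ℕ) : ℝ) ^ c ≤ (n k : ℝ))
    {r : ℝ} (hr : r < 1 / 3) (hsn : (fun k => (s k : ℝ)) =O[atTop] fun k => (n k : ℝ) ^ r)
    {a : ℕ → ℝ} (ha : SameOrder a fun k => initialRate (s k) (m k * n k) (n k))
    {h b : ℕ → ℝ} (hb : SameOrder b fun k => bandwidthRate (s k) (n k))
    (βinit : ∀ k, Ω k → Fin (p k + 1) → ℝ) (M : ℝ) :
    ∃ C₀ > 0, ∀ C ≥ C₀, ∃ M' : ℝ, ∀ ε > 0, ∀ᶠ k in atTop,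
      P k {ω | slopeSupport (βinit k ω) ⊆ slopeSupport (βstar k) ∧
          l2norm (βinit k ω - βstar k) ≤ M * a k ∧
          ¬ OneStepWithin K τ (h k) (b k) (penaltyLevel C (a k) (s k) (m k * n k) (n k))
            (βinit k ω) (fun i => X k i ω) (fun i => Y k i ω) (βstar k)
            (M' * oneStepRate (a k) (s k) (m k * n k) (n k))} ≤ ENNReal.ofReal ε := by
  obtain ⟨G, hG, hGprop⟩ := exists_lintegral_exp_sq_le
  set σ := f₁ / (16 * c₁ ^ 2 * lamHi) with hσ
  have hσ0 : 0 < σ := by positivity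
  have hf₂ : 0 ≤ f₂ := hf₁.le.trans hf₁₂
  obtain ⟨C₁, C₂, C₃, c₃, B, hdev⟩ :=
    exists_deviationConstants hK f₂ (max l₀ 0) σ G hf₂ (le_max_right _ _) hσ0 hG
  have hC₁0 := hdev.pos₁
  have hC₂0 := hdev.pos₂
  have hC₃0 := hdev.pos₃
  have hc₃0 := hdev.pos_c
  obtain ⟨ca, hca, Ca, hCa, ha⟩ := ha
  obtain ⟨cb, hcb, Cb, hCb, hb⟩ := hb
  obtain ⟨D, hD⟩ := exists_eventually_le_pow hN hgrowthP hp
  obtain ⟨hn_top, hlog⟩ := tendsto_of_rpow_le hN hc hn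
  have hT := tendsto_cube_mul_log_div hn_top hr hsn
  obtain ⟨hsi, hη⟩ := tendsto_rates hc hs_pos hlog hT
  have hi : Tendsto (fun k => initialRate (s k) (m k * n k) (n k)) atTop (𝓝 0) :=
    squeeze_zero (fun k => Real.sqrt_nonneg _) (fun k => le_mul_of_one_le_left
      (Real.sqrt_nonneg _) (by exact_mod_cast hs_pos k)) hsi
  -- the sparsity factor `L`, the multiples `κ₁, κ` of the rates, and an enlarged `M`, for which
  -- `M a` is at least the deviation level `√(log N / N)` divided by `2 C₂`
  obtain ⟨L₀, hL₀⟩ := exists_nat_gt (256 * lamHi / lamLo)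
  set L := max 3 L₀ with hL
  have hLlo : 256 * lamHi < lamLo * L := by
    rw [div_lt_iff₀ hlamLo] at hL₀
    have : (L₀ : ℝ) ≤ L := by exact_mod_cast le_max_right 3 L₀
    nlinarith
  set κ₁ := √((D + 1) * (4 * C₁)) with hκ₁
  set κ := √((2 * ((D + 17) * L) + 1) * (4 * C₃) / (cb * c)) with hκ
  have hκ₁' : D + 1 ≤ κ₁ ^ 2 / (4 * C₁) := by
    rw [hκ₁, Real.sq_sqrt (by positivity)]
    exact le_of_eq (by field_simp)
  have hκ' : 2 * ((D + 17) * L) + 1 ≤ κ ^ 2 * (cb * c) / (4 * C₃) := by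
    rw [hκ, Real.sq_sqrt (by positivity)]
    exact le_of_eq (by field_simp)
  set M₁ := max M (max 1 (1 / (2 * C₂ * ca))) with hM₁
  have hM₁1 : 1 ≤ M₁ := (le_max_left _ _).trans (le_max_right _ _)
  have hM₁2 : 1 ≤ M₁ * (2 * C₂ * ca) := by
    rw [← div_le_iff₀ (by positivity)]
    exact (le_max_right _ _).trans (le_max_right _ _)
  set θ := κ + C₃ * (M₁ * Ca + Cb) + 2 with hθ
  set C₀ := max (2 * (κ₁ + 2 + 2 * (4 * G * ((1 + 1 / (σ / 2)) * (f₂ * (1 + 1 / (σ / 2)))))))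
    (2 * (2 * (C₂ * M₁ ^ 2 * Ca) + M₁ * θ)) with hC₀
  refine ⟨C₀, lt_of_lt_of_le (by positivity) (le_max_left _ _), fun C hC => ⟨12 * C / lamLo,
    fun ε hε => ?_⟩⟩
  have hNreal : Tendsto (fun k => ((m k * n k : ℕ) : ℝ)) atTop atTop :=
    tendsto_natCast_atTop_atTop.comp hN
  have hNinv : Tendsto (fun k => 1 / ((m k * n k : ℕ) : ℝ)) atTop (𝓝 0) := by
    simp only [one_div]
    exact tendsto_inv_atTop_zero.comp hNreal
  filter_upwards [ha, hb, hD, hlog, hn_top.eventually_ge_atTop 3, hN.eventually_ge_atTop (max 1 L),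
    hT.eventually (ge_mem_nhds one_pos), eventually_const_mul_le hi (M₁ * Ca) one_pos,
    eventually_const_mul_le hi κ₁ (by positivity : 0 < 2 * C₁),
    eventually_const_mul_le hη κ (by positivity : 0 < 2 * C₃ * c₃),
    eventually_const_mul_le hη Cb one_pos,
    eventually_const_mul_le hη θ (by positivity : 0 < lamLo / 4),
    eventually_const_mul_le hsi ((D + (D + 17) * L + 1) * (4 * (C₂ * (M₁ * Ca)))) one_pos,
    hNreal.eventually_ge_atTop (12 * B / cb ^ 2), hNreal.eventually_ge_atTop (6 * lamHi),
    hN.eventually (eventually_covariate_tail_le D G hσ0),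
    eventually_const_mul_le hNinv 13 hε] with k hak hbk hDk hlogk hn3 hNL hTk h₁ h₂ h₃ h₄ h₅ h₆ h₇
      h₈ h₉ hfin
  have hm : 1 ≤ m k := by
    by_contra hm0
    have : m k = 0 := by omega
    have h1 := (le_max_left _ _).trans hNL
    rw [this] at h1
    simp at h1
  have hsnk : s k ≤ n k := by
    have hn0 : (0 : ℝ) < n k := by exact_mod_cast (by omega : 0 < n k)
    have hs1 : (1 : ℝ) ≤ s k := by exact_mod_cast hs_pos k
    rw [div_le_one hn0] at hTk
    have hl := one_le_log_of_three_le hn3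
    have : (s k : ℝ) ≤ n k := by
      calc (s k : ℝ) ≤ (s k : ℝ) ^ 3 := le_self_pow₀ hs1 (by norm_num)
        _ ≤ (s k : ℝ) ^ 3 * Real.log (n k) := le_mul_of_one_le_right (by positivity) hl
        _ ≤ _ := hTk
    exact_mod_cast this
  obtain ⟨hQ, hq, hsymm, hquad, hint⟩ := (hmodel k).isErrorLaw_and_hessian hτ.1 hf₁ hf₁₂ (hdens k)
    hc₁ (hsub k) hlamLo hlamHi (heig k) hG hGprop
  have hak0 : 0 ≤ a k := (mul_nonneg hca.le (Real.sqrt_nonneg _)).trans hak.1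
  refine (measure_mono ?_).trans ((measure_not_oneStepWithin_le_div (hsample k) hQ hτ.1 hτ.2 hq
    (hs k) hsymm hlamLo hquad hlamHi.le hint hK hdev hm hn3 (hs_pos k) hsnk (le_max_left 3 L₀)
    ((le_max_right _ _).trans hNL) hLlo hDk hca hCa hcb hM₁1 hM₁2 (Real.sqrt_nonneg _)
    (Real.sqrt_nonneg _) hκ₁' hκ' le_rfl hlogk hak hbk hCb (h := h k)
    ((le_max_left _ _).trans hC) ((le_max_right _ _).trans hC) (by rw [← mul_assoc]; exact h₁) h₂
    h₃ h₄ h₅ h₆ h₇ h₈ (h₉ _ hDk (by linarith)) (βinit k)).trans (ENNReal.ofReal_le_ofReal hfin))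
  rintro ω ⟨w₁, w₂, w₃⟩
  exact ⟨w₁, w₂.trans (mul_le_mul_of_nonneg_right (le_max_left _ _) hak0), w₃⟩

lemma measurableSet_slopeSupport_subset {Ω : Type*} [MeasurableSpace Ω] {p : ℕ}
    {β : Ω → Fin (p + 1) → ℝ} (hβ : Measurable β) (S : Finset (Fin (p + 1))) :
    MeasurableSet {ω | slopeSupport (β ω) ⊆ S} := by
  have h : {ω | slopeSupport (β ω) ⊆ S} =
      ⋂ j ∈ {j : Fin (p + 1) | j ≠ 0 ∧ j ∉ S}, {ω | β ω j = 0} := by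
    ext ω
    simp only [slopeSupport, Finset.subset_iff, Finset.mem_filter, Finset.mem_univ, true_and,
      Set.mem_ofPred_eq, Set.mem_iInter, and_imp]
    refine forall_congr' fun j => ?_
    tauto
  rw [h]
  exact MeasurableSet.biInter (Set.to_countable _) fun j _ =>
    (measurable_pi_apply j).comp hβ (measurableSet_singleton 0)

lemma measurable_l2norm_sub {Ω : Type*} [MeasurableSpace Ω] {d : ℕ} {β : Ω → Fin d → ℝ}
    (hβ : Measurable β) (β₀ : Fin d → ℝ) : Measurable fun ω => l2norm (β ω - β₀) := by
  unfold l2norm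
  simp only [Pi.sub_apply]
  fun_prop

lemma eventually_measure_compl_le {Ω : ℕ → Type*} [∀ k, MeasurableSpace (Ω k)]
    {P : ∀ k, Measure (Ω k)} [∀ k, IsProbabilityMeasure (P k)] {E : ∀ k, Set (Ω k)}
    (hE : ∀ k, MeasurableSet (E k)) (hlim : Tendsto (fun k => P k (E k)) atTop (𝓝 1)) {ε : ℝ}
    (hε : 0 < ε) : ∀ᶠ k in atTop, P k (E k)ᶜ ≤ ENNReal.ofReal ε := by
  have h : Tendsto (fun k => P k (E k)ᶜ) atTop (𝓝 0) := by
    have := ENNReal.Tendsto.sub (tendsto_const_nhds (x := (1 : ℝ≥0∞))) hlim (Or.inl (by simp))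
    simp only [tsub_self] at this
    exact this.congr fun k => (prob_compl_eq_one_sub (hE k)).symm
  exact h.eventually (ge_mem_nhds (ENNReal.ofReal_pos.2 hε))

theorem theorem1
    {Ω : ℕ → Type*} [∀ k, MeasurableSpace (Ω k)]
    (P : ∀ k, Measure (Ω k)) [∀ k, IsProbabilityMeasure (P k)]
    (τ : ℝ) (hτ : 0 < τ ∧ τ < 1)
    (m n p s : ℕ → ℕ)
    (ν : ∀ k, Measure ((Fin (p k + 1) → ℝ) × ℝ))
    (βstar : ∀ k, Fin (p k + 1) → ℝ)
    (f : ∀ k, (Fin (p k + 1) → ℝ) → ℝ → ℝ)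
    (X : ∀ k, Fin (m k * n k) → Ω k → Fin (p k + 1) → ℝ)
    (Y : ∀ k, Fin (m k * n k) → Ω k → ℝ)
    (hmodel : ∀ k, IsLinearQuantileModel τ (ν k) (βstar k) (f k))
    (hsample : ∀ k, IsIIDSample (P k) (ν k) (X k) (Y k))
    (hN : Tendsto (fun k => m k * n k) atTop atTop)
    (hs : ∀ k, s k = (slopeSupport (βstar k)).card)
    (hs_pos : ∀ k, 1 ≤ s k)
    -- the kernel
    (K : ℝ → ℝ) (hK : IsSmoothingKernel K)
    -- the conditional density
    (f₁ f₂ l₀ : ℝ) (hf₁ : 0 < f₁) (hf₁₂ : f₁ ≤ f₂)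
    (hdens : ∀ k, CondDensityRegular (ν k) (f k) f₁ f₂ l₀)
    -- sub-Gaussian covariates
    (c₁ : ℝ) (hc₁ : 0 < c₁) (hsub : ∀ k, SubGaussianCovariates (ν k) c₁)
    -- irrepresentable condition and eigenvalue bounds
    (α : ℝ) (hα : 0 < α ∧ α < 1)
    (hirr : ∀ k, Irrepresentable (populationHessian (ν k) (f k)) (βstar k) α)
    (lamLo lamHi : ℝ) (hlamLo : 0 < lamLo) (hlamHi : 0 < lamHi)
    (heig : ∀ k, EigenvaluesIn (populationHessian (ν k) (f k)) lamLo lamHi)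
    -- growth conditions
    (growthP : ℝ) (hgrowthP : 0 < growthP)
    (hp : (fun k => (p k : ℝ)) =O[atTop] fun k => ((m k * n k : ℕ) : ℝ) ^ growthP)
    (c : ℝ) (hc : 0 < c ∧ c < 1)
    (hn : ∀ᶠ k in atTop, ((m k * n k : ℕ) : ℝ) ^ c ≤ (n k : ℝ))
    (r : ℝ) (hr : 0 ≤ r ∧ r < 1 / 3)
    (hsn : (fun k => (s k : ℝ)) =O[atTop] fun k => (n k : ℝ) ^ r)
    -- the initial estimator
    (a : ℕ → ℝ) (ha : SameOrder a fun k => initialRate (s k) (m k * n k) (n k))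
    (βinit : ∀ k, Ω k → Fin (p k + 1) → ℝ) (hβinit : ∀ k, Measurable (βinit k))
    (hinit : ∀ ε > 0, ∃ M : ℝ, ∀ᶠ k in atTop,
      P k {ω | M * a k < l2norm (βinit k ω - βstar k)} ≤ ENNReal.ofReal ε)
    (hinit_supp : Tendsto
      (fun k => P k {ω | slopeSupport (βinit k ω) ⊆ slopeSupport (βstar k)}) atTop (𝓝 1))
    -- the bandwidths
    (h b : ℕ → ℝ)
    (hh : SameOrder h fun k => bandwidthRate (s k) (m k * n k))
    (hb : SameOrder b fun k => bandwidthRate (s k) (n k)) :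
    -- the constant `C` is large in terms of the tolerated probability
    (∀ ε > 0, ∃ C₀ > 0, ∀ C ≥ C₀, ∃ M : ℝ, ∀ᶠ k in atTop,
      P k {ω | ¬ OneStepWithin K τ (h k) (b k) (penaltyLevel C (a k) (s k) (m k * n k) (n k))
          (βinit k ω) (fun i => X k i ω) (fun i => Y k i ω) (βstar k)
          (M * oneStepRate (a k) (s k) (m k * n k) (n k))} ≤ ENNReal.ofReal ε) ∧
    -- one constant `C` for all probabilities, if the `O_P` bound on the initial error holds
    -- with one constant, with probability tending to one
    ((∃ M₀ : ℝ, Tendsto (fun k => P k {ω | l2norm (βinit k ω - βstar k) ≤ M₀ * a k})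
        atTop (𝓝 1)) →
      ∃ C₀ > 0, ∀ C ≥ C₀, ∀ ε > 0, ∃ M : ℝ, ∀ᶠ k in atTop,
        P k {ω | ¬ OneStepWithin K τ (h k) (b k) (penaltyLevel C (a k) (s k) (m k * n k) (n k))
            (βinit k ω) (fun i => X k i ω) (fun i => Y k i ω) (βstar k)
            (M * oneStepRate (a k) (s k) (m k * n k) (n k))} ≤ ENNReal.ofReal ε) := by
  have core := eventually_measure_not_oneStepWithin_le (P := P) hτ hmodel hsample hN hs hs_pos hK
    hf₁ hf₁₂ hdens hc₁ hsub hlamLo hlamHi heig hgrowthP hp hc.1 hn hr.2 hsn ha (h := h) hb βinit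
  have hsupp : ∀ ε > 0, ∀ᶠ k in atTop,
      P k {ω | slopeSupport (βinit k ω) ⊆ slopeSupport (βstar k)}ᶜ ≤ ENNReal.ofReal ε :=
    fun ε hε => eventually_measure_compl_le
      (fun k => measurableSet_slopeSupport_subset (hβinit k) _) hinit_supp hε
  -- three failures: of the support, of the initial error bound, of the one-step estimator
  have union : ∀ (C M M' ε : ℝ), 0 < ε →
      (∀ᶠ k in atTop, P k {ω | M * a k < l2norm (βinit k ω - βstar k)} ≤ ENNReal.ofReal (ε / 3)) →
      (∀ᶠ k in atTop, P k {ω | slopeSupport (βinit k ω) ⊆ slopeSupport (βstar k) ∧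
          l2norm (βinit k ω - βstar k) ≤ M * a k ∧
          ¬ OneStepWithin K τ (h k) (b k) (penaltyLevel C (a k) (s k) (m k * n k) (n k))
            (βinit k ω) (fun i => X k i ω) (fun i => Y k i ω) (βstar k)
            (M' * oneStepRate (a k) (s k) (m k * n k) (n k))} ≤ ENNReal.ofReal (ε / 3)) →
      ∀ᶠ k in atTop,
        P k {ω | ¬ OneStepWithin K τ (h k) (b k) (penaltyLevel C (a k) (s k) (m k * n k) (n k))
            (βinit k ω) (fun i => X k i ω) (fun i => Y k i ω) (βstar k)
            (M' * oneStepRate (a k) (s k) (m k * n k) (n k))} ≤ ENNReal.ofReal ε := by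
    intro C M M' ε hε hM hone
    filter_upwards [hM, hone, hsupp (ε / 3) (by positivity)] with k e₁ e₂ e₃
    calc _ ≤ P k ({ω | slopeSupport (βinit k ω) ⊆ slopeSupport (βstar k)}ᶜ ∪
          {ω | M * a k < l2norm (βinit k ω - βstar k)} ∪ _) := measure_mono fun ω hω => by
            by_cases w₁ : slopeSupport (βinit k ω) ⊆ slopeSupport (βstar k)
            · by_cases w₂ : l2norm (βinit k ω - βstar k) ≤ M * a k
              · exact Or.inr ⟨w₁, w₂, hω⟩
              · exact Or.inl (Or.inr (not_le.1 w₂))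
            · exact Or.inl (Or.inl w₁)
      _ ≤ ENNReal.ofReal (ε / 3) + ENNReal.ofReal (ε / 3) + ENNReal.ofReal (ε / 3) :=
          (measure_union_le _ _).trans (add_le_add
            ((measure_union_le _ _).trans (add_le_add e₃ e₁)) e₂)
      _ = ENNReal.ofReal ε := by
          rw [← ENNReal.ofReal_add (by positivity) (by positivity),
            ← ENNReal.ofReal_add (by positivity) (by positivity)]
          congr 1
          ring
  refine ⟨fun ε hε => ?_, fun ⟨M₀, hM₀⟩ => ?_⟩
  · obtain ⟨M, hM⟩ := hinit (ε / 3) (by positivity)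
    obtain ⟨C₀, hC₀, hcore⟩ := core M
    refine ⟨C₀, hC₀, fun C hC => ?_⟩
    obtain ⟨M', hM'⟩ := hcore C hC
    exact ⟨M', union C M M' ε hε hM (hM' (ε / 3) (by positivity))⟩
  · obtain ⟨C₀, hC₀, hcore⟩ := core M₀
    refine ⟨C₀, hC₀, fun C hC ε hε => ?_⟩
    obtain ⟨M', hM'⟩ := hcore C hC
    refine ⟨M', union C M₀ M' ε hε ?_ (hM' (ε / 3) (by positivity))⟩
    refine (eventually_measure_compl_le (fun k => measurableSet_le
      (measurable_l2norm_sub (hβinit k) (βstar k)) measurable_const) hM₀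
      (by positivity : 0 < ε / 3)).mono fun k hk => (measure_mono fun ω hω => ?_).trans hk
    exact fun hle => absurd (Set.mem_ofPred_eq ▸ hω) (not_lt.2 hle)
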